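/- An instance $(G,P)$ of \textsc{Edge Disjoint Paths} (EDP) consists of a finite simple graph $G$ and a set $P$ of two-element subsets of $V(G)$ (terminal pairs). It is a YES-instance if $G$ contains pairwise edge-disjoint paths, one for each pair in $P$, such that the path of a pair connects the two vertices of the pair. A feedback edge set of $G$ is a set $X\subseteq E(G)$ such that $G-X$ is a forest, and $\mathrm{fes}(G)$ is the minimum size of a feedback edge set. **Theorem.** (1) EDP admits a linear kernel parameterized by the feedback edge set number: there are a polynomial-time algorithm and a constant $c$ such that the algorithm transforms every instance $(G,P)$ into an equivalent instance $(G',P')$ (one is a YES-instance if and only if the other is) with $$|V(G')|+|E(G')|+|P'|+\mathrm{fes}(G')\le c\,(\mathrm{fes}(G)+1),$$ and moreover $|V(G')|\le 11\,\mathrm{fes}(G)-2$ whenever $\mathrm{fes}(G)\ge 1$. (2) Let $(G,P)$ be an instance with $G$ connected such that each vertex lies in at most one terminal pair, each terminal has degree $1$, and the two vertices of a terminal pair are not adjacent. Let $X$ be a minimum feedback edge set of $G$ with $|X|\ge 1$. Consider the following reduction rules for $(G,P,X)$, where $Y$ is the set of endpoints of the edges in $X$, and where, for a vertex set $L$, $P_L$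 is the set of pairs of $P$ inside $L$ and a terminal in $L$ is called unmatched if its partner is not in $L$. * (R1) Delete a non-terminal that has exactly one neighbour. * (R2) If $N(v)=\{a,b\}$ with $a\ne b$ and $ab\notin E(G)$, delete $v$ and add the edge $ab$; if $av$ or $vb$ was in $X$, put $ab$ into $X$ (in place of the edges at $v$). * (R3) Let $L$ be a connected component of $G-Y$ that is joined to $Y$ by exactly one edge $\ell y$, with $\ell\in L$ and $y\in Y$. (a) If $L$ has no unmatched terminal and $(G[L],P_L)$ is a YES-instance, delete $L$ and $P_L$. (b) If $L$ has exactly one unmatched terminal $s$ and edge-disjoint paths in $G[L]$ connect all pairs of $P_L$ and also $s$ to $\ell$ (the last path being trivial if $s=\ell$), then, unless $L=\{s\}$, delete $P_L$ and all vertices of $L$ other than $s$, and add the edge $ys$. (c) Otherwise, reject. * (R4) If $\{a,b\}\in P$ and $a,b$ are leaves of $G$ with the same neighbour, delete $a$, $b$ and this pair. Then, whenever a sequence of applications of these rules starting from $(G,P,X)$ ends in $(G^*,P^*,X^*)$ to which no rule applies (including the rejection (R3)(c)), we have $|X^*|=|X|$, and either $|V(G^*)|\le 11|X|-2$, or the forest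 $G^*-X^*$ has more than $4|X|$ leaves (the case in which the reduction procedure rejects). -/

import Mathlib

namespace EDP

/-! ### Polynomial time

A small `while` language over binary trees, with a big-step semantics that counts cost. Every
elementary operation is charged the size of the data it handles, so the size of an output never
exceeds the cost of computing it, and the model is polynomially equivalent to Turing machines. -/

/-- Data: binary trees with unlabelled leaves. -/
inductive Data : Type
  | leaf : Data
  | node : Data → Data → Data

/-- The number of nodes of a tree, leaves included. -/
def Data.size : Data → ℕ
  | .leaf => 1
  | .node a b => a.size + b.size + 1

/-- Programs; each program transforms one piece of data. -/
inductive Prog : Type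
  /-- leave the data unchanged -/
  | skip : Prog
  /-- return the tree `leaf` -/
  | nil : Prog
  /-- return the left subtree -/
  | left : Prog
  /-- return the right subtree -/
  | right : Prog
  /-- run both programs on the input and join the two results by a node -/
  | pair : Prog → Prog → Prog
  /-- `seq f g` runs `f`, then `g` on the result of `f` -/
  | seq : Prog → Prog → Prog
  /-- `cond c f g` runs `f` if `c` returns a node, and `g` if `c` returns a leaf -/
  | cond : Prog → Prog → Prog → Prog
  /-- `loop c f`: as long as `c` returns a node, replace the data by the result of `f` -/
  | loop : Prog → Prog → Prog

/-- `Runs p x y t`: the program `p` halts on input `x` with output `y` at total cost `t`. -/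
inductive Runs : Prog → Data → Data → ℕ → Prop
  | skip (x : Data) : Runs .skip x x x.size
  | nil (x : Data) : Runs .nil x .leaf x.size
  | left_leaf : Runs .left .leaf .leaf Data.leaf.size
  | left_node (a b : Data) : Runs .left (.node a b) a (Data.node a b).size
  | right_leaf : Runs .right .leaf .leaf Data.leaf.size
  | right_node (a b : Data) : Runs .right (.node a b) b (Data.node a b).size
  | pair {f g : Prog} {x y z : Data} {s t : ℕ} :
      Runs f x y s → Runs g x z t → Runs (.pair f g) x (.node y z) (s + t + x.size)
  | seq {f g : Prog} {x y z : Data} {s t : ℕ} :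
      Runs f x y s → Runs g y z t → Runs (.seq f g) x z (s + t)
  | cond_node {c f g : Prog} {x a b y : Data} {s t : ℕ} :
      Runs c x (.node a b) s → Runs f x y t → Runs (.cond c f g) x y (s + t + x.size)
  | cond_leaf {c f g : Prog} {x y : Data} {s t : ℕ} :
      Runs c x .leaf s → Runs g x y t → Runs (.cond c f g) x y (s + t + x.size)
  | loop_stop {c f : Prog} {x : Data} {s : ℕ} :
      Runs c x .leaf s → Runs (.loop c f) x x (s + x.size)
  | loop_step {c f : Prog} {x a b y z : Data} {s t r : ℕ} :
      Runs c x (.node a b) s → Runs f x y t → Runs (.loop c f) y z r →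
        Runs (.loop c f) x z (s + t + r + x.size)

/-- `f` is computed, relative to the encodings `ea` and `eb`, by a program whose cost is bounded
by a polynomial in the size of the encoded input. -/
def PolyTimeComputable {α β : Type*} (ea : α → Data) (eb : β → Data) (f : α → β) : Prop :=
  ∃ (p : Prog) (q : Polynomial ℕ), ∀ x : α,
    ∃ t : ℕ, Runs p (ea x) (eb (f x)) t ∧ t ≤ q.eval (ea x).size

/-- Encoding of a truth value. -/
def Data.ofBool : Bool → Data
  | false => .leaf
  | true => .node .leaf .leaf

/-- Encoding of a list. -/
def Data.ofList : List Data → Data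
  | [] => .leaf
  | a :: l => .node a (Data.ofList l)

open Classical in
/-- The `n × n` matrix of truth values of a binary relation on `Fin n`, row by row. -/
noncomputable def encodeRel {n : ℕ} (R : Fin n → Fin n → Prop) : Data :=
  Data.ofList (List.ofFn fun i => Data.ofList (List.ofFn fun j => Data.ofBool (decide (R i j))))

/-! ### Edge disjoint paths and feedback edge sets -/

/-- There are pairwise edge disjoint paths of `G`, one for every pair in `P`, such that the path
of a pair connects the two elements of the pair. -/
def HasSolution {V : Type*} (G : SimpleGraph V) (P : Set (Sym2 V)) : Prop :=
  ∃ (a b : P → V) (w : ∀ p : P, G.Walk (a p) (b p)),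
    (∀ p : P, s(a p, b p) = (p : Sym2 V)) ∧ (∀ p : P, (w p).IsPath) ∧
      ∀ p q : P, p ≠ q → List.Disjoint (w p).edges (w q).edges

/-- An instance of the edge disjoint paths problem: a finite simple graph, with vertices numbered
`0, …, n - 1`, and a set of terminal pairs, that is, of two-element sets of vertices. -/
structure Instance where
  n : ℕ
  G : SimpleGraph (Fin n)
  P : Set (Sym2 (Fin n))
  pairs : ∀ p ∈ P, ¬ p.IsDiag

/-- The instance is a YES-instance. -/
def Instance.IsYes (I : Instance) : Prop := HasSolution I.G I.P

/-- An instance is given by the adjacency matrix of its graph and the matrix of its pairs. -/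
noncomputable def Instance.encode (I : Instance) : Data :=
  .node (encodeRel I.G.Adj) (encodeRel fun i j => s(i, j) ∈ I.P)

/-- `X` is a set of edges of `G` whose deletion leaves a forest. -/
def IsFeedbackEdgeSet {V : Type*} (G : SimpleGraph V) (X : Set (Sym2 V)) : Prop :=
  X ⊆ G.edgeSet ∧ (G.deleteEdges X).IsAcyclic

/-- The feedback edge set number of a finite graph. -/
noncomputable def fes {V : Type*} [Finite V] (G : SimpleGraph V) : ℕ :=
  sInf {k : ℕ | ∃ X : Set (Sym2 V), IsFeedbackEdgeSet G X ∧ X.ncard = k}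

/-! ### The reduction rules -/

/-- `v` occurs in a terminal pair. -/
def IsTerminal {V : Type*} (P : Set (Sym2 V)) (v : V) : Prop := ∃ p ∈ P, v ∈ p

/-- Every vertex occurs in at most one terminal pair, every terminal has degree one, and the two
elements of a terminal pair are distinct and not adjacent. -/
structure IsNormalized {V : Type*} (G : SimpleGraph V) (P : Set (Sym2 V)) : Prop where
  pairs : ∀ p ∈ P, ¬ p.IsDiag
  unique : ∀ p ∈ P, ∀ q ∈ P, ∀ v : V, v ∈ p → v ∈ q → p = q
  degree_one : ∀ v : V, IsTerminal P v → (G.neighborSet v).ncard = 1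
  not_adj : ∀ a b : V, s(a, b) ∈ P → ¬ G.Adj a b

/-- The subgraph of `G` induced on `A`, with the vertices outside `A` kept as isolated points of
the ambient type. -/
def restrict {V : Type*} (G : SimpleGraph V) (A : Set V) : SimpleGraph V :=
  (G.induce A).spanningCoe

/-- An instance together with a set `X` of edges, as it is transformed by the reduction rules.
The current graph has vertex set `verts`, a subset of the vertex set `V` of the original graph. -/
structure State (V : Type*) where
  verts : Set V
  G : SimpleGraph V
  P : Set (Sym2 V)
  X : Set (Sym2 V)

namespace State

variable {V : Type*}

/-- The vertices incident to an edge of `X`. -/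
def Y (S : State V) : Set V := {v | ∃ e ∈ S.X, v ∈ e}

/-- The graph without the edges in `X`. -/
def Q (S : State V) : SimpleGraph V := S.G.deleteEdges S.X

/-- The leaves of `Q`. -/
def leaves (S : State V) : Set V := {v ∈ S.verts | (S.Q.neighborSet v).ncard = 1}

/-- `L` is (the vertex set of) a connected component of the graph without the vertices in `Y`. -/
def IsComponent (S : State V) (L : Set V) : Prop :=
  ∃ C : (S.G.induce (S.verts \ S.Y)).ConnectedComponent, L = Subtype.val '' C.supp

/-- `L` is a connected component of the graph without `Y`, and there is exactly one edge between
`L` and `Y`, namely the one from `l` in `L` to `y` in `Y`. -/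
def IsPendant (S : State V) (L : Set V) (l y : V) : Prop :=
  S.IsComponent L ∧ l ∈ L ∧ y ∈ S.Y ∧ S.G.Adj l y ∧
    ∀ l' ∈ L, ∀ y' ∈ S.Y, S.G.Adj l' y' → l' = l ∧ y' = y

/-- The terminal pairs with both elements in `L`. -/
def inner (S : State V) (L : Set V) : Set (Sym2 V) := {p ∈ S.P | ∀ v ∈ p, v ∈ L}

/-- The terminals in `L` that are paired with a vertex outside `L`. -/
def unmatched (S : State V) (L : Set V) : Set V := {s ∈ L | ∃ t, t ∉ L ∧ s(s, t) ∈ S.P}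

/-- The component `L` admits the deletion of all of its vertices. -/
def DropsAll (S : State V) (L : Set V) : Prop :=
  S.unmatched L = ∅ ∧ HasSolution (restrict S.G L) (S.inner L)

/-- The component `L`, attached at `l`, admits the deletion of all of its vertices but `s`. -/
def DropsTo (S : State V) (L : Set V) (l s : V) : Prop :=
  S.unmatched L = {s} ∧ HasSolution (restrict S.G L) (S.inner L ∪ {s(s, l)})

open Classical in
/-- One application of a reduction rule that transforms the instance. -/
inductive Step : State V → State V → Prop
  /-- Delete a non-terminal with exactly one neighbour. -/
  | deleteLeaf (S : State V) (v : V) (hv : v ∈ S.verts) (hdeg : (S.G.neighborSet v).ncard = 1)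
      (hterm : ¬ IsTerminal S.P v) :
      Step S
        { verts := S.verts \ {v}
          G := restrict S.G {v}ᶜ
          P := S.P
          X := S.X \ {e | v ∈ e} }
  /-- Replace a vertex with exactly two neighbours, which are not adjacent, by an edge. -/
  | suppress (S : State V) (v a b : V) (hv : v ∈ S.verts) (hab : a ≠ b)
      (hN : S.G.neighborSet v = {a, b}) (hadj : ¬ S.G.Adj a b) :
      Step S
        { verts := S.verts \ {v}
          G := restrict S.G {v}ᶜ ⊔ SimpleGraph.edge a b
          P := S.P
          X := if s(a, v) ∈ S.X ∨ s(v, b) ∈ S.X then (S.X \ {e | v ∈ e}) ∪ {s(a, b)} else S.X }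
  /-- Delete a pendant component that has no unmatched terminal and is solvable. -/
  | pruneAll (S : State V) (L : Set V) (l y : V) (hL : S.IsPendant L l y) (h : S.DropsAll L) :
      Step S
        { verts := S.verts \ L
          G := restrict S.G Lᶜ
          P := S.P \ S.inner L
          X := S.X }
  /-- Replace a pendant component that has exactly one unmatched terminal `s`, and that is
  solvable together with a path from `s` to `l`, by `s`; the component is not `s` alone. -/
  | pruneTo (S : State V) (L : Set V) (l y s : V) (hL : S.IsPendant L l y)
      (h : S.DropsTo L l s) (hne : L ≠ {s}) :
      Step S
        { verts := S.verts \ (L \ {s})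
          G := restrict S.G (L \ {s})ᶜ ⊔ SimpleGraph.edge y s
          P := S.P \ S.inner L
          X := S.X }
  /-- Delete a terminal pair of two leaves with the same neighbour. -/
  | deletePair (S : State V) (a b : V) (hP : s(a, b) ∈ S.P) (hab : a ≠ b)
      (hdeg : (S.G.neighborSet a).ncard = 1) (hN : S.G.neighborSet a = S.G.neighborSet b) :
      Step S
        { verts := S.verts \ {a, b}
          G := restrict S.G {a, b}ᶜ
          P := S.P \ {s(a, b)}
          X := S.X }

/-- Pruning rejects the instance: there is a pendant component that can neither be deleted nor be
replaced by a single terminal. -/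
def PruneRejects (S : State V) : Prop :=
  ∃ (L : Set V) (l y : V), S.IsPendant L l y ∧ ¬ S.DropsAll L ∧ ¬ ∃ s, S.DropsTo L l s

/-- No reduction rule applies any more. -/
def Exhausted (S : State V) : Prop := (∀ T : State V, ¬ Step S T) ∧ ¬ S.PruneRejects

end State

end EDP

/-!
The kernel is obtained in the larger class of multigraphs with demands. A solution of such an
instance is a colouring of the edges in which the endpoints of every demand are connected by edges
of its own colour (`Solvable`); for simple graphs this is the same as a family of edge disjoint
paths (`HasSolution.of_coloring`, `HasSolution.exists_coloring`). Allowing parallel edges makes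
three rules available. An edge and a demand with the same endpoints can be removed
(`solvable_drop_drop`); a vertex can be identified with a neighbour if at least half of the edges
and demands at the vertex are edges to this neighbour (`solvable_contract`); and an edge can be
deleted if, at both of its endpoints, the edges outnumber the demands by at most one
(`solvable_drop`). Every rule decreases the number of edges, and none increases the difference of
the number of edges and the rank of the graph. At the beginning this difference is at most the
feedback edge set number `k`, because incidence vectors of the edges of a forest are linearly
independent (`length_le_rk_add_fes`).

If no rule applies and no vertex has more demands than edges (in a YES-instance this is so, by
`Solvable.deg_le`), then there are no vertices of degree one, and the vertices of degree two are
pairwise not adjacent and have two distinct neighbours. Counting edges gives at most `6 * k - 6`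
edges (`Stuck.size_le`). To return to a simple graph, the edges whose endpoints both have degree at
least three are subdivided, and each demand is moved to a new leaf at its first endpoint, so that
distinct demands yield distinct pairs (`solvable_iff_names`). The same count bounds the number of
vertices obtained by `11 * k - 11`. Polynomial-time computability of all this is derived from a
small calculus of functions on lists (`PT`), whose main tool is a left fold with results of
polynomially bounded size (`PT.list_foldl`).

For the second part, a minimum feedback edge set `X` of a connected graph is the complement of a
spanning tree (`State.inv_of_minimum`), and every reduction rule preserves this as well as the size
of `X` (`State.Step.inv`). In an exhausted instance, a vertex of degree two in the tree that is not
an endpoint of an edge in `X` has two adjacent neighbours, as it would be suppressed otherwise, and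
the edge between them belongs to `X`; since a tree has no cycle of length four, different vertices
of this kind use different edges of `X`. So at most `3 * X.ncard` vertices have degree two in the
tree, and the degree sum of a tree bounds the number of vertices in terms of the number of leaves
(`State.Inv.ncard_verts_le`).
-/


namespace EDP

/-! ### A calculus of polynomial-time functions -/

/-- Types whose elements are represented by data. -/
class Enc (α : Type) where
  /-- The representation of an element. -/
  enc : α → Data

open Enc

instance : Enc Bool := ⟨Data.ofBool⟩

instance {α β : Type} [Enc α] [Enc β] : Enc (α × β) := ⟨fun p => .node (enc p.1) (enc p.2)⟩

instance {α : Type} [Enc α] : Enc (List α) := ⟨fun l => Data.ofList (l.map enc)⟩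

instance {α : Type} [Enc α] : Enc (Option α) :=
  ⟨fun o => match o with
    | none => .leaf
    | some a => .node (enc a) .leaf⟩

/-- Natural numbers are encoded in unary. -/
instance : Enc ℕ := ⟨fun n => Data.ofList (List.replicate n .leaf)⟩

/-- The size of the representation of `a`. -/
def esize {α : Type} [Enc α] (a : α) : ℕ := (enc a).size

/-- Polynomial-time computability with respect to the standard representations. -/
def PT {α β : Type} [Enc α] [Enc β] (f : α → β) : Prop :=
  PolyTimeComputable (enc : α → Data) (enc : β → Data) f

lemma Data.size_pos (x : Data) : 1 ≤ x.size := by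
  cases x <;> simp [Data.size]

/-- Cost is at least the size of the output; this makes polynomial-time functions composable. -/
lemma Runs.size_le {p : Prog} {x y : Data} {t : ℕ} (h : Runs p x y t) : y.size ≤ t := by
  induction h with
  | nil x => exact x.size_pos
  | left_leaf | right_leaf => exact le_rfl
  | left_node | right_node => simp only [Data.size]; omega
  | @pair f g x => have := x.size_pos; simp only [Data.size]; omega
  | _ => omega

lemma polynomial_eval_mono (q : Polynomial ℕ) {m n : ℕ} (h : m ≤ n) : q.eval m ≤ q.eval n := by
  rw [Polynomial.eval_eq_sum, Polynomial.eval_eq_sum]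
  exact Finset.sum_le_sum fun i _ => Nat.mul_le_mul_left _ (Nat.pow_le_pow_left h i)

namespace PT

variable {α β γ δ σ : Type} [Enc α] [Enc β] [Enc γ] [Enc δ] [Enc σ]

lemma exists_size_le {f : α → β} (hf : PT f) :
    ∃ q : Polynomial ℕ, ∀ a, esize (f a) ≤ q.eval (esize a) := by
  obtain ⟨p, q, h⟩ := hf
  refine ⟨q, fun a => ?_⟩
  obtain ⟨t, ht, hq⟩ := h a
  exact ht.size_le.trans hq

lemma esize_pos (a : α) : 1 ≤ esize a := Data.size_pos _

lemma esize_nil : esize ([] : List α) = 1 := rfl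

lemma esize_pair (a : α) (b : β) : esize (a, b) = esize a + esize b + 1 := rfl

lemma esize_cons (a : α) (l : List α) : esize (a :: l) = esize a + esize l + 1 := rfl

lemma length_lt_esize (l : List α) : l.length < esize l := by
  induction l with
  | nil => simp [esize_nil]
  | cons a l ih => rw [esize_cons, List.length_cons]; omega

lemma esize_append (l l' : List α) : esize (l ++ l') + 1 = esize l + esize l' := by
  induction l with
  | nil => simp [esize_nil]; omega
  | cons a l ih => rw [List.cons_append, esize_cons, esize_cons]; omega

lemma esize_le_of_mem {a : α} {l : List α} (h : a ∈ l) : esize a ≤ esize l := by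
  induction l with
  | nil => simp at h
  | cons b l ih =>
    rw [esize_cons]
    rcases List.mem_cons.1 h with rfl | h
    · omega
    · have := ih h; omega

lemma esize_le_of_forall (l : List α) (C : ℕ) (h : ∀ a ∈ l, esize a ≤ C) :
    esize l ≤ l.length * (C + 1) + 1 := by
  induction l with
  | nil => simp [esize_nil]
  | cons a l ih =>
    rw [esize_cons, List.length_cons, Nat.succ_mul]
    have := ih fun b hb => h b (List.mem_cons_of_mem _ hb)
    have := h a List.mem_cons_self
    omega

lemma esize_nat (n : ℕ) : esize n = 2 * n + 1 := by
  change (Data.ofList (List.replicate n .leaf)).size = _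
  induction n with
  | zero => rfl
  | succ n ih => simp only [List.replicate_succ, Data.ofList, Data.size, ih]; omega

lemma of_eq {f g : α → β} (hf : PT f) (h : ∀ a, f a = g a) : PT g := by
  rwa [← funext h]

lemma comp {f : β → γ} {g : α → β} (hf : PT f) (hg : PT g) : PT (fun a => f (g a)) := by
  obtain ⟨p, q, h⟩ := hf
  obtain ⟨p', q', h'⟩ := hg
  refine ⟨.seq p' p, q' + q.comp q', fun a => ?_⟩
  obtain ⟨t', ht', hq'⟩ := h' a
  obtain ⟨t, ht, hq⟩ := h (g a)
  refine ⟨t' + t, .seq ht' ht, ?_⟩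
  have := polynomial_eval_mono q (ht'.size_le.trans hq')
  simp only [Polynomial.eval_add, Polynomial.eval_comp]
  omega

protected lemma id : PT (fun a : α => a) :=
  ⟨.skip, Polynomial.X, fun a => ⟨_, .skip _, by simp⟩⟩

lemma const (b : β) : PT (fun _ : α => b) := by
  -- the program that builds `d` from any input depends on `d`, which is fixed
  have key : ∀ d : Data, ∃ (p : Prog) (q : Polynomial ℕ), ∀ x : Data,
      ∃ t, Runs p x d t ∧ t ≤ q.eval x.size := by
    intro d
    induction d with
    | leaf => exact ⟨.nil, Polynomial.X, fun x => ⟨_, .nil x, by simp⟩⟩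
    | node a b iha ihb =>
      obtain ⟨p, q, h⟩ := iha
      obtain ⟨p', q', h'⟩ := ihb
      refine ⟨.pair p p', q + q' + Polynomial.X, fun x => ?_⟩
      obtain ⟨t, ht, hq⟩ := h x
      obtain ⟨t', ht', hq'⟩ := h' x
      exact ⟨_, .pair ht ht', by simp; omega⟩
  obtain ⟨p, q, h⟩ := key (enc b)
  exact ⟨p, q, fun a => h (enc a)⟩

lemma fst : PT (fun p : α × β => p.1) :=
  ⟨.left, Polynomial.X, fun a => ⟨_, .left_node _ _, by simp [enc]⟩⟩

lemma snd : PT (fun p : α × β => p.2) :=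
  ⟨.right, Polynomial.X, fun a => ⟨_, .right_node _ _, by simp [enc]⟩⟩

lemma pair {f : α → β} {g : α → γ} (hf : PT f) (hg : PT g) : PT (fun a => (f a, g a)) := by
  obtain ⟨p, q, h⟩ := hf
  obtain ⟨p', q', h'⟩ := hg
  refine ⟨.pair p p', q + q' + Polynomial.X, fun a => ?_⟩
  obtain ⟨t, ht, hq⟩ := h a
  obtain ⟨t', ht', hq'⟩ := h' a
  exact ⟨_, .pair ht ht', by simp; omega⟩

lemma cond {c : α → Bool} {f g : α → β} (hc : PT c) (hf : PT f) (hg : PT g) :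
    PT (fun a => if c a = true then f a else g a) := by
  obtain ⟨pc, qc, hc⟩ := hc
  obtain ⟨p, q, h⟩ := hf
  obtain ⟨p', q', h'⟩ := hg
  refine ⟨.cond pc p p', qc + q + q' + Polynomial.X, fun a => ?_⟩
  obtain ⟨s, hs, hqs⟩ := hc a
  obtain ⟨t, ht, hq⟩ := h a
  obtain ⟨t', ht', hq'⟩ := h' a
  cases hca : c a
  · rw [hca] at hs
    refine ⟨s + t' + (enc a).size, ?_, by simp; omega⟩
    have e : (if c a = true then f a else g a) = g a := by simp [hca]
    simpa only [e] using Runs.cond_leaf hs ht'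
  · rw [hca] at hs
    refine ⟨s + t + (enc a).size, ?_, by simp; omega⟩
    have e : (if c a = true then f a else g a) = f a := by simp [hca]
    simpa only [e] using Runs.cond_node hs ht

lemma not {c : α → Bool} (hc : PT c) : PT (fun a => !c a) :=
  (hc.cond (const false) (const true)).of_eq fun a => by cases c a <;> rfl

lemma and {c d : α → Bool} (hc : PT c) (hd : PT d) : PT (fun a => c a && d a) :=
  (hc.cond hd (const false)).of_eq fun a => by cases c a <;> rfl

lemma or {c d : α → Bool} (hc : PT c) (hd : PT d) : PT (fun a => c a || d a) :=
  (hc.cond (const true) hd).of_eq fun a => by cases c a <;> rfl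

/-! ### Options and lists -/

lemma option_elim {f : α → Option β} {g : α → γ} {h : α → β → γ} (hf : PT f) (hg : PT g)
    (hh : PT (fun p : α × β => h p.1 p.2)) : PT (fun a => (f a).elim (g a) (h a)) := by
  have key : PT (fun p : α × Option β => p.2.elim (g p.1) (h p.1)) := by
    obtain ⟨pg, qg, hg⟩ := hg
    obtain ⟨ph, qh, hh⟩ := hh
    refine ⟨.cond .right (.seq (.pair .left (.seq .right .left)) ph) (.seq .left pg),
      7 * Polynomial.X + qg + qh, ?_⟩
    rintro ⟨a, o⟩
    cases o with
    | none =>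
      obtain ⟨t, ht, hq⟩ := hg a
      refine ⟨_, .cond_leaf (.right_node _ _) (.seq (.left_node _ _) ht), ?_⟩
      have : (enc a).size ≤ (enc (a, (none : Option β))).size := by
        change esize a ≤ esize (a, (none : Option β)); rw [esize_pair]; omega
      have := polynomial_eval_mono qg this
      change (enc (a, (none : Option β))).size + ((enc (a, (none : Option β))).size + t) +
        (enc (a, (none : Option β))).size ≤ _
      simp only [Polynomial.eval_add, Polynomial.eval_mul, Polynomial.eval_X,
        Polynomial.eval_ofNat]
      omega
    | some b =>
      obtain ⟨t, ht, hq⟩ := hh (a, b)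
      refine ⟨_, .cond_node (.right_node _ _)
        (.seq (.pair (.left_node _ _) (.seq (.right_node _ _) (.left_node _ _))) ht), ?_⟩
      have : (enc (a, b)).size ≤ (enc (a, Option.some b)).size := by
        simp only [enc, Data.size]; omega
      have := polynomial_eval_mono qh this
      have h3 : (Data.node (enc b) .leaf).size ≤ (enc (a, Option.some b)).size := by
        simp only [enc, Data.size]; omega
      change (enc (a, Option.some b)).size + ((enc (a, Option.some b)).size +
        ((enc (a, Option.some b)).size + (Data.node (enc b) .leaf).size) +
        (enc (a, Option.some b)).size + t) + (enc (a, Option.some b)).size ≤ _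
      simp only [Polynomial.eval_add, Polynomial.eval_mul, Polynomial.eval_X,
        Polynomial.eval_ofNat]
      omega
  exact key.comp (PT.id.pair hf)

lemma list_cons {f : α → β} {g : α → List β} (hf : PT f) (hg : PT g) :
    PT (fun a => f a :: g a) :=
  hf.pair hg

lemma list_head? {f : α → List β} (hf : PT f) : PT (fun a => (f a).head?) := by
  refine PT.comp (f := List.head?) ?_ hf
  refine ⟨.cond .skip (.pair .left .nil) .skip, 5 * Polynomial.X, fun l => ?_⟩
  cases l with
  | nil => exact ⟨_, .cond_leaf (.skip _) (.skip _), by simp [enc]; omega⟩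
  | cons b l =>
    refine ⟨_, .cond_node (.skip _) (.pair (.left_node _ _) (.nil _)), ?_⟩
    simp only [Polynomial.eval_mul, Polynomial.eval_X, Polynomial.eval_ofNat]
    change (enc (b :: l)).size + ((enc (b :: l)).size + (enc (b :: l)).size +
      (enc (b :: l)).size) + (enc (b :: l)).size ≤ _
    omega

lemma list_tail {f : α → List β} (hf : PT f) : PT (fun a => (f a).tail) := by
  refine PT.comp (f := List.tail) ?_ hf
  refine ⟨.right, Polynomial.X, fun l => ?_⟩
  cases l with
  | nil => exact ⟨_, .right_leaf, by simp [enc, Data.ofList]⟩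
  | cons b l => exact ⟨_, .right_node _ _, by simp [enc, Data.ofList]⟩

/-- A left fold is computable in polynomial time, provided that all intermediate results have
polynomially bounded size. -/
theorem list_foldl {f : α → List β} {g : α → σ} {h : α → σ → β → σ} (hf : PT f) (hg : PT g)
    (hh : PT (fun p : α × σ × β => h p.1 p.2.1 p.2.2)) (B : Polynomial ℕ)
    (hB : ∀ a l, l <+: f a → esize (l.foldl (h a) (g a)) ≤ B.eval (esize a)) :
    PT (fun a => (f a).foldl (h a) (g a)) := by
  obtain ⟨pf, qf, hf⟩ := hf
  obtain ⟨pg, qg, hg⟩ := hg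
  obtain ⟨ph, qh, hh⟩ := hh
  -- the data of the loop is `(a, s, l)`: parameter, accumulator and the rest of the list; `C`
  -- returns `l`, and `R` consumes the first element of `l`
  set C : Prog := .seq .right .right with hC
  set R : Prog := .pair .left (.pair (.seq (.pair .left (.pair (.seq .right .left)
    (.seq .right (.seq .right .left)))) ph) (.seq .right (.seq .right .right))) with hR
  have loop : ∀ (a : α) (M : ℕ) (l : List β) (s : σ), esize a ≤ M → esize l ≤ M →
      (∀ l', l' <+: l → esize (l'.foldl (h a) s) ≤ M) →
      ∃ t, Runs (.loop C R) (enc (a, s, l)) (enc (a, l.foldl (h a) s, ([] : List β))) t ∧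
        t ≤ (l.length + 1) * (20 * (3 * M + 2) + qh.eval (3 * M + 2)) := by
    intro a M l
    induction l with
    | nil =>
      intro s ha hl hs
      refine ⟨_, Runs.loop_stop (.seq (.right_node _ _) (.right_node _ _)), ?_⟩
      have h1 := hs [] List.prefix_rfl
      have : (enc (a, s, ([] : List β))).size ≤ 3 * M + 2 := by
        change esize (a, s, ([] : List β)) ≤ _
        rw [esize_pair, esize_pair]
        simp only [List.foldl_nil] at h1
        omega
      have h2 : (Data.node (enc s) (enc ([] : List β))).size ≤ 3 * M + 2 := by
        change esize (s, ([] : List β)) ≤ _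
        rw [esize_pair]
        simp only [List.foldl_nil] at h1
        omega
      change (enc (a, s, ([] : List β))).size + (Data.node (enc s) (enc ([] : List β))).size
        + (enc (a, s, ([] : List β))).size ≤ _
      simp only [List.length_nil, zero_add, one_mul]
      omega
    | cons b l ih =>
      intro s ha hl hs
      rw [esize_cons] at hl
      have h0 : esize s ≤ M := by simpa using hs [] (List.nil_prefix)
      obtain ⟨r, hr, hrq⟩ := ih (h a s b) ha (by omega) (fun l' hl' => by
        simpa using hs (b :: l') (by simpa using hl'))
      obtain ⟨t, ht, hq⟩ := hh (a, s, b)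
      refine ⟨_, .loop_step (.seq (.right_node _ _) (.right_node _ _))
        (.pair (.left_node _ _) (.pair (.seq (.pair (.left_node _ _)
          (.pair (.seq (.right_node _ _) (.left_node _ _)) (.seq (.right_node _ _)
            (.seq (.right_node _ _) (.left_node _ _))))) ht)
          (.seq (.right_node _ _) (.seq (.right_node _ _) (.right_node _ _))))) hr, ?_⟩
      have e1 : (enc (a, s, b :: l)).size ≤ 3 * M + 2 := by
        change esize (a, s, b :: l) ≤ _
        rw [esize_pair, esize_pair, esize_cons]; omega
      have e2 : (Data.node (enc s) (enc (b :: l))).size ≤ 3 * M + 2 := by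
        change esize (s, b :: l) ≤ _
        rw [esize_pair, esize_cons]; omega
      have e3 : (Data.node (enc b) (Data.ofList (l.map enc))).size ≤ 3 * M + 2 := by
        change esize (b :: l) ≤ _
        rw [esize_cons]; omega
      have e4 : (enc (a, s, b)).size ≤ 3 * M + 2 := by
        change esize (a, s, b) ≤ _
        rw [esize_pair, esize_pair]; omega
      have e5 := polynomial_eval_mono qh e4
      rw [List.length_cons, Nat.succ_mul]
      have e6 : (Data.node (enc a) (Data.node (enc s) (enc (b :: l)))).size ≤ 3 * M + 2 := e1
      simp only [] at *
      change _ + _ + _ + (enc (a, s, b :: l)).size ≤ _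
      generalize (Data.node (enc a) (enc (s, b :: l))).size = z1 at *
      omega
  refine ⟨.seq (.pair .skip (.pair pg pf)) (.seq (.loop C R) (.seq .right .left)),
    9 * Polynomial.X + qg + qf + (qf + 1) *
    (20 * (3 * (B + qf + Polynomial.X) + 2) + qh.comp (3 * (B + qf + Polynomial.X) + 2)) + 3 * B,
    fun a => ?_⟩
  obtain ⟨t, ht, hq⟩ := hf a
  obtain ⟨t', ht', hq'⟩ := hg a
  have h1 : esize (f a) ≤ qf.eval (esize a) := ht.size_le.trans hq
  obtain ⟨r, hr, hrq⟩ := loop a (B.eval (esize a) + qf.eval (esize a) + esize a) (f a) (g a)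
    (by omega) (by omega) (fun l' hl' => (hB a l' hl').trans (by omega))
  refine ⟨_, .seq (.pair (.skip _) (.pair ht' ht)) (.seq hr (.seq (.right_node _ _)
    (.left_node _ _))), ?_⟩
  have h2 := length_lt_esize (f a)
  have h3 := hB a (f a) List.prefix_rfl
  have h4 : ((f a).length + 1) * (20 * (3 * (B.eval (esize a) + qf.eval (esize a) + esize a) + 2)
      + qh.eval (3 * (B.eval (esize a) + qf.eval (esize a) + esize a) + 2)) ≤
      (qf.eval (esize a) + 1) * (20 * (3 * (B.eval (esize a) + qf.eval (esize a) + esize a) + 2)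
      + qh.eval (3 * (B.eval (esize a) + qf.eval (esize a) + esize a) + 2)) :=
    Nat.mul_le_mul_right _ (by omega)
  have h5 : (Data.node (enc a) (enc ((f a).foldl (h a) (g a), ([] : List β)))).size
      = esize a + (esize ((f a).foldl (h a) (g a)) + 1 + 1) + 1 := rfl
  have h6 : (Data.node (enc ((f a).foldl (h a) (g a))) (enc ([] : List β))).size
      = esize ((f a).foldl (h a) (g a)) + 1 + 1 := rfl
  have h7 := esize_pos a
  have h8 : (enc a).size = esize a := rfl
  simp only [Polynomial.eval_add, Polynomial.eval_mul, Polynomial.eval_X, Polynomial.eval_ofNat,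
    Polynomial.eval_comp, Polynomial.eval_one, h5, h6, h8] at *
  omega

/-- A left fold is computable in polynomial time if every step adds to the accumulator an amount
bounded by a polynomial in the sizes of the parameter and of the list element. -/
theorem list_foldl_of_add {f : α → List β} {g : α → σ} {h : α → σ → β → σ} (hf : PT f)
    (hg : PT g) (hh : PT (fun p : α × σ × β => h p.1 p.2.1 p.2.2)) (B : Polynomial ℕ)
    (hB : ∀ a s b, esize (h a s b) ≤ esize s + B.eval (esize a + esize b)) :
    PT (fun a => (f a).foldl (h a) (g a)) := by
  obtain ⟨qf, hqf⟩ := hf.exists_size_le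
  obtain ⟨qg, hqg⟩ := hg.exists_size_le
  refine list_foldl hf hg hh (qg + qf * B.comp (Polynomial.X + qf)) fun a l hl => ?_
  have key : ∀ (l : List β) (s : σ), (∀ b ∈ l, b ∈ f a) → esize (l.foldl (h a) s) ≤
      esize s + l.length * B.eval (esize a + qf.eval (esize a)) := by
    intro l
    induction l with
    | nil => simp
    | cons b l ih =>
      intro s hl
      have h1 := ih (h a s b) fun c hc => hl c (List.mem_cons_of_mem _ hc)
      have h2 := hB a s b
      have h3 : B.eval (esize a + esize b) ≤ B.eval (esize a + qf.eval (esize a)) :=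
        polynomial_eval_mono B (Nat.add_le_add_left
          ((esize_le_of_mem (hl b List.mem_cons_self)).trans (hqf a)) _)
      rw [List.foldl_cons, List.length_cons, Nat.succ_mul]
      omega
  have h1 := key l (g a) fun b hb => hl.subset hb
  have h2 := hqg a
  have h3 : l.length ≤ qf.eval (esize a) :=
    hl.length_le.trans ((length_lt_esize _).le.trans (hqf a))
  have h4 := Nat.mul_le_mul_right (B.eval (esize a + qf.eval (esize a))) h3
  simp only [Polynomial.eval_add, Polynomial.eval_mul, Polynomial.eval_X, Polynomial.eval_comp]
  omega

lemma list_reverse {f : α → List β} (hf : PT f) : PT (fun a => (f a).reverse) := by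
  refine (list_foldl_of_add (h := fun _ (s : List β) b => b :: s) hf (const [])
    (list_cons (snd.comp snd) (fst.comp snd)) (Polynomial.X + 1) ?_).of_eq fun a => ?_
  · intro a s b
    simp only [esize_cons, Polynomial.eval_add, Polynomial.eval_X, Polynomial.eval_one]
    omega
  · simp

lemma list_map {f : α → List β} {g : α → β → γ} (hf : PT f)
    (hg : PT (fun p : α × β => g p.1 p.2)) : PT (fun a => (f a).map (g a)) := by
  obtain ⟨q, hq⟩ := hg.exists_size_le
  refine (list_reverse (list_foldl_of_add (h := fun a (s : List γ) b => g a b :: s) hf (const [])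
    (list_cons (hg.comp (fst.pair (snd.comp snd))) (fst.comp snd)) (q.comp (Polynomial.X + 1) + 1)
      ?_)).of_eq fun a => ?_
  · intro a s b
    have := hq (a, b)
    simp only [esize_cons, Polynomial.eval_add, Polynomial.eval_X, Polynomial.eval_one,
      Polynomial.eval_comp, esize_pair] at *
    omega
  · have : ∀ (l : List β) (s : List γ), l.foldl (fun s b => g a b :: s) s
        = (l.map (g a)).reverse ++ s := by
      intro l
      induction l with
      | nil => simp
      | cons b l ih => simp [ih]
    simp [this]

lemma list_filter {f : α → List β} {g : α → β → Bool} (hf : PT f)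
    (hg : PT (fun p : α × β => g p.1 p.2)) : PT (fun a => (f a).filter (g a)) := by
  refine (list_reverse (list_foldl_of_add
    (h := fun a (s : List β) b => if g a b = true then b :: s else s) hf (const [])
    (cond (hg.comp (fst.pair (snd.comp snd))) (list_cons (snd.comp snd) (fst.comp snd))
      (fst.comp snd)) (Polynomial.X + 1) ?_)).of_eq fun a => ?_
  · intro a s b
    simp only [Polynomial.eval_add, Polynomial.eval_X, Polynomial.eval_one]
    split_ifs
    · rw [esize_cons]; omega
    · omega
  · have : ∀ (l s : List β), l.foldl (fun s b => if g a b = true then b :: s else s) s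
        = (l.filter (g a)).reverse ++ s := by
      intro l
      induction l with
      | nil => simp
      | cons b l ih =>
        intro s
        rw [List.foldl_cons, ih, List.filter_cons]
        split_ifs <;> simp
    simp [this]

/-- The second list is the initial accumulator, to which the reversed first list is added. -/
lemma list_append {f g : α → List β} (hf : PT f) (hg : PT g) : PT (fun a => f a ++ g a) := by
  refine (list_foldl_of_add (h := fun _ (s : List β) b => b :: s) (list_reverse hf) hg
    (list_cons (snd.comp snd) (fst.comp snd)) (Polynomial.X + 1) ?_).of_eq fun a => ?_
  · intro a s b
    simp only [esize_cons, Polynomial.eval_add, Polynomial.eval_X, Polynomial.eval_one]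
    omega
  · rw [List.foldl_reverse]
    induction f a with
    | nil => rfl
    | cons b l ih => simp

lemma list_flatMap {f : α → List β} {g : α → β → List γ} (hf : PT f)
    (hg : PT (fun p : α × β => g p.1 p.2)) : PT (fun a => (f a).flatMap (g a)) := by
  obtain ⟨q, hq⟩ := hg.exists_size_le
  refine (list_foldl_of_add (h := fun a (s : List γ) b => s ++ g a b) hf (const [])
    (list_append (fst.comp snd) (hg.comp (fst.pair (snd.comp snd)))) (q.comp (Polynomial.X + 1))
      ?_).of_eq fun a => ?_
  · intro a s b
    have := hq (a, b)
    have := esize_append s (g a b)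
    simp only [esize_pair, Polynomial.eval_add, Polynomial.eval_X, Polynomial.eval_one,
      Polynomial.eval_comp] at *
    omega
  · have : ∀ (l : List β) (s : List γ), l.foldl (fun s b => s ++ g a b) s
        = s ++ l.flatMap (g a) := by
      intro l
      induction l with
      | nil => simp
      | cons b l ih => simp [ih]
    simp [this]

lemma list_isEmpty {f : α → List β} (hf : PT f) : PT (fun a => (f a).isEmpty) :=
  (option_elim (list_head? hf) (const true) (const false)).of_eq fun a => by cases f a <;> rfl

lemma list_any {f : α → List β} {g : α → β → Bool} (hf : PT f)
    (hg : PT (fun p : α × β => g p.1 p.2)) : PT (fun a => (f a).any (g a)) :=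
  (list_isEmpty (list_filter hf hg)).not.of_eq fun a => by
    induction f a with
    | nil => rfl
    | cons b l ih => cases h : g a b <;> simp_all

lemma list_all {f : α → List β} {g : α → β → Bool} (hf : PT f)
    (hg : PT (fun p : α × β => g p.1 p.2)) : PT (fun a => (f a).all (g a)) :=
  (list_any (g := fun a b => !g a b) hf (not hg)).not.of_eq fun a => by
    simp [List.any_eq_not_all_not]

/-! ### Natural numbers -/

/-- Functions whose values have the same representations are computed by the same program. -/
lemma of_enc_eq {f : α → β} {g : α → γ} (hf : PT f) (h : ∀ a, enc (f a) = enc (g a)) : PT g := by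
  obtain ⟨p, q, hp⟩ := hf
  exact ⟨p, q, fun a => by simpa only [h a] using hp a⟩

/-- The number `n` has the same representation as a list of `n` empty lists. -/
lemma units {f : α → ℕ} (hf : PT f) : PT (fun a => List.replicate (f a) ([] : List Bool)) :=
  hf.of_enc_eq fun a => by
    change Data.ofList _ = Data.ofList _
    rw [List.map_replicate]; rfl

lemma nat_succ {f : α → ℕ} (hf : PT f) : PT (fun a => f a + 1) :=
  (list_cons (const ([] : List Bool)) (units hf)).of_enc_eq fun a => by
    change Data.ofList _ = Data.ofList _
    rw [← List.replicate_succ, List.map_replicate]; rfl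

lemma nat_pred {f : α → ℕ} (hf : PT f) : PT (fun a => f a - 1) :=
  (list_tail (units hf)).of_enc_eq fun a => by
    change Data.ofList _ = Data.ofList _
    rw [List.tail_replicate, List.map_replicate]; rfl

lemma list_length {f : α → List β} (hf : PT f) : PT (fun a => (f a).length) := by
  refine (list_foldl_of_add (h := fun _ (s : ℕ) _ => s + 1) hf (const 0)
    (nat_succ (fst.comp snd)) 2 ?_).of_eq fun a => ?_
  · intro a s b
    simp only [esize_nat, Polynomial.eval_ofNat]
    omega
  · have : ∀ (l : List β) (s : ℕ), l.foldl (fun s _ => s + 1) s = s + l.length := by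
      intro l
      induction l with
      | nil => simp
      | cons b l ih => intro s; simp [ih]; omega
    simp [this]

lemma nat_sub {f g : α → ℕ} (hf : PT f) (hg : PT g) : PT (fun a => f a - g a) := by
  refine (list_foldl_of_add (h := fun _ (s : ℕ) _ => s - 1) (units hg) hf
    (nat_pred (fst.comp snd)) 0 ?_).of_eq fun a => ?_
  · intro a s b
    simp only [esize_nat]
    omega
  · induction g a generalizing f with
    | zero => rfl
    | succ n ih =>
      rw [List.replicate_succ, List.foldl_cons]
      refine (ih (f := fun a => f a - 1) (nat_pred hf)).trans ?_
      omega

lemma nat_add {f g : α → ℕ} (hf : PT f) (hg : PT g) : PT (fun a => f a + g a) :=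
  (list_length (list_append (units hf) (units hg))).of_eq fun a => by simp

lemma nat_le {f g : α → ℕ} (hf : PT f) (hg : PT g) : PT (fun a => decide (f a ≤ g a)) :=
  (list_isEmpty (units (nat_sub hf hg))).of_eq fun a => by
    rw [Bool.eq_iff_iff, List.isEmpty_iff, List.replicate_eq_nil_iff, decide_eq_true_iff]
    omega

lemma nat_lt {f g : α → ℕ} (hf : PT f) (hg : PT g) : PT (fun a => decide (f a < g a)) :=
  nat_le (nat_succ hf) hg

lemma nat_beq {f g : α → ℕ} (hf : PT f) (hg : PT g) : PT (fun a => f a == g a) :=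
  ((nat_le hf hg).and (nat_le hg hf)).of_eq fun a => by
    rw [Bool.eq_iff_iff]
    simp
    omega

lemma list_drop {f : α → ℕ} {g : α → List β} (hf : PT f) (hg : PT g) :
    PT (fun a => (g a).drop (f a)) := by
  refine (list_foldl_of_add (h := fun _ (s : List β) _ => s.tail) (units hf) hg
    (list_tail (fst.comp snd)) 0 ?_).of_eq fun a => ?_
  · intro a s b
    cases s with
    | nil => simp
    | cons b s => rw [List.tail_cons, esize_cons]; omega
  · generalize g a = l
    induction f a generalizing l with
    | zero => rfl
    | succ n ih => rw [List.replicate_succ, List.foldl_cons, ih, List.drop_tail, Nat.add_comm]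

lemma list_headD {f : α → List β} (b : β) (hf : PT f) : PT (fun a => (f a).headD b) :=
  (option_elim (list_head? hf) (const b) snd).of_eq fun a => by cases f a <;> rfl

lemma list_range {f : α → ℕ} (hf : PT f) : PT (fun a => List.range (f a)) := by
  -- the next number is the length of the list of the previous ones
  have key : ∀ n : ℕ, (List.replicate n ([] : List Bool)).foldl
      (fun (s : List ℕ) _ => s.length :: s) [] = (List.range n).reverse := by
    intro n
    induction n with
    | zero => rfl
    | succ n ih =>
      rw [List.replicate_succ', List.foldl_append, ih, List.range_succ]
      simp
  obtain ⟨q, hq⟩ := hf.exists_size_le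
  refine (list_reverse (list_foldl (h := fun _ (s : List ℕ) _ => s.length :: s) (units hf)
    (const []) (list_cons (list_length (fst.comp snd)) (fst.comp snd))
    (q * (q + 1) + 1) ?_)).of_eq fun a => ?_
  · intro a l hl
    obtain ⟨hl', hl''⟩ : l.length ≤ f a ∧ l = List.replicate l.length [] := by
      refine ⟨by simpa using hl.length_le, List.eq_replicate_iff.2 ⟨rfl, fun b hb => ?_⟩⟩
      exact List.eq_of_mem_replicate (hl.subset hb)
    rw [hl'', key]
    have h1 := hq a
    rw [esize_nat] at h1
    refine (esize_le_of_forall _ (q.eval (esize a)) ?_).trans ?_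
    · intro n hn
      rw [List.mem_reverse, List.mem_range] at hn
      rw [esize_nat]; omega
    · rw [List.length_reverse, List.length_range]
      simp only [Polynomial.eval_add, Polynomial.eval_mul, Polynomial.eval_one]
      exact Nat.add_le_add_right (Nat.mul_le_mul_right _ (by omega)) _
  · rw [key, List.reverse_reverse]

lemma list_product {f : α → List β} {g : α → List γ} (hf : PT f) (hg : PT g) :
    PT (fun a => (f a) ×ˢ (g a)) :=
  list_flatMap hf (list_map (hg.comp fst) ((snd.comp fst).pair snd))

end PT

end EDP

namespace EDP

open Relation

/-! ### Multigraphs with demands -/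

/-- A labelled edge, or a labelled demand, of a multigraph with vertices in `ℕ`: a label followed
by two endpoints. -/
abbrev Entry := (ℕ × ℕ) × (ℕ × ℕ)

/-- `x` and `y` are the first and the second endpoint of an edge of `E` with colour `i`. -/
def Link (E : List Entry) (c : ℕ × ℕ → ℕ × ℕ) (i : ℕ × ℕ) (x y : ℕ) : Prop :=
  ∃ a ∈ E, c a.1 = i ∧ a.2 = (x, y)

/-- The edges of `E` can be coloured by labels of demands so that the endpoints of every demand of
`D` lie in the same component of the subgraph formed by the edges with its colour. The colour is a
function of the label of an edge, so that it survives changes of the endpoints. -/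
def Solvable (E D : List Entry) : Prop :=
  ∃ c : ℕ × ℕ → ℕ × ℕ, ∀ d ∈ D, EqvGen (Link E c d.1) d.2.1 d.2.2

/-- There are no loops, and distinct entries have distinct labels. -/
structure Proper (E : List Entry) : Prop where
  ne : ∀ a ∈ E, a.2.1 ≠ a.2.2
  nodup : (E.map Prod.fst).Nodup

/-- `v` is an endpoint of `a`. -/
def touches (v : ℕ) (a : Entry) : Bool := a.2.1 == v || a.2.2 == v

/-- `u` and `v` are the endpoints of `a`. -/
def joins (u v : ℕ) (a : Entry) : Bool :=
  (a.2.1 == u && a.2.2 == v) || (a.2.1 == v && a.2.2 == u)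

/-- The number of entries with endpoint `v`. -/
def deg (E : List Entry) (v : ℕ) : ℕ := (E.filter (touches v)).length

/-- The number of entries with endpoints `u` and `v`. -/
def mult (E : List Entry) (u v : ℕ) : ℕ := (E.filter (joins u v)).length

/-- The set of labels. -/
def labels (E : List Entry) : Finset (ℕ × ℕ) := (E.map Prod.fst).toFinset

/-- The list without the entry labelled `i`. -/
def drop (i : ℕ × ℕ) (E : List Entry) : List Entry :=
  E.filter fun a => !(a.1.1 == i.1 && a.1.2 == i.2)

/-- Move `v` to `u`. -/
def move (v u x : ℕ) : ℕ := if (x == v) = true then u else x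

/-- Identify `v` with `u` and delete the resulting loops. -/
def contract (v u : ℕ) (E : List Entry) : List Entry :=
  (E.map fun a => (a.1, (move v u a.2.1, move v u a.2.2))).filter fun a => !(a.2.1 == a.2.2)

lemma touches_iff {v : ℕ} {a : Entry} : touches v a = true ↔ a.2.1 = v ∨ a.2.2 = v := by
  simp [touches]

lemma joins_iff {u v : ℕ} {a : Entry} :
    joins u v a = true ↔ (a.2.1 = u ∧ a.2.2 = v) ∨ (a.2.1 = v ∧ a.2.2 = u) := by
  simp [joins]

lemma mem_drop {i : ℕ × ℕ} {E : List Entry} {a : Entry} : a ∈ drop i E ↔ a ∈ E ∧ a.1 ≠ i := by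
  simp only [drop, List.mem_filter, Prod.ext_iff, ne_eq, not_and, Bool.not_eq_true',
    Bool.and_eq_false_imp, beq_iff_eq, beq_eq_false_iff_ne]

lemma mem_contract {v u : ℕ} {E : List Entry} {a : Entry} :
    a ∈ contract v u E ↔ (∃ b ∈ E, a = (b.1, (move v u b.2.1, move v u b.2.2))) ∧
      a.2.1 ≠ a.2.2 := by
  simp only [contract, List.mem_filter, List.mem_map, Bool.not_eq_true', beq_eq_false_iff_ne, ne_eq]
  exact and_congr_left fun _ => exists_congr fun b => and_congr_right fun _ => eq_comm

lemma mem_labels {E : List Entry} {i : ℕ × ℕ} : i ∈ labels E ↔ ∃ a ∈ E, a.1 = i := by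
  simp [labels]

lemma Proper.filter {E : List Entry} (h : Proper E) (p : Entry → Bool) : Proper (E.filter p) :=
  ⟨fun a ha => h.ne a (List.mem_of_mem_filter ha),
    h.nodup.sublist (List.filter_sublist.map _)⟩

lemma Proper.drop {E : List Entry} (h : Proper E) (i : ℕ × ℕ) : Proper (drop i E) := h.filter _

lemma Proper.contract {E : List Entry} (h : Proper E) (v u : ℕ) : Proper (contract v u E) := by
  refine ⟨fun a ha => (mem_contract.1 ha).2, ?_⟩
  refine List.Nodup.sublist (List.filter_sublist.map _) ?_
  simpa [Function.comp_def] using h.nodup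

lemma Proper.card_labels {E : List Entry} (h : Proper E) : (labels E).card = E.length := by
  rw [labels, List.toFinset_card_of_nodup h.nodup, List.length_map]

lemma Proper.eq_of_label {E : List Entry} (h : Proper E) {a b : Entry} (ha : a ∈ E) (hb : b ∈ E)
    (hab : a.1 = b.1) : a = b :=
  List.inj_on_of_nodup_map h.nodup ha hb hab

lemma eqvGen_map {α β : Type*} {r : α → α → Prop} {s : β → β → Prop} (f : α → β)
    (h : ∀ x y, r x y → EqvGen s (f x) (f y)) {x y : α} (hxy : EqvGen r x y) :
    EqvGen s (f x) (f y) := by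
  induction hxy with
  | rel x y hr => exact h x y hr
  | refl x => exact .refl _
  | symm x y _ ih => exact .symm _ _ ih
  | trans x y z _ _ ih ih' => exact .trans _ _ _ ih ih'

/-- A colour class that connects `v` to another vertex contains an edge at `v`. -/
lemma exists_touching {E : List Entry} {c : ℕ × ℕ → ℕ × ℕ} {i : ℕ × ℕ} {s t v : ℕ}
    (h : EqvGen (Link E c i) s t) (hne : s ≠ t) (hv : s = v ∨ t = v) :
    ∃ a ∈ E, c a.1 = i ∧ touches v a = true := by
  by_contra hcon
  push Not at hcon
  have key : EqvGen (fun p q : Prop => (p ↔ q)) (s = v) (t = v) :=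
    eqvGen_map (fun x => x = v) (fun x y ⟨a, ha, hc, hxy⟩ => by
      have := hcon a ha hc
      rw [ne_eq, touches_iff, hxy] at this
      push Not at this
      exact .rel _ _ (by simp [this.1, this.2])) h
  have key' : (s = v) ↔ (t = v) := by
    generalize (s = v) = p at key
    generalize (t = v) = q at key
    induction key with
    | rel _ _ h => exact h
    | refl => exact Iff.rfl
    | symm _ _ _ ih => exact ih.symm
    | trans _ _ _ _ _ ih ih' => exact ih.trans ih'
  rcases hv with rfl | rfl
  · exact hne (key'.1 rfl).symm
  · exact hne (key'.2 rfl)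

/-- In a solution, the colour of every demand at `v` occurs on an edge at `v`. -/
lemma labels_subset_image {E D : List Entry} (hD : Proper D) {c : ℕ × ℕ → ℕ × ℕ}
    (hc : ∀ d ∈ D, EqvGen (Link E c d.1) d.2.1 d.2.2) (v : ℕ) :
    labels (D.filter (touches v)) ⊆ (labels (E.filter (touches v))).image c := by
  intro i hi
  obtain ⟨d, hd, rfl⟩ := mem_labels.1 hi
  rw [List.mem_filter, touches_iff] at hd
  obtain ⟨a, ha, hca, hta⟩ := exists_touching (hc d hd.1) (hD.ne d hd.1) hd.2
  exact Finset.mem_image.2 ⟨a.1, mem_labels.2 ⟨a, List.mem_filter.2 ⟨ha, hta⟩, rfl⟩, hca⟩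

lemma Solvable.deg_le {E D : List Entry} (h : Solvable E D) (hE : Proper E) (hD : Proper D)
    (v : ℕ) : deg D v ≤ deg E v := by
  obtain ⟨c, hc⟩ := h
  have := (Finset.card_le_card (labels_subset_image hD hc v)).trans Finset.card_image_le
  rwa [(hD.filter _).card_labels, (hE.filter _).card_labels] at this

/-! ### Removing a demand between adjacent vertices -/

/-- An edge and a demand with the same endpoints can be removed: if the edge is used for another
demand, then that demand can be rerouted along the path of the removed one. -/
theorem solvable_drop_drop {E D : List Entry} (hE : Proper E) (hD : Proper D) {e d : Entry}
    (he : e ∈ E) (hd : d ∈ D) (hed : joins d.2.1 d.2.2 e = true) :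
    Solvable (drop e.1 E) (drop d.1 D) ↔ Solvable E D := by
  rw [joins_iff] at hed
  constructor
  · rintro ⟨c, hc⟩
    refine ⟨fun i => if i = e.1 then d.1 else c i, fun d' hd' => ?_⟩
    by_cases h : d'.1 = d.1
    · have hlink : Link E (fun i => if i = e.1 then d.1 else c i) d.1 e.2.1 e.2.2 :=
        ⟨e, he, by simp, rfl⟩
      rw [hD.eq_of_label hd' hd h]
      rcases hed with ⟨h1, h2⟩ | ⟨h1, h2⟩
      · rw [← h1, ← h2]; exact .rel _ _ hlink
      · rw [← h1, ← h2]; exact .symm _ _ (.rel _ _ hlink)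
    · refine (hc d' (mem_drop.2 ⟨hd', h⟩)).mono fun x y ⟨a, ha, hca, hxy⟩ => ?_
      rw [mem_drop] at ha
      exact ⟨a, ha.1, by simp [ha.2, hca], hxy⟩
  · rintro ⟨c, hc⟩
    -- the path of the removed demand replaces `e`
    refine ⟨fun i => if c i = d.1 then c e.1 else c i, fun d' hd' => ?_⟩
    rw [mem_drop] at hd'
    have huv : c e.1 ≠ d.1 → EqvGen (Link (drop e.1 E) (fun i => if c i = d.1 then c e.1 else c i)
        (c e.1)) e.2.1 e.2.2 := by
      intro hne
      have h1 : EqvGen (Link (drop e.1 E) (fun i => if c i = d.1 then c e.1 else c i)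
          (c e.1)) d.2.1 d.2.2 := (hc d hd).mono fun x y ⟨a, ha, hca, hxy⟩ =>
        ⟨a, mem_drop.2 ⟨ha, fun h => hne (h ▸ hca)⟩, by simp [hca], hxy⟩
      rcases hed with ⟨h1', h2'⟩ | ⟨h1', h2'⟩
      · rwa [h1', h2']
      · rw [h1', h2']; exact .symm _ _ h1
    refine eqvGen_map id (fun x y ⟨a, ha, hca, hxy⟩ => ?_) (hc d' hd'.1)
    by_cases hae : a.1 = e.1
    · obtain rfl := hE.eq_of_label ha he hae
      have := huv (by rw [hca]; exact hd'.2)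
      rw [hxy] at this
      rw [← hca]
      exact this
    · exact .rel _ _ ⟨a, mem_drop.2 ⟨ha, hae⟩, by
        simp only [hca]; rw [if_neg hd'.2], hxy⟩

/-! ### Contraction -/

lemma move_self (v u : ℕ) : move v u v = u := by simp [move]

lemma move_of_ne {v u x : ℕ} (h : x ≠ v) : move v u x = x := by simp [move, h]

lemma exists_subset_image {α β : Type*} [DecidableEq β] [Nonempty β] (A : Finset α) (B : Finset β)
    (h : B.card ≤ A.card) : ∃ f : α → β, B ⊆ A.image f := by
  classical
  obtain ⟨A', hA', hcard⟩ := Finset.exists_subset_card_eq h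
  have e : A' ≃ B := Finset.equivOfCardEq hcard
  refine ⟨fun a => if h : a ∈ A' then (e ⟨a, h⟩ : β) else Classical.arbitrary β, fun b hb => ?_⟩
  refine Finset.mem_image.2 ⟨(e.symm ⟨b, hb⟩ : α), hA' (e.symm ⟨b, hb⟩).2, ?_⟩
  simp

/-- If at least half of the edges and demands at `v` are edges to `u`, then `v` can be identified
with `u`: the edges to `u` suffice to continue at `u` every path that uses another edge at `v` or
ends at `v`. -/
theorem solvable_contract {E D : List Entry} (hE : Proper E) (hD : Proper D) {u v : ℕ}
    (h : deg D v + deg E v ≤ 2 * mult E v u) :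
    Solvable (contract v u E) (contract v u D) ↔ Solvable E D := by
  constructor
  · rintro ⟨c, hc⟩
    set ext := (E.filter (touches v)).filter (fun a => !joins v u a) with hext
    -- the colours that need a connection from `v` to `u` do not outnumber the edges between them
    have hcard : ((labels ext).image c ∪ labels (D.filter (touches v))).card
        ≤ (labels (E.filter (joins v u))).card := by
      refine (Finset.card_union_le _ _).trans ?_
      have h1 : ((labels ext).image c).card ≤ ext.length :=
        Finset.card_image_le.trans ((hE.filter _).filter _).card_labels.le
      have h2 : (labels (D.filter (touches v))).card = deg D v := (hD.filter _).card_labels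
      have h3 : (labels (E.filter (joins v u))).card = mult E v u := (hE.filter _).card_labels
      have h4 : deg E v = ((E.filter (touches v)).filter (joins v u)).length + ext.length := by
        rw [deg, hext, List.length_eq_length_filter_add (joins v u)]
      have h5 : (E.filter (touches v)).filter (joins v u) = E.filter (joins v u) := by
        rw [List.filter_filter]
        refine List.filter_congr fun a _ => ?_
        rw [Bool.eq_iff_iff, Bool.and_eq_true, joins_iff, touches_iff]
        tauto
      rw [h5] at h4
      rw [mult] at h h3
      omega
    -- so the edges between `v` and `u` can be given all of these colours
    obtain ⟨f, hf⟩ := exists_subset_image _ _ hcard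
    set c' : ℕ × ℕ → ℕ × ℕ := fun i => if i ∈ labels (E.filter (joins v u)) then f i else c i
      with hc'
    have hc'_of : ∀ a ∈ E, joins v u a = false → c' a.1 = c a.1 := by
      intro a ha haj
      rw [hc']
      refine if_neg fun hmem => ?_
      obtain ⟨b, hb, hba⟩ := mem_labels.1 hmem
      rw [List.mem_filter] at hb
      rw [hE.eq_of_label hb.1 ha hba, haj] at hb
      exact absurd hb.2 (by simp)
    -- every edge that survives the contraction has kept its colour
    have hlink : ∀ i x y, Link (contract v u E) c i x y → ∃ a ∈ E, c' a.1 = i ∧ c a.1 = i ∧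
        joins v u a = false ∧ x = move v u a.2.1 ∧ y = move v u a.2.2 := by
      rintro i x y ⟨a, ha, hca, hxy⟩
      obtain ⟨⟨b, hb, rfl⟩, hne⟩ := mem_contract.1 ha
      have hbj : joins v u b = false := by
        by_contra hbj
        rw [Bool.not_eq_false, joins_iff] at hbj
        refine hne ?_
        rcases hbj with ⟨h1, h2⟩ | ⟨h1, h2⟩ <;> simp [h1, h2, move]
      simp only [Prod.mk.injEq] at hxy
      exact ⟨b, hb, (hc'_of b hb hbj).trans hca, hca, hbj, hxy.1.symm, hxy.2.symm⟩
    refine ⟨c', fun d hd => ?_⟩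
    -- a colour that does not need the connection is not present at `v`
    by_cases hi : d.1 ∈ (labels ext).image c ∪ labels (D.filter (touches v))
    · have hvu : EqvGen (Link E c' d.1) v u := by
        obtain ⟨p, hp, hpd⟩ := Finset.mem_image.1 (hf hi)
        obtain ⟨a, ha, rfl⟩ := mem_labels.1 hp
        rw [List.mem_filter, joins_iff] at ha
        have hl : Link E c' d.1 a.2.1 a.2.2 := ⟨a, ha.1, by rw [hc']; simp only [hp, if_true, hpd],
          rfl⟩
        rcases ha.2 with ⟨h1, h2⟩ | ⟨h1, h2⟩
        · rw [h1, h2] at hl; exact .rel _ _ hl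
        · rw [h1, h2] at hl; exact .symm _ _ (.rel _ _ hl)
      have hmove : ∀ x, EqvGen (Link E c' d.1) x (move v u x) := by
        intro x
        by_cases hx : x = v
        · rw [hx, move_self]; exact hvu
        · rw [move_of_ne hx]; exact .refl _
      have hmid : EqvGen (Link E c' d.1) (move v u d.2.1) (move v u d.2.2) := by
        by_cases hloop : move v u d.2.1 = move v u d.2.2
        · rw [hloop]; exact .refl _
        · refine eqvGen_map id (fun x y hxy => ?_)
            (hc _ (mem_contract.2 ⟨⟨d, hd, rfl⟩, hloop⟩))
          obtain ⟨a, ha, hca, _, _, rfl, rfl⟩ := hlink _ _ _ hxy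
          exact .trans _ _ _ (.symm _ _ (hmove _))
            (.trans _ _ _ (.rel _ _ ⟨a, ha, hca, rfl⟩) (hmove _))
      exact .trans _ _ _ (hmove _) (.trans _ _ _ hmid (.symm _ _ (hmove _)))
    · rw [Finset.mem_union, not_or] at hi
      have hdv : ¬ touches v d = true := fun ht =>
        hi.2 (mem_labels.2 ⟨d, List.mem_filter.2 ⟨hd, ht⟩, rfl⟩)
      rw [touches_iff, not_or] at hdv
      have hdc : d ∈ contract v u D := mem_contract.2
        ⟨⟨d, hd, by rw [move_of_ne hdv.1, move_of_ne hdv.2]⟩, hD.ne d hd⟩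
      refine (hc d hdc).mono fun x y hxy => ?_
      obtain ⟨a, ha, hca', hca, haj, rfl, rfl⟩ := hlink _ _ _ hxy
      have hav : ¬ touches v a = true := fun ht => hi.1 (Finset.mem_image.2
        ⟨a.1, mem_labels.2 ⟨a, List.mem_filter.2 ⟨List.mem_filter.2 ⟨ha, ht⟩, by simp [haj]⟩, rfl⟩,
          hca⟩)
      rw [touches_iff, not_or] at hav
      rw [move_of_ne hav.1, move_of_ne hav.2]
      exact ⟨a, ha, hca', rfl⟩
  · rintro ⟨c, hc⟩
    refine ⟨c, fun d' hd' => ?_⟩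
    obtain ⟨⟨d, hd, rfl⟩, -⟩ := mem_contract.1 hd'
    refine eqvGen_map (move v u) (fun x y ⟨a, ha, hca, hxy⟩ => ?_) (hc d hd)
    by_cases hloop : move v u x = move v u y
    · rw [hloop]; exact .refl _
    · refine .rel _ _ ⟨(a.1, (move v u x, move v u y)), mem_contract.2 ⟨⟨a, ha, ?_⟩, hloop⟩, hca,
        rfl⟩
      rw [hxy]

/-! ### Useless edges -/

/-- If at most one edge at `u` is not needed for demands ending at `u`, then an edge at `u` whose
colour is not that of a demand at `u` is the only one of its colour there, and can be dropped. -/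
lemma eqvGen_drop_of_saturated {E D : List Entry} (hE : Proper E) (hD : Proper D)
    {c : ℕ × ℕ → ℕ × ℕ} (hc : ∀ d ∈ D, EqvGen (Link E c d.1) d.2.1 d.2.2) {e : Entry} (he : e ∈ E)
    {u v : ℕ} (huv : joins u v e = true) (hu : deg E u ≤ deg D u + 1)
    {d : Entry} (hd : d ∈ D) (hce : c e.1 = d.1) (hdu : touches u d = false) :
    EqvGen (Link (drop e.1 E) c d.1) d.2.1 d.2.2 := by
  have heu : touches u e = true := by
    rw [touches_iff]; rw [joins_iff] at huv; tauto
  have hlab : ∀ i ∈ labels (D.filter (touches u)), i ≠ d.1 := by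
    rintro i hi rfl
    obtain ⟨d', hd', hdd⟩ := mem_labels.1 hi
    rw [List.mem_filter] at hd'
    rw [hD.eq_of_label hd'.1 hd hdd, hdu] at hd'
    exact absurd hd'.2 (by simp)
  have hsub : labels (D.filter (touches u)) ⊆
      ((labels (E.filter (touches u))).erase e.1).image c := by
    intro i hi
    obtain ⟨j, hj, rfl⟩ := Finset.mem_image.1 (labels_subset_image hD hc u hi)
    refine Finset.mem_image.2 ⟨j, Finset.mem_erase.2 ⟨?_, hj⟩, rfl⟩
    rintro rfl
    exact hlab _ hi hce
  have hcard : ((labels (E.filter (touches u))).erase e.1).card ≤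
      (labels (D.filter (touches u))).card := by
    rw [Finset.card_erase_of_mem (mem_labels.2 ⟨e, List.mem_filter.2 ⟨he, heu⟩, rfl⟩),
      (hE.filter _).card_labels, (hD.filter _).card_labels]
    change deg E u - 1 ≤ deg D u
    omega
  have heq := Finset.eq_of_subset_of_card_le hsub (Finset.card_image_le.trans hcard)
  have honly : ∀ a ∈ E, c a.1 = d.1 → a.1 ≠ e.1 → ¬ touches u a = true := by
    intro a ha hca hae hta
    refine hlab (c a.1) ?_ hca
    rw [heq]
    exact Finset.mem_image.2 ⟨a.1, Finset.mem_erase.2 ⟨hae, mem_labels.2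
      ⟨a, List.mem_filter.2 ⟨ha, hta⟩, rfl⟩⟩, rfl⟩
  -- identifying `u` with `v` turns `e` into a loop and moves no other edge of its colour
  have key : EqvGen (Link (drop e.1 E) c d.1) (move u v d.2.1) (move u v d.2.2) := by
    refine eqvGen_map (move u v) (fun x y ⟨a, ha, hca, hxy⟩ => ?_) (hc d hd)
    by_cases hae : a.1 = e.1
    · obtain rfl := hE.eq_of_label ha he hae
      rw [joins_iff, hxy] at huv
      have : move u v x = move u v y := by
        rcases huv with ⟨h1, h2⟩ | ⟨h1, h2⟩ <;> simp only at h1 h2 <;> simp [h1, h2, move]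
      rw [this]; exact .refl _
    · have := honly a ha hca hae
      rw [touches_iff, hxy, not_or] at this
      rw [move_of_ne this.1, move_of_ne this.2]
      exact .rel _ _ ⟨a, mem_drop.2 ⟨ha, hae⟩, hca, hxy⟩
  have hdu' : ¬ touches u d = true := by simp [hdu]
  rw [touches_iff, not_or] at hdu'
  rwa [move_of_ne hdu'.1, move_of_ne hdu'.2] at key

/-- An edge can be deleted if at both of its endpoints at most one edge is not needed for the
demands there, and its endpoints do not form a demand. -/
theorem solvable_drop {E D : List Entry} (hE : Proper E) (hD : Proper D) {e : Entry} (he : e ∈ E)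
    (h1 : deg E e.2.1 ≤ deg D e.2.1 + 1) (h2 : deg E e.2.2 ≤ deg D e.2.2 + 1)
    (hno : ∀ d ∈ D, joins d.2.1 d.2.2 e = false) :
    Solvable (drop e.1 E) D ↔ Solvable E D := by
  constructor
  · rintro ⟨c, hc⟩
    refine ⟨c, fun d hd => (hc d hd).mono fun x y ⟨a, ha, hca, hxy⟩ => ⟨a, ?_, hca, hxy⟩⟩
    exact (mem_drop.1 ha).1
  · rintro ⟨c, hc⟩
    refine ⟨c, fun d hd => ?_⟩
    by_cases hce : c e.1 = d.1
    · have hne := hE.ne e he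
      have hj := hno d hd
      by_cases ht : touches e.2.1 d = true
      · refine eqvGen_drop_of_saturated hE hD hc he (u := e.2.2) (v := e.2.1)
          (joins_iff.2 (.inr ⟨rfl, rfl⟩)) h2 hd hce ?_
        by_contra ht'
        rw [Bool.not_eq_false, touches_iff] at ht'
        rw [touches_iff] at ht
        have : ¬ joins d.2.1 d.2.2 e = true := by simp [hj]
        rw [joins_iff] at this
        have := hD.ne d hd
        omega
      · exact eqvGen_drop_of_saturated hE hD hc he (u := e.2.1) (v := e.2.2)
          (joins_iff.2 (.inl ⟨rfl, rfl⟩)) h1 hd hce (by simpa using ht)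
    · refine (hc d hd).mono fun x y ⟨a, ha, hca, hxy⟩ => ⟨a, mem_drop.2 ⟨ha, ?_⟩, hca, hxy⟩
      rintro hae
      exact hce (hae ▸ hca)

/-! ### Rank -/

/-- The incidence vector of an edge. -/
noncomputable def vec (a : Entry) : ℕ →₀ ℚ := Finsupp.single a.2.1 1 - Finsupp.single a.2.2 1

/-- The space spanned by the incidence vectors of the edges. -/
noncomputable def cutSpace (E : List Entry) : Submodule ℚ (ℕ →₀ ℚ) :=
  Submodule.span ℚ (vec '' {a | a ∈ E})

/-- The rank of the graphic matroid of `E`, that is, the size of a maximal forest. -/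
noncomputable def rk (E : List Entry) : ℕ := Module.finrank ℚ (cutSpace E)

instance (E : List Entry) : FiniteDimensional ℚ (cutSpace E) :=
  FiniteDimensional.span_of_finite _ ((List.finite_toSet E).image _)

lemma vec_mem_cutSpace {E : List Entry} {a : Entry} (h : a ∈ E) : vec a ∈ cutSpace E :=
  Submodule.subset_span ⟨a, h, rfl⟩

lemma rk_le_of_subset {E E' : List Entry} (h : E ⊆ E') : rk E ≤ rk E' :=
  Submodule.finrank_mono (Submodule.span_mono (Set.image_mono fun _ ha => h ha))

/-- The rank increases by at most one when a single vector `w` is adjoined. -/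
lemma rk_le_succ {E E' : List Entry} (w : ℕ →₀ ℚ)
    (h : ∀ a ∈ E, vec a ∈ Submodule.span ℚ {w} ⊔ cutSpace E') : rk E ≤ rk E' + 1 := by
  have h1 : cutSpace E ≤ Submodule.span ℚ {w} ⊔ cutSpace E' := by
    refine Submodule.span_le.2 ?_
    rintro _ ⟨a, ha, rfl⟩
    exact h a ha
  have h2 := Submodule.finrank_mono h1
  have h3 := Submodule.finrank_add_le_finrank_add_finrank (Submodule.span ℚ {w}) (cutSpace E')
  have h4 : Module.finrank ℚ (Submodule.span ℚ {w}) ≤ 1 := by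
    simpa using finrank_span_le_card (R := ℚ) ({w} : Set (ℕ →₀ ℚ))
  change Module.finrank ℚ _ ≤ Module.finrank ℚ _ + 1
  omega

lemma rk_le_rk_drop {E : List Entry} (hE : Proper E) {e : Entry} (he : e ∈ E) :
    rk E ≤ rk (drop e.1 E) + 1 := by
  refine rk_le_succ (vec e) fun a ha => ?_
  by_cases hae : a.1 = e.1
  · rw [hE.eq_of_label ha he hae]
    exact Submodule.mem_sup_left (Submodule.mem_span_singleton_self _)
  · exact Submodule.mem_sup_right (vec_mem_cutSpace (mem_drop.2 ⟨ha, hae⟩))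

/-- Contraction changes incidence vectors by multiples of a single vector. -/
lemma rk_le_rk_contract (E : List Entry) (v u : ℕ) : rk E ≤ rk (contract v u E) + 1 := by
  set w : ℕ →₀ ℚ := Finsupp.single v 1 - Finsupp.single u 1 with hw
  have hmove : ∀ x, (Finsupp.single x 1 - Finsupp.single (move v u x) 1 : ℕ →₀ ℚ) ∈
      Submodule.span ℚ {w} := by
    intro x
    by_cases hx : x = v
    · rw [hx, move_self]; exact Submodule.mem_span_singleton_self _
    · rw [move_of_ne hx, sub_self]; exact Submodule.zero_mem _
  refine rk_le_succ w fun a ha => ?_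
  have h1 : vec a = ((Finsupp.single a.2.1 1 - Finsupp.single (move v u a.2.1) 1) -
      (Finsupp.single a.2.2 1 - Finsupp.single (move v u a.2.2) 1)) +
      (Finsupp.single (move v u a.2.1) 1 - Finsupp.single (move v u a.2.2) 1) := by
    rw [vec]; abel
  rw [h1]
  refine Submodule.add_mem_sup (Submodule.sub_mem _ (hmove _) (hmove _)) ?_
  by_cases hloop : move v u a.2.1 = move v u a.2.2
  · rw [hloop, sub_self]; exact Submodule.zero_mem _
  · exact vec_mem_cutSpace (a := (a.1, (move v u a.2.1, move v u a.2.2)))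
      (mem_contract.2 ⟨⟨a, ha, rfl⟩, hloop⟩)

/-- The incidence vectors of edges on `S` are combinations of the `S.card - 1` differences with a
fixed vertex. -/
lemma rk_lt_card {E : List Entry} {S : Finset ℕ} (hS : S.Nonempty)
    (h : ∀ a ∈ E, a.2.1 ∈ S ∧ a.2.2 ∈ S) : rk E + 1 ≤ S.card := by
  classical
  obtain ⟨x0, hx0⟩ := hS
  set T : Finset (ℕ →₀ ℚ) :=
    (S.erase x0).image fun x => Finsupp.single x 1 - Finsupp.single x0 1 with hT
  have hmem : ∀ x ∈ S, (Finsupp.single x 1 - Finsupp.single x0 1 : ℕ →₀ ℚ) ∈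
      Submodule.span ℚ (T : Set (ℕ →₀ ℚ)) := by
    intro x hx
    by_cases hxx : x = x0
    · rw [hxx, sub_self]; exact Submodule.zero_mem _
    · exact Submodule.subset_span (Finset.mem_coe.2 (Finset.mem_image.2
        ⟨x, Finset.mem_erase.2 ⟨hxx, hx⟩, rfl⟩))
  have hle : cutSpace E ≤ Submodule.span ℚ (T : Set (ℕ →₀ ℚ)) := by
    refine Submodule.span_le.2 ?_
    rintro _ ⟨a, ha, rfl⟩
    have : vec a = (Finsupp.single a.2.1 1 - Finsupp.single x0 1) -
        (Finsupp.single a.2.2 1 - Finsupp.single x0 1) := by rw [vec]; abel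
    rw [this]
    exact Submodule.sub_mem _ (hmem _ (h a ha).1) (hmem _ (h a ha).2)
  have h1 : rk E ≤ T.card := (Submodule.finrank_mono hle).trans (finrank_span_finset_le_card T)
  have h2 : T.card ≤ (S.erase x0).card := Finset.card_image_le
  have h3 := Finset.card_erase_add_one hx0
  omega

/-- The number of edges of a graph exceeds the rank by at most the feedback edge set number,
because the incidence vectors of the edges of a forest are linearly independent. -/
theorem length_le_rk_add_fes {n : ℕ} (G : SimpleGraph (Fin n)) {E : List Entry} (hE : Proper E)
    (hmem : ∀ a, a ∈ E ↔ ∃ i j : Fin n, i < j ∧ G.Adj i j ∧ a = ((↑i, ↑j), (↑i, ↑j))) :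
    E.length ≤ rk E + fes G := by
  classical
  obtain ⟨X, hX, hXcard⟩ : ∃ X : Set (Sym2 (Fin n)), IsFeedbackEdgeSet G X ∧ X.ncard = fes G := by
    refine Nat.sInf_mem (s := {k : ℕ | ∃ X : Set (Sym2 (Fin n)), IsFeedbackEdgeSet G X ∧
      X.ncard = k}) ⟨_, G.edgeSet, ⟨subset_rfl, ?_⟩, rfl⟩
    rw [SimpleGraph.deleteEdges_edgeSet, sdiff_self]
    exact SimpleGraph.isAcyclic_bot
  set inX : Entry → Bool := fun a => decide (∃ i j : Fin n, a.2 = (↑i, ↑j) ∧ s(i, j) ∈ X) with hinX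
  set F := E.filter fun a => !inX a with hF
  have hlen : E.length = (E.filter inX).length + F.length :=
    List.length_eq_length_filter_add inX
  have h1 : (E.filter inX).length ≤ X.ncard := by
    rw [← (hE.filter _).card_labels, ← Set.ncard_coe_finset]
    have : ((labels (E.filter inX) : Finset (ℕ × ℕ)) : Set (ℕ × ℕ)) ⊆
        (fun e : Sym2 (Fin n) => ((e.inf : ℕ), (e.sup : ℕ))) '' X := by
      intro p hp
      obtain ⟨a, ha, rfl⟩ := mem_labels.1 (Finset.mem_coe.1 hp)
      rw [List.mem_filter, hmem] at ha
      obtain ⟨⟨i, j, hij, -, rfl⟩, ha⟩ := ha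
      simp only [hinX, decide_eq_true_eq, Prod.mk.injEq] at ha
      obtain ⟨i', j', ⟨hi, hj⟩, hX'⟩ := ha
      obtain rfl := Fin.ext hi
      obtain rfl := Fin.ext hj
      refine ⟨_, hX', ?_⟩
      simp [min_eq_left hij.le, max_eq_right hij.le]
    exact (Set.ncard_le_ncard this (Set.toFinite _)).trans (Set.ncard_image_le (Set.toFinite _))
  -- `F` is the forest that remains after the deletion of `X`
  have hind : LinearIndependent ℚ (fun a : {a // a ∈ F.toFinset} => vec a.1) := by
    rw [linearIndependent_iff']
    rintro s g hsum ⟨a, ha⟩ has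
    have haF := ha
    rw [List.mem_toFinset, hF, List.mem_filter, hmem] at haF
    obtain ⟨⟨i, j, hij, hadj, haeq⟩, hna⟩ := haF
    have hH : (G.deleteEdges X).Adj i j := by
      rw [SimpleGraph.deleteEdges_adj]
      refine ⟨hadj, fun hx => ?_⟩
      simp only [hinX, Bool.not_eq_true', decide_eq_false_iff_not] at hna
      exact hna ⟨i, j, by rw [haeq], hx⟩
    have hbr := (SimpleGraph.isAcyclic_iff_forall_adj_isBridge.1 hX.2) hH
    rw [SimpleGraph.isBridge_iff] at hbr
    set R := (G.deleteEdges X).deleteEdges {s(i, j)} with hR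
    -- the functional that sums the coefficients over the component of `i` after removal of `a`
    set S : ℕ → ℚ := fun k => if ∃ m : Fin n, (m : ℕ) = k ∧ R.Reachable i m then 1 else 0 with hS
    have hSv : ∀ m : Fin n, S m = if R.Reachable i m then 1 else 0 := by
      intro m
      refine if_congr ⟨?_, fun h => ⟨m, rfl, h⟩⟩ rfl rfl
      rintro ⟨m', hm', h⟩
      rwa [← Fin.ext hm']
    have hφ : ∀ b : Entry, Finsupp.linearCombination ℚ S (vec b) = S b.2.1 - S b.2.2 := by
      intro b
      simp [vec, Finsupp.linearCombination_single]
    have h0 := congrArg (Finsupp.linearCombination ℚ S) hsum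
    rw [map_sum, map_zero, Finset.sum_eq_single ⟨a, ha⟩] at h0
    · have h1 : S a.2.1 - S a.2.2 = 1 := by
        rw [haeq, hSv, hSv, if_pos (SimpleGraph.Reachable.refl i), if_neg hbr, sub_zero]
      rw [map_smul, hφ, h1, smul_eq_mul, mul_one] at h0
      exact h0
    · rintro ⟨b, hb⟩ - hba
      rw [map_smul, hφ]
      rw [List.mem_toFinset, hF, List.mem_filter, hmem] at hb
      obtain ⟨⟨k, l, hkl, hadj', rfl⟩, hnb⟩ := hb
      have hne : s(k, l) ≠ s(i, j) := by
        intro h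
        refine hba (Subtype.ext ?_)
        rw [Sym2.eq_iff] at h
        rcases h with ⟨rfl, rfl⟩ | ⟨rfl, rfl⟩
        · exact haeq.symm
        · exact absurd hkl (lt_asymm hij)
      have hRkl : R.Adj k l := by
        rw [hR, SimpleGraph.deleteEdges_adj, SimpleGraph.deleteEdges_adj]
        refine ⟨⟨hadj', fun hx => ?_⟩, by simpa using hne⟩
        simp only [hinX, Bool.not_eq_true', decide_eq_false_iff_not] at hnb
        exact hnb ⟨k, l, rfl, hx⟩
      have : R.Reachable i k ↔ R.Reachable i l :=
        ⟨fun h => h.trans hRkl.reachable, fun h => h.trans hRkl.symm.reachable⟩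
      simp only [hSv, this, sub_self, smul_zero]
    · exact fun h => absurd has h
  have h2 : F.length = rk F := by
    have h := finrank_span_eq_card hind
    have hr : Set.range (fun a : {a // a ∈ F.toFinset} => vec a.1) = vec '' {a | a ∈ F} := by
      ext x; simp
    rw [hr, Fintype.card_coe, List.toFinset_card_of_nodup ((hE.filter _).nodup.of_map _)] at h
    exact h.symm
  have h3 : rk F ≤ rk E := rk_le_of_subset (List.filter_subset_self _)
  omega

/-! ### The reduction procedure -/

/-- All labels and endpoints are smaller than `N`. -/
def Within (N : ℕ) (E : List Entry) : Prop :=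
  ∀ a ∈ E, a.1.1 < N ∧ a.1.2 < N ∧ a.2.1 < N ∧ a.2.2 < N

/-- The entry with its endpoints in the opposite order. -/
def flip (a : Entry) : Entry := (a.1, (a.2.2, a.2.1))

/-- Delete a useless edge of a multigraph `S.1` with demands `S.2`, if there is one, that is, an
edge at both of whose endpoints the edges outnumber the demands by at most one. -/
def reduceDelete (S : List Entry × List Entry) : List Entry × List Entry :=
  (S.1.filter fun e => decide (deg S.1 e.2.1 ≤ deg S.2 e.2.1 + 1) &&
    decide (deg S.1 e.2.2 ≤ deg S.2 e.2.2 + 1)).head?.elim S fun e => (drop e.1 S.1, S.2)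

/-- Identify a vertex with a neighbour, if at least half of the edges and demands at the vertex are
edges to that neighbour; otherwise delete a useless edge. -/
def reduceContract (S : List Entry × List Entry) : List Entry × List Entry :=
  ((S.1 ++ S.1.map flip).filter fun a => decide (deg S.2 a.2.1 + deg S.1 a.2.1 ≤
    mult S.1 a.2.1 a.2.2 + mult S.1 a.2.1 a.2.2)).head?.elim (reduceDelete S)
      fun a => (contract a.2.1 a.2.2 S.1, contract a.2.1 a.2.2 S.2)

/-- Remove a demand that has the same endpoints as the edge `e`, together with `e`. -/
def reducePair (S : List Entry × List Entry) (e : Entry) : List Entry × List Entry :=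
  (S.2.filter fun d => joins d.2.1 d.2.2 e).head?.elim S fun d => (drop e.1 S.1, drop d.1 S.2)

/-- One reduction of a multigraph `S.1` with demands `S.2`, by the first applicable rule of the
following: remove an edge and a demand with the same endpoints, identify a vertex with a
neighbour, delete a useless edge. -/
def reduce (S : List Entry × List Entry) : List Entry × List Entry :=
  (S.1.filter fun e => S.2.any fun d => joins d.2.1 d.2.2 e).head?.elim (reduceContract S)
    (reducePair S)

/-- No rule is applicable. -/
structure Stuck (E D : List Entry) : Prop where
  no_pair : ∀ e ∈ E, ∀ d ∈ D, joins d.2.1 d.2.2 e = false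
  no_contract : ∀ u v, ∀ e ∈ E, joins v u e = true → 2 * mult E v u < deg D v + deg E v
  no_delete : ∀ e ∈ E, ¬ (deg E e.2.1 ≤ deg D e.2.1 + 1 ∧ deg E e.2.2 ≤ deg D e.2.2 + 1)

lemma drop_length_lt {E : List Entry} {e : Entry} (he : e ∈ E) :
    (drop e.1 E).length < E.length := by
  refine lt_of_le_of_ne (List.length_filter_le _ _) fun h => ?_
  have := List.length_filter_eq_length_iff.1 h e he
  simp at this

lemma drop_length_le (i : ℕ × ℕ) (E : List Entry) : (drop i E).length ≤ E.length :=
  List.length_filter_le _ _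

lemma contract_length_le (v u : ℕ) (E : List Entry) : (contract v u E).length ≤ E.length :=
  (List.length_filter_le _ _).trans (List.length_map _).le

lemma contract_length_lt {E : List Entry} {v u : ℕ} {e : Entry} (he : e ∈ E)
    (hj : joins v u e = true) : (contract v u E).length < E.length := by
  refine lt_of_le_of_ne (contract_length_le _ _ _) fun h => ?_
  rw [contract] at h
  have := List.length_filter_eq_length_iff.1 (h.trans (List.length_map _).symm) _
    (List.mem_map.2 ⟨e, he, rfl⟩)
  rw [joins_iff] at hj
  rcases hj with ⟨h1, h2⟩ | ⟨h1, h2⟩ <;> simp [h1, h2, move] at this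

lemma Within.drop {N : ℕ} {E : List Entry} (h : Within N E) (i : ℕ × ℕ) : Within N (drop i E) :=
  fun a ha => h a (mem_drop.1 ha).1

lemma Within.contract {N : ℕ} {E : List Entry} (h : Within N E) {u : ℕ} (hu : u < N) (v : ℕ) :
    Within N (contract v u E) := by
  intro a ha
  obtain ⟨⟨b, hb, rfl⟩, -⟩ := mem_contract.1 ha
  obtain ⟨h1, h2, h3, h4⟩ := h b hb
  refine ⟨h1, h2, ?_, ?_⟩ <;> simp only [move] <;> split_ifs <;> assumption

lemma joins_comm (u v : ℕ) : joins u v = joins v u := by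
  ext a
  exact Bool.or_comm _ _

lemma mult_comm (E : List Entry) (u v : ℕ) : mult E u v = mult E v u := by
  rw [mult, joins_comm, mult]

/-- What a reduction does: either the instance is stuck and remains unchanged, or one of the three
rules is applied. -/
lemma reduce_cases (S : List Entry × List Entry) :
    (reduce S = S ∧ Stuck S.1 S.2) ∨
    (∃ e ∈ S.1, ∃ d ∈ S.2, joins d.2.1 d.2.2 e = true ∧ reduce S = (drop e.1 S.1, drop d.1 S.2)) ∨
    (∃ u v, ∃ e ∈ S.1, joins v u e = true ∧ deg S.2 v + deg S.1 v ≤ 2 * mult S.1 v u ∧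
      reduce S = (contract v u S.1, contract v u S.2)) ∨
    (∃ e ∈ S.1, deg S.1 e.2.1 ≤ deg S.2 e.2.1 + 1 ∧ deg S.1 e.2.2 ≤ deg S.2 e.2.2 + 1 ∧
      (∀ d ∈ S.2, joins d.2.1 d.2.2 e = false) ∧ reduce S = (drop e.1 S.1, S.2)) := by
  rw [reduce, reduceContract, reduceDelete]
  cases h1 : (S.1.filter fun e => S.2.any fun d => joins d.2.1 d.2.2 e).head? with
  | some e =>
    have he := List.mem_of_head? h1
    rw [List.mem_filter, List.any_eq_true] at he
    obtain ⟨he, d, hd, hde⟩ := he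
    cases h2 : (S.2.filter fun d => joins d.2.1 d.2.2 e).head? with
    | none =>
      rw [List.head?_eq_none_iff, List.filter_eq_nil_iff] at h2
      exact absurd hde (h2 d hd)
    | some d =>
      have hd := List.mem_of_head? h2
      rw [List.mem_filter] at hd
      exact .inr (.inl ⟨e, he, d, hd.1, hd.2, by
        rw [Option.elim_some, reducePair, h2, Option.elim_some]⟩)
  | none =>
    rw [List.head?_eq_none_iff, List.filter_eq_nil_iff] at h1
    have h1' : ∀ e ∈ S.1, ∀ d ∈ S.2, joins d.2.1 d.2.2 e = false := by
      intro e he d hd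
      have := h1 e he
      rw [List.any_eq_true] at this
      simpa using fun h => this ⟨d, hd, h⟩
    cases h2 : ((S.1 ++ S.1.map flip).filter fun a => decide (deg S.2 a.2.1 + deg S.1 a.2.1 ≤
        mult S.1 a.2.1 a.2.2 + mult S.1 a.2.1 a.2.2)).head? with
    | some a =>
      have ha := List.mem_of_head? h2
      rw [List.mem_filter, List.mem_append, List.mem_map, decide_eq_true_eq, ← two_mul] at ha
      refine .inr (.inr (.inl ⟨a.2.2, a.2.1, ?_⟩))
      rcases ha with ⟨ha | ⟨b, hb, rfl⟩, hle⟩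
      · exact ⟨a, ha, by simp [joins], hle, rfl⟩
      · exact ⟨b, hb, by simp [joins, flip], hle, rfl⟩
    | none =>
      rw [List.head?_eq_none_iff, List.filter_eq_nil_iff] at h2
      cases h3 : (S.1.filter fun e => decide (deg S.1 e.2.1 ≤ deg S.2 e.2.1 + 1) &&
          decide (deg S.1 e.2.2 ≤ deg S.2 e.2.2 + 1)).head? with
      | some e =>
        have he := List.mem_of_head? h3
        rw [List.mem_filter, Bool.and_eq_true, decide_eq_true_eq, decide_eq_true_eq] at he
        exact .inr (.inr (.inr ⟨e, he.1, he.2.1, he.2.2, h1' e he.1, rfl⟩))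
      | none =>
        rw [List.head?_eq_none_iff, List.filter_eq_nil_iff] at h3
        refine .inl ⟨rfl, h1', fun u v e he hj => ?_, fun e he => by simpa using h3 e he⟩
        rw [joins_iff] at hj
        rcases hj with ⟨rfl, rfl⟩ | ⟨rfl, rfl⟩
        · have := h2 e (List.mem_append_left _ he)
          rw [decide_eq_true_eq] at this
          omega
        · have := h2 (flip e) (List.mem_append_right _ (List.mem_map.2 ⟨e, he, rfl⟩))
          rw [decide_eq_true_eq] at this
          simp only [flip] at this
          omega

lemma reduce_length_le (S : List Entry × List Entry) :
    (reduce S).1.length ≤ S.1.length ∧ (reduce S).2.length ≤ S.2.length := by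
  rcases reduce_cases S with ⟨h, -⟩ | ⟨e, -, d, -, -, h⟩ | ⟨u, v, -, -, -, -, h⟩ |
    ⟨e, -, -, -, -, h⟩ <;> rw [h]
  · exact ⟨le_rfl, le_rfl⟩
  · exact ⟨drop_length_le _ _, drop_length_le _ _⟩
  · exact ⟨contract_length_le _ _ _, contract_length_le _ _ _⟩
  · exact ⟨drop_length_le _ _, le_rfl⟩

lemma reduce_within {N : ℕ} {S : List Entry × List Entry} (h : Within N S.1 ∧ Within N S.2) :
    Within N (reduce S).1 ∧ Within N (reduce S).2 := by
  rcases reduce_cases S with ⟨h', -⟩ | ⟨e, -, d, -, -, h'⟩ | ⟨u, v, e, he, hj, -, h'⟩ |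
    ⟨e, -, -, -, -, h'⟩ <;> rw [h']
  · exact h
  · exact ⟨h.1.drop _, h.2.drop _⟩
  · have hu : u < N := by
      have := h.1 e he
      rw [joins_iff] at hj
      omega
    exact ⟨h.1.contract hu _, h.2.contract hu _⟩
  · exact ⟨h.1.drop _, h.2⟩

/-- A reduction yields an equivalent instance without increasing the difference between the number
of edges and the rank. -/
lemma reduce_spec {S : List Entry × List Entry} (hE : Proper S.1) (hD : Proper S.2) :
    (Proper (reduce S).1 ∧ Proper (reduce S).2) ∧
    (Solvable (reduce S).1 (reduce S).2 ↔ Solvable S.1 S.2) ∧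
    (reduce S).1.length + rk S.1 ≤ S.1.length + rk (reduce S).1 ∧
    ((reduce S = S ∧ Stuck S.1 S.2) ∨ (reduce S).1.length < S.1.length) := by
  rcases reduce_cases S with h | ⟨e, he, d, hd, hj, h⟩ | ⟨u, v, e, he, hj, hle, h⟩ |
    ⟨e, he, h1, h2, hno, h⟩
  · refine ⟨?_, ?_, ?_, .inl h⟩ <;> rw [h.1]
    exact ⟨hE, hD⟩
  · rw [h]
    have := rk_le_rk_drop hE he
    have := drop_length_lt he
    exact ⟨⟨hE.drop _, hD.drop _⟩, solvable_drop_drop hE hD he hd hj, by simp only; omega,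
      .inr this⟩
  · rw [h]
    have := rk_le_rk_contract S.1 v u
    have := contract_length_lt he hj
    exact ⟨⟨hE.contract _ _, hD.contract _ _⟩, solvable_contract hE hD hle, by simp only; omega,
      .inr this⟩
  · rw [h]
    have := rk_le_rk_drop hE he
    have := drop_length_lt he
    exact ⟨⟨hE.drop _, hD⟩, solvable_drop hE hD he h1 h2 hno, by simp only; omega, .inr this⟩

/-- Reduce as many times as there are edges at the beginning; every reduction of an instance that
is not stuck decreases the number of edges, so that the result is stuck. -/
def reduceAll (S : List Entry × List Entry) : List Entry × List Entry :=
  S.1.foldl (fun T _ => reduce T) S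

lemma foldl_reduce (l : List Entry) (S : List Entry × List Entry) :
    l.foldl (fun T _ => reduce T) S = reduce^[l.length] S := by
  induction l generalizing S with
  | nil => rfl
  | cons a l ih => rw [List.foldl_cons, ih, List.length_cons, Function.iterate_succ_apply]

lemma iterate_reduce_spec {S : List Entry × List Entry} (hE : Proper S.1) (hD : Proper S.2)
    (k : ℕ) :
    (Proper (reduce^[k] S).1 ∧ Proper (reduce^[k] S).2) ∧
    (Solvable (reduce^[k] S).1 (reduce^[k] S).2 ↔ Solvable S.1 S.2) ∧
    (reduce^[k] S).1.length + rk S.1 ≤ S.1.length + rk (reduce^[k] S).1 ∧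
    (S.1.length ≤ k → Stuck (reduce^[k] S).1 (reduce^[k] S).2) := by
  induction k generalizing S with
  | zero =>
    refine ⟨⟨hE, hD⟩, Iff.rfl, le_rfl, fun h => ?_⟩
    have h0 : S.1 = [] := List.eq_nil_of_length_eq_zero (by omega)
    constructor <;> simp [h0]
  | succ k ih =>
    obtain ⟨⟨h1, h2⟩, h3, h4, h5⟩ := reduce_spec hE hD
    obtain ⟨i1, i2, i3, i4⟩ := ih h1 h2
    rw [Function.iterate_succ_apply]
    refine ⟨i1, i2.trans h3, by omega, fun hk => ?_⟩
    rcases h5 with ⟨h5, h6⟩ | h5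
    · rw [h5, Function.iterate_fixed h5]
      exact h6
    · exact i4 (by omega)

lemma iterate_reduce_within {N : ℕ} {S : List Entry × List Entry}
    (h : Within N S.1 ∧ Within N S.2) (k : ℕ) :
    Within N (reduce^[k] S).1 ∧ Within N (reduce^[k] S).2 := by
  induction k with
  | zero => exact h
  | succ k ih => rw [Function.iterate_succ_apply']; exact reduce_within ih

lemma iterate_reduce_length (S : List Entry × List Entry) (k : ℕ) :
    (reduce^[k] S).1.length ≤ S.1.length ∧ (reduce^[k] S).2.length ≤ S.2.length := by
  induction k with
  | zero => exact ⟨le_rfl, le_rfl⟩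
  | succ k ih =>
    rw [Function.iterate_succ_apply']
    have := reduce_length_le (reduce^[k] S)
    omega

/-! ### The size of a stuck instance -/

/-- The edge `a` of `E` has an endpoint of degree at most two. -/
def light (E : List Entry) (a : Entry) : Bool :=
  decide (deg E a.2.1 ≤ 2) || decide (deg E a.2.2 ≤ 2)

/-- The vertices smaller than `N` that are endpoints of edges. -/
def support (N : ℕ) (E : List Entry) : List ℕ := (List.range N).filter fun v => decide (0 < deg E v)

lemma deg_cons (a : Entry) (E : List Entry) (v : ℕ) :
    deg (a :: E) v = (if touches v a = true then 1 else 0) + deg E v := by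
  rw [deg, List.filter_cons]
  split_ifs
  · rw [List.length_cons, deg, Nat.add_comm]
  · rw [deg, Nat.zero_add]

/-- Double counting of the incidences between a set of vertices and the edges. -/
lemma sum_deg {E : List Entry} (hE : ∀ a ∈ E, a.2.1 ≠ a.2.2) (S : Finset ℕ) :
    ∑ v ∈ S, deg E v =
      (E.map fun a => (if a.2.1 ∈ S then 1 else 0) + (if a.2.2 ∈ S then 1 else 0)).sum := by
  induction E with
  | nil => simp [deg]
  | cons a E ih =>
    rw [List.map_cons, List.sum_cons, ← ih fun b hb => hE b (List.mem_cons_of_mem _ hb)]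
    simp only [deg_cons]
    rw [Finset.sum_add_distrib]
    congr 1
    have hne := hE a List.mem_cons_self
    have : ∀ v ∈ S, (if touches v a = true then 1 else 0 : ℕ) =
        (if a.2.1 = v then 1 else 0) + (if a.2.2 = v then 1 else 0) := by
      intro v _
      rw [touches]
      by_cases h1 : a.2.1 = v
      · have h2 : a.2.2 ≠ v := fun h => hne (h1.trans h.symm)
        simp [h1, h2]
      · simp [h1]
    rw [Finset.sum_congr rfl this, Finset.sum_add_distrib, Finset.sum_ite_eq, Finset.sum_ite_eq]

lemma sum_deg_range {N : ℕ} {E : List Entry} (hE : Proper E) (hN : Within N E) :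
    ∑ v ∈ Finset.range N, deg E v = 2 * E.length := by
  rw [sum_deg hE.ne]
  have : E.map (fun a : Entry => (if a.2.1 ∈ Finset.range N then 1 else 0) +
      (if a.2.2 ∈ Finset.range N then 1 else 0)) = E.map fun _ => 2 := by
    refine List.map_congr_left fun a ha => ?_
    obtain ⟨-, -, h3, h4⟩ := hN a ha
    simp [h3, h4]
  rw [this, List.map_const', List.sum_replicate, smul_eq_mul, Nat.mul_comm]

lemma deg_pos {E : List Entry} {a : Entry} (ha : a ∈ E) {v : ℕ} (hv : touches v a = true) :
    0 < deg E v :=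
  List.length_pos_of_mem (List.mem_filter.2 ⟨ha, hv⟩)

lemma mult_pos {E : List Entry} {a : Entry} (ha : a ∈ E) {u v : ℕ} (hv : joins u v a = true) :
    0 < mult E u v :=
  List.length_pos_of_mem (List.mem_filter.2 ⟨ha, hv⟩)

lemma exists_joins {a : Entry} {v : ℕ} (hv : touches v a = true) : ∃ u, joins v u a = true := by
  rw [touches_iff] at hv
  rcases hv with h | h
  · exact ⟨a.2.2, joins_iff.2 (.inl ⟨h, rfl⟩)⟩
  · exact ⟨a.2.1, joins_iff.2 (.inr ⟨rfl, h⟩)⟩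

/-- In a stuck instance there are no vertices of degree one. -/
lemma Stuck.two_le_deg {E D : List Entry} (hS : Stuck E D) (hdeg : ∀ v, deg D v ≤ deg E v)
    {v : ℕ} (hv : 0 < deg E v) : 2 ≤ deg E v := by
  obtain ⟨a, ha⟩ := List.exists_mem_of_length_pos hv
  rw [List.mem_filter] at ha
  obtain ⟨u, hu⟩ := exists_joins ha.2
  have h1 := hS.no_contract u v a ha.1 hu
  have h2 := mult_pos ha.1 hu
  have h3 := hdeg v
  omega

/-- In a stuck instance, a vertex of degree two has two distinct neighbours, and it is an endpoint
of a demand. -/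
lemma Stuck.mult_eq_one {E D : List Entry} (hS : Stuck E D) (hdeg : ∀ v, deg D v ≤ deg E v)
    {u v : ℕ} (hv : deg E v ≤ 2) {a : Entry} (ha : a ∈ E) (huv : joins v u a = true) :
    mult E v u = 1 ∧ 1 ≤ deg D v := by
  have h1 := hS.no_contract u v a ha huv
  have h2 := mult_pos ha huv
  have h3 := hdeg v
  omega

/-- In a stuck instance, the vertices of degree two form an independent set. -/
lemma Stuck.not_both_light {E D : List Entry} (hS : Stuck E D) (hdeg : ∀ v, deg D v ≤ deg E v)
    {a : Entry} (ha : a ∈ E) : ¬ (deg E a.2.1 ≤ 2 ∧ deg E a.2.2 ≤ 2) := by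
  rintro ⟨h1, h2⟩
  have h3 := hS.mult_eq_one hdeg h1 ha (u := a.2.2) (joins_iff.2 (.inl ⟨rfl, rfl⟩))
  have h4 := hS.mult_eq_one hdeg h2 ha (u := a.2.1) (joins_iff.2 (.inr ⟨rfl, rfl⟩))
  exact hS.no_delete a ha ⟨by omega, by omega⟩

/-- The size of a stuck instance that has `k` more edges than its rank. -/
theorem Stuck.size_le {E D : List Entry} (hS : Stuck E D) (hdeg : ∀ v, deg D v ≤ deg E v)
    (hE : Proper E) (hD : Proper D) {N : ℕ} (hEN : Within N E) (hDN : Within N D) {k : ℕ}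
    (hk : E.length ≤ rk E + k) (hne : E ≠ []) :
    D.length ≤ E.length ∧ E.length + 6 ≤ 6 * k ∧
    (support N E).length + (E.filter fun a => !light E a).length + D.length + 11 ≤ 11 * k := by
  have hDE : D.length ≤ E.length := by
    have h1 := sum_deg_range hE hEN
    have h2 := sum_deg_range hD hDN
    have h3 : ∑ v ∈ Finset.range N, deg D v ≤ ∑ v ∈ Finset.range N, deg E v :=
      Finset.sum_le_sum fun v _ => hdeg v
    omega
  set S := (Finset.range N).filter fun v => 0 < deg E v with hSdef
  set S2 := S.filter fun v => deg E v ≤ 2 with hS2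
  set S3 := S.filter fun v => ¬ deg E v ≤ 2 with hS3
  have hmemS : ∀ a ∈ E, a.2.1 ∈ S ∧ a.2.2 ∈ S := by
    intro a ha
    obtain ⟨-, -, h3, h4⟩ := hEN a ha
    exact ⟨Finset.mem_filter.2 ⟨Finset.mem_range.2 h3, deg_pos ha (touches_iff.2 (.inl rfl))⟩,
      Finset.mem_filter.2 ⟨Finset.mem_range.2 h4, deg_pos ha (touches_iff.2 (.inr rfl))⟩⟩
  have hcard : S2.card + S3.card = S.card := Finset.card_filter_add_card_filter_not _
  have hsupp : (support N E).length = S.card := by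
    have h1 : (support N E).toFinset = S := by ext v; simp [support, hSdef]
    rw [← h1, support, List.toFinset_card_of_nodup (List.nodup_range.filter _)]
  have hrk : rk E + 1 ≤ S.card := by
    obtain ⟨a, ha⟩ := List.exists_mem_of_ne_nil E hne
    exact rk_lt_card ⟨_, (hmemS a ha).1⟩ hmemS
  -- every light edge has exactly one endpoint of degree two
  have hlight : ∑ v ∈ S2, deg E v = (E.filter (light E)).length := by
    rw [sum_deg hE.ne]
    have : ∀ a ∈ E, ((if a.2.1 ∈ S2 then 1 else 0) + (if a.2.2 ∈ S2 then 1 else 0) : ℕ) =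
        if light E a = true then 1 else 0 := by
      intro a ha
      have h1 := hS.not_both_light hdeg ha
      have h2 := hmemS a ha
      simp only [hS2, Finset.mem_filter, h2.1, h2.2, true_and, light, Bool.or_eq_true,
        decide_eq_true_eq]
      split_ifs <;> omega
    rw [List.map_congr_left this]
    clear * -
    generalize light E = p
    induction E with
    | nil => rfl
    | cons a E ih =>
      rw [List.map_cons, List.sum_cons, List.filter_cons, ih]
      split_ifs
      · rw [List.length_cons, Nat.add_comm]
      · rw [Nat.zero_add]
  have h2 : ∑ v ∈ S2, deg E v = 2 * S2.card := by
    rw [Finset.sum_congr rfl (g := fun _ => 2), Finset.sum_const, smul_eq_mul, Nat.mul_comm]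
    intro v hv
    rw [hS2, hSdef, Finset.mem_filter, Finset.mem_filter] at hv
    have := hS.two_le_deg hdeg hv.1.2
    omega
  have h3 : 3 * S3.card ≤ ∑ v ∈ S3, deg E v := by
    rw [Nat.mul_comm, ← smul_eq_mul, ← Finset.sum_const]
    refine Finset.sum_le_sum fun v hv => ?_
    rw [hS3, Finset.mem_filter] at hv
    omega
  have h4 : ∑ v ∈ S2, deg E v + ∑ v ∈ S3, deg E v ≤ 2 * E.length := by
    rw [hS2, hS3, Finset.sum_filter_add_sum_filter_not, ← sum_deg_range hE hEN]
    exact Finset.sum_le_sum_of_subset (Finset.filter_subset _ _)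
  have h5 : E.length = (E.filter (light E)).length + (E.filter fun a => !light E a).length :=
    List.length_eq_length_filter_add (light E)
  -- with `s₂`, `s₃` the sizes of `S2`, `S3` and `m` the number of edges, `2 s₂ + 3 s₃ ≤ 2 m` and
  -- `m ≤ s₂ + s₃ - 1 + k` give `s₃ ≤ 2 k - 2`, then `2 s₂ ≤ m` gives `s₂ ≤ 3 k - 3`, and finally
  -- `m ≤ 6 k - 6`; the second size is `s₂ + s₃ + (m - 2 s₂)` plus the number of demands
  omega

/-! ### Solutions as edge colourings -/

/-- A colouring of the edges in which every pair of `P` has its own colour and is joined by edges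
of that colour yields edge disjoint paths. -/
lemma HasSolution.of_coloring {V γ : Type*} {G : SimpleGraph V} {P : Set (Sym2 V)}
    (c : Sym2 V → γ) (l : Sym2 V → γ) (hl : Set.InjOn l P)
    (h : ∀ a b, s(a, b) ∈ P → EqvGen (fun x y => G.Adj x y ∧ c s(x, y) = l s(a, b)) a b) :
    HasSolution G P := by
  classical
  have key : ∀ p : P, ∃ (a b : V) (w : G.Walk a b), s(a, b) = (p : Sym2 V) ∧ w.IsPath ∧
      ∀ e ∈ w.edges, c e = l p := by
    rintro ⟨p, hp⟩
    induction p with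
    | h a b =>
      set H : SimpleGraph V := ⟨fun x y => G.Adj x y ∧ c s(x, y) = l s(a, b),
        ⟨fun x y hxy => ⟨hxy.1.symm, by rw [Sym2.eq_swap]; exact hxy.2⟩⟩,
        ⟨fun x hx => G.loopless.irrefl x hx.1⟩⟩ with hH
      have hle : H ≤ G := fun x y hxy => hxy.1
      have hr : ∀ x y, EqvGen H.Adj x y → H.Reachable x y := by
        intro x y hxy
        induction hxy with
        | rel x y hr => exact SimpleGraph.Adj.reachable hr
        | refl x => exact .refl x
        | symm x y _ ih => exact ih.symm
        | trans x y z _ _ ih ih' => exact ih.trans ih'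
      obtain ⟨w⟩ := hr a b (h a b hp)
      refine ⟨a, b, w.bypass.mapLe hle, rfl, w.bypass_isPath.mapLe hle, fun e he => ?_⟩
      rw [SimpleGraph.Walk.edges_mapLe_eq_edges] at he
      have := w.bypass.edges_subset_edgeSet he
      induction e with
      | h x y => exact this.2
  choose a b w h1 h2 h3 using key
  refine ⟨a, b, w, h1, h2, fun p q hpq e hep heq => hpq (Subtype.ext (hl p.2 q.2 ?_))⟩
  rw [← h3 p e hep, ← h3 q e heq]

/-- Edge disjoint paths yield a colouring of the edges in which every pair of `P` is joined by
edges that are coloured with that pair. -/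
lemma HasSolution.exists_coloring {V : Type*} {G : SimpleGraph V} {P : Set (Sym2 V)}
    (h : HasSolution G P) : ∃ c : Sym2 V → Sym2 V, ∀ a b, s(a, b) ∈ P →
      EqvGen (fun x y => G.Adj x y ∧ c s(x, y) = s(a, b)) a b := by
  classical
  obtain ⟨a, b, w, h1, -, h3⟩ := h
  refine ⟨fun e => if h : ∃ p : P, e ∈ (w p).edges then (h.choose : Sym2 V) else e,
    fun x y hxy => ?_⟩
  set p : P := ⟨s(x, y), hxy⟩ with hp
  have hc : ∀ e ∈ (w p).edges,
      (if h : ∃ p : P, e ∈ (w p).edges then (h.choose : Sym2 V) else e) = s(x, y) := by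
    intro e he
    have hex : ∃ p : P, e ∈ (w p).edges := ⟨p, he⟩
    rw [dif_pos hex]
    have : hex.choose = p := by
      by_contra hne
      exact h3 _ _ hne hex.choose_spec he
    rw [this]
  have key : ∀ (c : Sym2 V → Sym2 V) (u v : V) (q : G.Walk u v), (∀ e ∈ q.edges, c e = s(x, y)) →
      EqvGen (fun x' y' => G.Adj x' y' ∧ c s(x', y') = s(x, y)) u v := by
    intro c u v q
    induction q with
    | nil => exact fun _ => .refl _
    | cons hadj q ih =>
      intro hq
      rw [SimpleGraph.Walk.edges_cons] at hq
      exact .trans _ _ _ (.rel _ _ ⟨hadj, hq _ List.mem_cons_self⟩)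
        (ih fun e he => hq e (List.mem_cons_of_mem _ he))
  have h4 := key _ _ _ (w p) hc
  have h5 := h1 p
  rw [hp, Sym2.eq_iff] at h5
  rcases h5 with ⟨h6, h7⟩ | ⟨h6, h7⟩
  · rw [← hp] at h6 h7; rw [h6, h7] at h4; exact h4
  · rw [← hp] at h6 h7; rw [h6, h7] at h4; exact .symm _ _ h4

/-! ### Instances given by named vertices -/

/-- The graph on the positions of `N`, with adjacency given by the symmetric closure of `A`. -/
def nameGraph {α : Type} (N : List α) (A : α → α → Bool) (hA : ∀ a, A a a = false) :
    SimpleGraph (Fin N.length) where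
  Adj i j := (A (N.get i) (N.get j) || A (N.get j) (N.get i)) = true
  symm := ⟨fun i j h => by rwa [Bool.or_comm]⟩
  loopless := ⟨fun i h => by simp [hA] at h⟩

/-- The pairs of positions of `N` given by the symmetric closure of `B`. -/
def namePairs {α : Type} (N : List α) (B : α → α → Bool) : Set (Sym2 (Fin N.length)) :=
  {p | ∃ i j, p = s(i, j) ∧ B (N.get i) (N.get j) = true}

lemma mem_namePairs {α : Type} {N : List α} {B : α → α → Bool} {i j : Fin N.length} :
    s(i, j) ∈ namePairs N B ↔ (B (N.get i) (N.get j) || B (N.get j) (N.get i)) = true := by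
  rw [Bool.or_eq_true]
  constructor
  · rintro ⟨i', j', h, h'⟩
    rw [Sym2.eq_iff] at h
    rcases h with ⟨rfl, rfl⟩ | ⟨rfl, rfl⟩
    · exact .inl h'
    · exact .inr h'
  · rintro (h | h)
    · exact ⟨i, j, rfl, h⟩
    · exact ⟨j, i, Sym2.eq_swap, h⟩

/-- The instance with one vertex for every element of `N`; adjacency and the terminal pairs are
given by the symmetric closures of `A` and `B`. -/
def ofNames {α : Type} (N : List α) (A B : α → α → Bool)
    (hA : ∀ a, A a a = false) (hB : ∀ a, B a a = false) : Instance where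
  n := N.length
  G := nameGraph N A hA
  P := namePairs N B
  pairs := by
    rintro _ ⟨i, j, rfl, h⟩ hd
    rw [Sym2.mk_isDiag_iff] at hd
    rw [hd, hB] at h
    exact absurd h (by simp)

/-- The matrix of the symmetric closure of `A`. -/
def matrix {α : Type} (N : List α) (A : α → α → Bool) : List (List Bool) :=
  N.map fun a => N.map fun b => A a b || A b a

lemma encodeRel_eq {α : Type} (N : List α) (A : α → α → Bool)
    (R : Fin N.length → Fin N.length → Prop)
    (hR : ∀ i j, R i j ↔ (A (N.get i) (N.get j) || A (N.get j) (N.get i)) = true) :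
    encodeRel R = Enc.enc (matrix N A) := by
  have key : ∀ {β : Type} (f : α → β), List.ofFn (fun i => f (N.get i)) = N.map f := by
    intro β f
    have := (List.map_ofFn (f := N.get) (g := f)).symm
    rwa [List.ofFn_get] at this
  have h1 : ∀ i, (List.ofFn fun j => Data.ofBool (@decide (R i j) (Classical.propDecidable _))) =
      (N.map fun b => A (N.get i) b || A b (N.get i)).map Data.ofBool := by
    intro i
    rw [List.map_map, ← key]
    congr 1
    ext j
    congr 1
    rw [Bool.eq_iff_iff, @decide_eq_true_iff _ (Classical.propDecidable _), hR]
  rw [encodeRel]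
  change _ = Data.ofList ((matrix N A).map fun l => Data.ofList (l.map Data.ofBool))
  rw [matrix, List.map_map, ← key]
  congr 2
  ext i
  simp only [Function.comp]
  rw [← h1]

lemma encode_ofNames {α : Type} (N : List α) (A B : α → α → Bool)
    (hA : ∀ a, A a a = false) (hB : ∀ a, B a a = false) :
    (ofNames N A B hA hB).encode = Enc.enc (matrix N A, matrix N B) := by
  rw [Instance.encode]
  change Data.node _ _ = Data.node _ _
  congr 1
  · exact encodeRel_eq N A _ fun i j => Iff.rfl
  · exact encodeRel_eq N B _ fun i j => mem_namePairs

/-- Solutions as edge colourings, in terms of names instead of positions. -/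
lemma hasSolution_names_iff {α : Type} {N : List α} (hN : N.Nodup)
    (A B : α → α → Bool) (hA : ∀ a, A a a = false) :
    HasSolution (nameGraph N A hA) (namePairs N B) ↔
      ∃ c : Sym2 α → Sym2 α, ∀ a ∈ N, ∀ b ∈ N, B a b = true →
      EqvGen (fun x y => x ∈ N ∧ y ∈ N ∧ A x y = true ∧ c s(x, y) = s(a, b)) a b := by
  classical
  have hinj : Function.Injective N.get := List.nodup_iff_injective_get.1 hN
  have hinj' := Sym2.map.injective hinj
  constructor
  · intro h
    obtain ⟨c, hc⟩ := HasSolution.exists_coloring h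
    refine ⟨Function.extend (Sym2.map N.get) (Sym2.map N.get ∘ c) id, fun a ha b hb hab => ?_⟩
    obtain ⟨i, rfl⟩ := List.get_of_mem ha
    obtain ⟨j, rfl⟩ := List.get_of_mem hb
    refine eqvGen_map N.get (fun x y hxy => ?_) (hc i j ⟨i, j, rfl, hab⟩)
    have hcol : ∀ x y, c s(x, y) = s(i, j) → Function.extend (Sym2.map N.get)
        (Sym2.map N.get ∘ c) id s(N.get x, N.get y) = s(N.get i, N.get j) := by
      intro x y h
      exact (hinj'.extend_apply _ _ s(x, y)).trans (by rw [Function.comp, h, Sym2.map_mk])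
    rcases Bool.or_eq_true_iff.1 hxy.1 with h1 | h1
    · exact .rel _ _ ⟨List.get_mem _ _, List.get_mem _ _, h1, hcol _ _ hxy.2⟩
    · exact .symm _ _ (.rel _ _ ⟨List.get_mem _ _, List.get_mem _ _, h1,
        hcol _ _ (by rw [Sym2.eq_swap (a := y)]; exact hxy.2)⟩)
  · rintro ⟨c, hc⟩
    refine HasSolution.of_coloring (fun e => c (Sym2.map N.get e)) (Sym2.map N.get)
      hinj'.injOn fun i j hij => ?_
    have key : ∀ i j : Fin N.length, B (N.get i) (N.get j) = true →
        EqvGen (fun x y => (nameGraph N A hA).Adj x y ∧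
          c (Sym2.map N.get s(x, y)) = Sym2.map N.get s(i, j)) i j := by
      intro i j hij
      have h1 := eqvGen_map (Function.extend N.get id fun _ => i)
        (s := fun x y => (nameGraph N A hA).Adj x y ∧
          c (Sym2.map N.get s(x, y)) = Sym2.map N.get s(i, j)) (fun x y hxy => ?_)
        (hc _ (List.get_mem N i) _ (List.get_mem N j) hij)
      · rw [hinj.extend_apply, hinj.extend_apply] at h1
        exact h1
      · obtain ⟨hx, hy, hxy, hcol⟩ := hxy
        obtain ⟨x, rfl⟩ := List.get_of_mem hx
        obtain ⟨y, rfl⟩ := List.get_of_mem hy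
        rw [hinj.extend_apply, hinj.extend_apply]
        exact .rel _ _ ⟨Bool.or_eq_true_iff.2 (.inl hxy), hcol⟩
    rcases Bool.or_eq_true_iff.1 (mem_namePairs.1 hij) with h' | h'
    · exact key _ _ h'
    · rw [Sym2.eq_swap]
      exact .symm _ _ (key _ _ h')

/-! ### Reading an instance as a multigraph -/

/-- The entry of a matrix in row `i` and column `j`; `false` outside the matrix. -/
def get (M : List (List Bool)) (i j : ℕ) : Bool := (((M.drop i).headD []).drop j).headD false

/-- The list of all `(i, j)` with `i < j` at which the matrix is true, each with label `(i, j)`. -/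
def entries (M : List (List Bool)) : List Entry :=
  ((List.range M.length ×ˢ List.range M.length).filter
    fun p => decide (p.1 < p.2) && get M p.1 p.2).map fun p => (p, p)

open Classical in
/-- The matrix of a relation, as a list of rows. -/
noncomputable def relMatrix {n : ℕ} (R : Fin n → Fin n → Prop) : List (List Bool) :=
  List.ofFn fun i => List.ofFn fun j => decide (R i j)

lemma encodeRel_eq_relMatrix {n : ℕ} (R : Fin n → Fin n → Prop) :
    encodeRel R = Enc.enc (relMatrix R) := by
  change _ = Data.ofList ((relMatrix R).map fun l => Data.ofList (l.map Data.ofBool))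
  rw [encodeRel, relMatrix, List.map_ofFn]
  simp only [Function.comp_def, List.map_ofFn]

lemma length_relMatrix {n : ℕ} (R : Fin n → Fin n → Prop) : (relMatrix R).length = n := by
  simp [relMatrix]

lemma headD_drop_ofFn {n : ℕ} {α : Type} (f : Fin n → α) (d : α) (i : Fin n) :
    ((List.ofFn f).drop i).headD d = f i := by
  rw [List.headD_eq_head?_getD, List.head?_drop]
  simp

lemma get_relMatrix {n : ℕ} (R : Fin n → Fin n → Prop) (i j : Fin n) :
    get (relMatrix R) i j = true ↔ R i j := by
  rw [get, relMatrix, headD_drop_ofFn, headD_drop_ofFn,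
    @decide_eq_true_iff _ (Classical.propDecidable _)]

lemma mem_range_product {m i j : ℕ} :
    (i, j) ∈ (List.range m ×ˢ List.range m) ↔ i < m ∧ j < m := by
  rw [List.mem_product, List.mem_range, List.mem_range]

lemma mem_entries {n : ℕ} (R : Fin n → Fin n → Prop) (a : Entry) :
    a ∈ entries (relMatrix R) ↔
      ∃ i j : Fin n, i < j ∧ R i j ∧ a = (((i : ℕ), (j : ℕ)), ((i : ℕ), (j : ℕ))) := by
  simp only [entries, List.mem_map, List.mem_filter, mem_range_product,
    length_relMatrix, Bool.and_eq_true, decide_eq_true_eq, Prod.exists]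
  constructor
  · rintro ⟨i, j, ⟨⟨hi, hj⟩, hij, h⟩, rfl⟩
    exact ⟨⟨i, hi⟩, ⟨j, hj⟩, hij, (get_relMatrix R ⟨i, hi⟩ ⟨j, hj⟩).1 h, rfl⟩
  · rintro ⟨i, j, hij, h, rfl⟩
    exact ⟨i, j, ⟨⟨i.2, j.2⟩, hij, (get_relMatrix R i j).2 h⟩, rfl⟩

lemma entries_within (M : List (List Bool)) : Within M.length (entries M) := by
  intro a ha
  simp only [entries, List.mem_map, List.mem_filter, mem_range_product, Prod.exists]
    at ha
  obtain ⟨i, j, ⟨⟨hi, hj⟩, -⟩, rfl⟩ := ha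
  exact ⟨hi, hj, hi, hj⟩

lemma entries_proper (M : List (List Bool)) : Proper (entries M) := by
  constructor
  · intro a ha
    simp only [entries, List.mem_map, List.mem_filter, Bool.and_eq_true, decide_eq_true_eq] at ha
    obtain ⟨p, ⟨-, hp, -⟩, rfl⟩ := ha
    exact hp.ne
  · rw [entries, List.map_map]
    have : (Prod.fst ∘ fun p : ℕ × ℕ => (p, p)) = id := rfl
    rw [this, List.map_id]
    exact (List.nodup_range.product List.nodup_range).filter _

lemma sym2_mk_inf_sup {α : Type*} [LinearOrder α] (e : Sym2 α) : s(e.inf, e.sup) = e := by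
  induction e with
  | h a b =>
    rcases le_total a b with h | h
    · simp [h]
    · rw [Sym2.eq_swap]; simp [h]

/-- An instance is solvable if and only if the corresponding multigraph with demands is. -/
theorem solvable_entries_iff {n : ℕ} (G : SimpleGraph (Fin n)) (P : Set (Sym2 (Fin n)))
    (hP : ∀ p ∈ P, ¬ p.IsDiag) :
    Solvable (entries (relMatrix G.Adj)) (entries (relMatrix fun i j => s(i, j) ∈ P)) ↔
      HasSolution G P := by
  set key : Sym2 (Fin n) → ℕ × ℕ := fun e => ((e.inf : ℕ), (e.sup : ℕ)) with hkey
  have hkey' : ∀ i j : Fin n, i < j → key s(i, j) = ((i : ℕ), (j : ℕ)) := by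
    intro i j hij
    simp [hkey, min_eq_left hij.le, max_eq_right hij.le]
  have hinj : Function.Injective key := by
    intro e e' h
    rw [← sym2_mk_inf_sup e, ← sym2_mk_inf_sup e']
    simp only [hkey, Prod.mk.injEq] at h
    rw [Fin.ext h.1, Fin.ext h.2]
  constructor
  · rintro ⟨c, hc⟩
    refine HasSolution.of_coloring (fun e => c (key e)) key hinj.injOn ?_
    have main : ∀ a b, a < b → s(a, b) ∈ P →
        EqvGen (fun x y => G.Adj x y ∧ c (key s(x, y)) = key s(a, b)) a b := by
      intro a b hab hmem
      have h1 := eqvGen_map (fun k : ℕ => if h : k < n then (⟨k, h⟩ : Fin n) else a)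
        (s := fun x y => G.Adj x y ∧ c (key s(x, y)) = key s(a, b)) ?_
        (hc _ ((mem_entries _ _).2 ⟨a, b, hab, hmem, rfl⟩))
      · simpa using h1
      · rintro x y ⟨e, he, hce, hxy⟩
        obtain ⟨i, j, hij, hadj, rfl⟩ := (mem_entries _ _).1 he
        simp only [Prod.mk.injEq] at hxy
        obtain ⟨rfl, rfl⟩ := hxy
        simp only [Fin.is_lt, dif_pos]
        exact .rel _ _ ⟨hadj, by rw [hkey' _ _ hij, hkey' _ _ hab]; exact hce⟩
    intro a b hmem
    rcases lt_trichotomy a b with h | h | h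
    · exact main a b h hmem
    · exact absurd (Sym2.mk_isDiag_iff.2 h) (hP _ hmem)
    · rw [Sym2.eq_swap] at hmem ⊢
      exact .symm _ _ (main b a h hmem)
  · intro h
    obtain ⟨c, hc⟩ := h.exists_coloring
    refine ⟨Function.extend key (key ∘ c) id, fun d hd => ?_⟩
    obtain ⟨a, b, hab, hmem, rfl⟩ := (mem_entries _ _).1 hd
    refine eqvGen_map (fun i : Fin n => (i : ℕ)) ?_ (hc a b hmem)
    have main : ∀ x y, x < y → G.Adj x y → c s(x, y) = s(a, b) →
        Link (entries (relMatrix G.Adj)) (Function.extend key (key ∘ c) id)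
          ((a : ℕ), (b : ℕ)) (x : ℕ) (y : ℕ) := by
      intro x y hxy hadj hcol
      refine ⟨_, (mem_entries _ _).2 ⟨x, y, hxy, hadj, rfl⟩, ?_, rfl⟩
      rw [← hkey' _ _ hxy, hinj.extend_apply, Function.comp, hcol, hkey' _ _ hab]
    rintro x y ⟨hadj, hcol⟩
    rcases lt_trichotomy x y with h | h | h
    · exact .rel _ _ (main x y h hadj hcol)
    · exact absurd h hadj.ne
    · exact .symm _ _ (.rel _ _ (main y x h hadj.symm (by rw [Sym2.eq_swap]; exact hcol)))

/-! ### Writing a multigraph as an instance -/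

/-- The name of a vertex of the simple graph that represents a multigraph with demands: tag `0`
marks vertices of the multigraph, tag `1` midpoints of edges, and tag `2` leaves attached to the
first endpoints of demands. -/
abbrev Name := ℕ × Entry

/-- The name of the vertex `v`. -/
def vertexName (v : ℕ) : Name := (0, ((v, v), (v, v)))

/-- Adjacency of the name `a` of a vertex of the multigraph with the name `b`. Edges with an
endpoint of degree at most two are kept, all other edges are subdivided. -/
def nameAdj (E : List Entry) (a b : Name) : Bool :=
  a.1 == 0 && ((b.1 == 0 && (!(a.2.2.1 == b.2.2.1) &&
      E.any fun e => light E e && joins a.2.2.1 b.2.2.1 e)) ||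
    ((b.1 == 1 && touches a.2.2.1 b.2) || (b.1 == 2 && a.2.2.1 == b.2.2.1)))

/-- The leaf of a demand is paired with the second endpoint of the demand. -/
def namePair (a b : Name) : Bool := a.1 == 2 && (b.1 == 0 && a.2.2.2 == b.2.2.1)

/-- The names of the vertices that represent a multigraph with demands. -/
def names (N : ℕ) (E D : List Entry) : List Name :=
  (support N E).map vertexName ++
    ((E.filter fun a => !light E a).map (fun a => (1, a)) ++ D.map (fun d => (2, d)))

lemma nameAdj_self (E : List Entry) (a : Name) : nameAdj E a a = false := by
  rw [nameAdj]
  rcases a with ⟨_ | _ | _ | _, a⟩ <;> simp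

lemma namePair_self (a : Name) : namePair a a = false := by
  rw [namePair]
  rcases a with ⟨_ | _ | _ | _, a⟩ <;> simp

lemma mem_names {N : ℕ} {E D : List Entry} {a : Name} : a ∈ names N E D ↔
    (∃ v ∈ support N E, vertexName v = a) ∨ (∃ e ∈ E, light E e = false ∧ (1, e) = a) ∨
      ∃ d ∈ D, (2, d) = a := by
  simp only [names, List.mem_append, List.mem_map, List.mem_filter, Bool.not_eq_true', and_assoc]

lemma vertexName_injective : Function.Injective vertexName := by
  intro v w h
  simp only [vertexName, Prod.mk.injEq] at h
  exact h.2.2.1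

lemma names_nodup {N : ℕ} {E D : List Entry} (hE : Proper E) (hD : Proper D) :
    (names N E D).Nodup := by
  rw [names, List.nodup_append, List.nodup_append]
  refine ⟨(List.nodup_range.filter _).map vertexName_injective,
    ⟨((hE.filter _).nodup.of_map _).map fun a b h => (Prod.ext_iff.1 h).2,
      (hD.nodup.of_map _).map fun a b h => (Prod.ext_iff.1 h).2, ?_⟩, ?_⟩
  · intro a ha b hb
    simp only [List.mem_map] at ha hb
    obtain ⟨_, -, rfl⟩ := ha
    obtain ⟨_, -, rfl⟩ := hb
    simp
  · intro a ha b hb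
    simp only [List.mem_append, List.mem_map] at ha hb
    obtain ⟨_, -, rfl⟩ := ha
    rcases hb with ⟨_, -, rfl⟩ | ⟨_, -, rfl⟩ <;> simp [vertexName]

lemma mem_support {N : ℕ} {E : List Entry} {v : ℕ} :
    v ∈ support N E ↔ v < N ∧ 0 < deg E v := by
  simp [support]

lemma length_names (N : ℕ) (E D : List Entry) : (names N E D).length =
    (support N E).length + (E.filter fun a => !light E a).length + D.length := by
  simp only [names, List.length_append, List.length_map, Nat.add_assoc]

section Output

variable {E D : List Entry} {N : ℕ}

/-- Light edges have no parallel edges, so that they need not be subdivided. -/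
lemma Stuck.light_unique (hS : Stuck E D) (hdeg : ∀ v, deg D v ≤ deg E v) {a b : Entry}
    (ha : a ∈ E) (hb : b ∈ E) (hla : light E a = true) {u v : ℕ} (hja : joins u v a = true)
    (hjb : joins u v b = true) : a = b := by
  have h1 : mult E u v = 1 := by
    rw [light, Bool.or_eq_true, decide_eq_true_eq, decide_eq_true_eq] at hla
    have hja' : joins v u a = true := by rw [joins_comm]; exact hja
    have : deg E u ≤ 2 ∨ deg E v ≤ 2 := by
      rw [joins_iff] at hja
      rcases hja with ⟨rfl, rfl⟩ | ⟨rfl, rfl⟩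
      · exact hla
      · exact hla.symm
    rcases this with h | h
    · exact (hS.mult_eq_one hdeg h ha hja).1
    · rw [mult_comm]; exact (hS.mult_eq_one hdeg h ha hja').1
  obtain ⟨e, he⟩ := List.length_eq_one_iff.1 h1
  have h2 : a ∈ E.filter (joins u v) := List.mem_filter.2 ⟨ha, hja⟩
  have h3 : b ∈ E.filter (joins u v) := List.mem_filter.2 ⟨hb, hjb⟩
  rw [he, List.mem_singleton] at h2 h3
  rw [h2, h3]

/-- The pair of names that represents a demand. -/
def demandPair (d : Entry) : Sym2 Name := s((2, d), vertexName d.2.2)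

lemma demandPair_injective : Function.Injective demandPair := by
  intro d d' h
  rw [demandPair, demandPair, Sym2.eq_iff] at h
  rcases h with ⟨h, -⟩ | ⟨h, -⟩
  · exact (Prod.ext_iff.1 h).2
  · simp [vertexName] at h

lemma namePair_iff {N : ℕ} {a b : Name} (ha : a ∈ names N E D) (hb : b ∈ names N E D) :
    namePair a b = true ↔ ∃ d ∈ D, a = (2, d) ∧ b = vertexName d.2.2 := by
  rw [namePair]
  rcases mem_names.1 ha with ⟨v, -, rfl⟩ | ⟨e, -, -, rfl⟩ | ⟨d, hd, rfl⟩
  · simp [vertexName]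
  · simp
  · rcases mem_names.1 hb with ⟨v, -, rfl⟩ | ⟨e, -, -, rfl⟩ | ⟨d', -, rfl⟩
    · change (true && (true && d.2.2 == v)) = true ↔ _
      rw [Bool.true_and, Bool.true_and, beq_iff_eq]
      constructor
      · rintro rfl
        exact ⟨d, hd, rfl, rfl⟩
      · rintro ⟨d', -, h, h'⟩
        obtain rfl : d = d' := (Prod.ext_iff.1 h).2
        exact (vertexName_injective h').symm
    · simp [vertexName]
    · simp [vertexName]

/-- A multigraph with demands to which no rule applies, and the simple graph that represents it,
are equivalent. -/
theorem solvable_iff_names (hS : Stuck E D) (hdeg : ∀ v, deg D v ≤ deg E v) (hE : Proper E)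
    (hD : Proper D) (hEN : Within N E) (hDN : Within N D) :
    HasSolution (nameGraph (names N E D) (nameAdj E) (nameAdj_self E))
      (namePairs (names N E D) namePair) ↔ Solvable E D := by
  classical
  rw [hasSolution_names_iff (names_nodup hE hD)]
  have hsuppE : ∀ e ∈ E, ∀ v, touches v e = true → v ∈ support N E := by
    intro e he v hv
    obtain ⟨-, -, h3, h4⟩ := hEN e he
    refine mem_support.2 ⟨?_, deg_pos he hv⟩
    rw [touches_iff] at hv
    omega
  have hsuppD : ∀ d ∈ D, ∀ v, touches v d = true → v ∈ support N E := by
    intro d hd v hv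
    obtain ⟨-, -, h3, h4⟩ := hDN d hd
    refine mem_support.2 ⟨?_, (deg_pos hd hv).trans_le (hdeg v)⟩
    rw [touches_iff] at hv
    omega
  have hvert : ∀ v ∈ support N E, vertexName v ∈ names N E D := fun v hv =>
    mem_names.2 (.inl ⟨v, hv, rfl⟩)
  have hheavy : ∀ e ∈ E, light E e = false → ((1, e) : Name) ∈ names N E D := fun e he hl =>
    mem_names.2 (.inr (.inl ⟨e, he, hl, rfl⟩))
  have hleaf : ∀ d ∈ D, ((2, d) : Name) ∈ names N E D := fun d hd =>
    mem_names.2 (.inr (.inr ⟨d, hd, rfl⟩))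
  have hfst : ∀ a : Entry, touches a.2.1 a = true := fun a => touches_iff.2 (.inl rfl)
  have hsnd : ∀ a : Entry, touches a.2.2 a = true := fun a => touches_iff.2 (.inr rfl)
  constructor
  · rintro ⟨c, hc⟩
    -- a subdivided edge takes the colour of its half at the first endpoint
    set c' : ℕ × ℕ → ℕ × ℕ := fun i => if h : ∃ e ∈ E, e.1 = i then
      Function.extend demandPair Prod.fst (fun _ => (0, 0))
        (c (if light E h.choose = true then
          s(vertexName h.choose.2.1, vertexName h.choose.2.2)
          else s(vertexName h.choose.2.1, (1, h.choose)))) else (0, 0) with hc'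
    have hc'_light : ∀ e ∈ E, light E e = true → ∀ d,
        c s(vertexName e.2.1, vertexName e.2.2) = demandPair d → c' e.1 = d.1 := by
      intro e he hl d h
      have hex : ∃ e' ∈ E, e'.1 = e.1 := ⟨e, he, rfl⟩
      have heq : hex.choose = e := hE.eq_of_label hex.choose_spec.1 he hex.choose_spec.2
      simp only [hc', dif_pos hex, heq, if_pos hl, h]
      exact demandPair_injective.extend_apply _ _ d
    have hc'_heavy : ∀ e ∈ E, light E e = false → ∀ d,
        c s(vertexName e.2.1, (1, e)) = demandPair d → c' e.1 = d.1 := by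
      intro e he hl d h
      have hex : ∃ e' ∈ E, e'.1 = e.1 := ⟨e, he, rfl⟩
      have heq : hex.choose = e := hE.eq_of_label hex.choose_spec.1 he hex.choose_spec.2
      simp only [hc', dif_pos hex, heq, hl, Bool.false_eq_true, if_false, h]
      exact demandPair_injective.extend_apply _ _ d
    refine ⟨c', fun d hd => ?_⟩
    -- retract the simple graph to the multigraph: a leaf goes to its neighbour, and a midpoint to
    -- the first endpoint if that half has the colour of `d`, and to the second endpoint otherwise
    set ρ : Name → ℕ := fun b => if b.1 = 1 then
      (if c s(vertexName b.2.2.1, b) = demandPair d then b.2.2.1 else b.2.2.2) else b.2.2.1 with hρ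
    refine eqvGen_map ρ ?_ (hc (2, d) (hleaf d hd) (vertexName d.2.2)
      (hvert _ (hsuppD d hd _ (hsnd d))) (by simp [namePair, vertexName]))
    rintro a b ⟨ha, hb, hab, hcol⟩
    rcases mem_names.1 ha with ⟨v, -, rfl⟩ | ⟨e, -, -, rfl⟩ | ⟨d', -, rfl⟩
    · rcases mem_names.1 hb with ⟨w, -, rfl⟩ | ⟨e, he, hl, rfl⟩ | ⟨d', -, rfl⟩
      · have h1 : v ≠ w ∧ ∃ e ∈ E, light E e = true ∧ joins v w e = true := by
          simpa [nameAdj, vertexName] using hab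
        obtain ⟨-, e, he, hl, hj⟩ := h1
        change EqvGen _ v w
        rw [joins_iff] at hj
        rcases hj with ⟨rfl, rfl⟩ | ⟨rfl, rfl⟩
        · exact .rel _ _ ⟨e, he, hc'_light e he hl d hcol, rfl⟩
        · rw [Sym2.eq_swap] at hcol
          exact .symm _ _ (.rel _ _ ⟨e, he, hc'_light e he hl d hcol, rfl⟩)
      · have h1 : touches v e = true := by simpa [nameAdj, vertexName] using hab
        change EqvGen _ v (if c s(vertexName e.2.1, (1, e)) = demandPair d then e.2.1 else e.2.2)
        rw [touches_iff] at h1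
        split_ifs with h2
        · rcases h1 with rfl | rfl
          · exact .refl _
          · exact .symm _ _ (.rel _ _ ⟨e, he, hc'_heavy e he hl d h2, rfl⟩)
        · rcases h1 with rfl | rfl
          · exact absurd hcol h2
          · exact .refl _
      · have h1 : v = d'.2.1 := by simpa [nameAdj, vertexName] using hab
        change EqvGen _ v d'.2.1
        rw [h1]
        exact .refl _
    · simp [nameAdj] at hab
    · simp [nameAdj] at hab
  · rintro ⟨c, hc⟩
    set pairOf : ℕ × ℕ → Sym2 Name := fun i => if h : ∃ d ∈ D, d.1 = i then
      demandPair h.choose else s(vertexName 0, vertexName 0) with hpairOf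
    have hpairOf' : ∀ d ∈ D, pairOf d.1 = demandPair d := by
      intro d hd
      have hex : ∃ d' ∈ D, d'.1 = d.1 := ⟨d, hd, rfl⟩
      simp only [hpairOf, dif_pos hex]
      rw [hD.eq_of_label hex.choose_spec.1 hd hex.choose_spec.2]
    -- both halves of a subdivided edge inherit its colour, and the edge at a leaf is coloured with
    -- the demand of the leaf
    set half : Name → ℕ × ℕ := fun b => if b.1 = 1 then c b.2.1 else b.2.1 with hhalf
    -- an edge that is not subdivided is determined by its endpoints, see `Stuck.light_unique`
    set direct : ℕ → ℕ → ℕ × ℕ := fun v w =>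
      ((E.filter fun e => light E e && joins v w e).head?).elim (0, 0) fun e => c e.1 with hdirect
    set col : Sym2 Name → ℕ × ℕ := Sym2.lift ⟨fun a b =>
      if a.1 = 0 then (if b.1 = 0 then direct a.2.2.1 b.2.2.1 else half b)
      else if b.1 = 0 then half a else (0, 0), by
        intro a b
        by_cases h1 : a.1 = 0 <;> by_cases h2 : b.1 = 0 <;> simp only [h1, h2, if_true, if_false]
        simp only [hdirect, joins_comm]⟩ with hcol
    have hcol_light : ∀ e ∈ E, light E e = true →
        col s(vertexName e.2.1, vertexName e.2.2) = c e.1 := by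
      intro e he hl
      change ((E.filter fun e' => light E e' && joins e.2.1 e.2.2 e').head?).elim (0, 0)
        (fun e => c e.1) = c e.1
      have hj : joins e.2.1 e.2.2 e = true := joins_iff.2 (.inl ⟨rfl, rfl⟩)
      have hmem : e ∈ E.filter fun e' => light E e' && joins e.2.1 e.2.2 e' :=
        List.mem_filter.2 ⟨he, by rw [hl, hj]; rfl⟩
      cases hh : (E.filter fun e' => light E e' && joins e.2.1 e.2.2 e').head? with
      | none =>
        rw [List.head?_eq_none_iff] at hh
        rw [hh] at hmem
        exact absurd hmem List.not_mem_nil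
      | some b =>
        have hb := List.mem_of_head? hh
        rw [List.mem_filter, Bool.and_eq_true] at hb
        rw [hS.light_unique hdeg he hb.1 hl hj hb.2.2, Option.elim_some]
    refine ⟨fun e => pairOf (col e), fun a ha b hb hab => ?_⟩
    obtain ⟨d, hd, rfl, rfl⟩ := (namePair_iff ha hb).1 hab
    have hpd := hpairOf' d hd
    refine .trans _ (vertexName d.2.1) _ (.symm _ _ (.rel _ _ ⟨hvert _ (hsuppD d hd _ (hfst d)),
      ha, by simp [nameAdj, vertexName], hpd⟩)) ?_
    refine eqvGen_map vertexName ?_ (hc d hd)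
    rintro x y ⟨e, he, hce, hxy⟩
    have hx : e.2.1 = x := by rw [hxy]
    have hy : e.2.2 = y := by rw [hxy]
    have hvx := hvert _ (hsuppE e he _ (hfst e))
    have hvy := hvert _ (hsuppE e he _ (hsnd e))
    rw [← hx, ← hy]
    cases hl : light E e with
    | true =>
      refine .rel _ _ ⟨hvx, hvy, ?_, ?_⟩
      · have : ∃ e' ∈ E, light E e' = true ∧ joins e.2.1 e.2.2 e' = true :=
          ⟨e, he, hl, joins_iff.2 (.inl ⟨rfl, rfl⟩)⟩
        simpa [nameAdj, vertexName, hE.ne e he] using this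
      · simp only [hcol_light e he hl, hce]
        exact hpd
    | false =>
      have h1 : ∀ v, touches v e = true → v ∈ support N E →
          EqvGen (fun x y => x ∈ names N E D ∧ y ∈ names N E D ∧ nameAdj E x y = true ∧
            pairOf (col s(x, y)) = s((2, d), vertexName d.2.2)) (vertexName v) (1, e) := by
        intro v hv hvs
        refine .rel _ _ ⟨hvert v hvs, hheavy e he hl, by simpa [nameAdj, vertexName] using hv, ?_⟩
        change pairOf (c e.1) = _
        rw [hce]
        exact hpd
      exact .trans _ _ _ (h1 _ (hfst e) (hsuppE e he _ (hfst e)))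
        (.symm _ _ (h1 _ (hsnd e) (hsuppE e he _ (hsnd e))))

end Output

/-! ### The kernel is computable in polynomial time -/

namespace PT

variable {α β : Type} [Enc α] [Enc β]

lemma touches {f : α → ℕ} {g : α → Entry} (hf : PT f) (hg : PT g) :
    PT (fun a => touches (f a) (g a)) :=
  (nat_beq (fst.comp (snd.comp hg)) hf).or (nat_beq (snd.comp (snd.comp hg)) hf)

lemma joins {f g : α → ℕ} {h : α → Entry} (hf : PT f) (hg : PT g) (hh : PT h) :
    PT (fun a => joins (f a) (g a) (h a)) :=
  ((nat_beq (fst.comp (snd.comp hh)) hf).and (nat_beq (snd.comp (snd.comp hh)) hg)).or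
    ((nat_beq (fst.comp (snd.comp hh)) hg).and (nat_beq (snd.comp (snd.comp hh)) hf))

lemma deg {f : α → List Entry} {g : α → ℕ} (hf : PT f) (hg : PT g) :
    PT (fun a => deg (f a) (g a)) :=
  list_length (list_filter (g := fun a e => EDP.touches (g a) e) hf (touches (hg.comp fst) snd))

lemma mult {f : α → List Entry} {g h : α → ℕ} (hf : PT f) (hg : PT g) (hh : PT h) :
    PT (fun a => mult (f a) (g a) (h a)) :=
  list_length (list_filter (g := fun a e => EDP.joins (g a) (h a) e) hf
    (joins (hg.comp fst) (hh.comp fst) snd))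

lemma drop {f : α → ℕ × ℕ} {g : α → List Entry} (hf : PT f) (hg : PT g) :
    PT (fun a => drop (f a) (g a)) :=
  list_filter (g := fun a (e : Entry) => !(e.1.1 == (f a).1 && e.1.2 == (f a).2)) hg
    ((nat_beq (fst.comp (fst.comp snd)) (fst.comp (hf.comp fst))).and
      (nat_beq (snd.comp (fst.comp snd)) (snd.comp (hf.comp fst)))).not

lemma move {f g h : α → ℕ} (hf : PT f) (hg : PT g) (hh : PT h) :
    PT (fun a => move (f a) (g a) (h a)) :=
  cond (c := fun a => h a == f a) (nat_beq hh hf) hg hh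

lemma contract {f g : α → ℕ} {h : α → List Entry} (hf : PT f) (hg : PT g) (hh : PT h) :
    PT (fun a => contract (f a) (g a) (h a)) :=
  list_filter (g := fun _ (e : Entry) => !(e.2.1 == e.2.2))
    (list_map (g := fun a (e : Entry) => (e.1, (EDP.move (f a) (g a) e.2.1,
      EDP.move (f a) (g a) e.2.2))) hh
      ((fst.comp snd).pair ((move (hf.comp fst) (hg.comp fst) (fst.comp (snd.comp snd))).pair
        (move (hf.comp fst) (hg.comp fst) (snd.comp (snd.comp snd))))))
    (nat_beq (fst.comp (snd.comp snd)) (snd.comp (snd.comp snd))).not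

lemma flip : PT flip := fst.pair ((snd.comp snd).pair (fst.comp snd))

lemma reduceDelete : PT reduceDelete := by
  refine option_elim (list_head? (list_filter (f := fun S : List Entry × List Entry => S.1)
    (g := fun S e => decide (EDP.deg S.1 e.2.1 ≤ EDP.deg S.2 e.2.1 + 1) &&
      decide (EDP.deg S.1 e.2.2 ≤ EDP.deg S.2 e.2.2 + 1)) fst ?_)) PT.id
    (h := fun S e => (EDP.drop e.1 S.1, S.2))
    ((drop (fst.comp snd) (fst.comp fst)).pair (snd.comp fst))
  have h1 : PT (fun p : (List Entry × List Entry) × Entry => p.2.2.1) := fst.comp (snd.comp snd)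
  have h2 : PT (fun p : (List Entry × List Entry) × Entry => p.2.2.2) := snd.comp (snd.comp snd)
  exact (nat_le (deg (fst.comp fst) h1) (nat_succ (deg (snd.comp fst) h1))).and
    (nat_le (deg (fst.comp fst) h2) (nat_succ (deg (snd.comp fst) h2)))

lemma reduceContract : PT reduceContract := by
  have h1 : PT (fun p : (List Entry × List Entry) × Entry => p.2.2.1) := fst.comp (snd.comp snd)
  have h2 : PT (fun p : (List Entry × List Entry) × Entry => p.2.2.2) := snd.comp (snd.comp snd)
  have h3 : PT (fun p : (List Entry × List Entry) × Entry => p.1.1) := fst.comp fst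
  have h4 : PT (fun p : (List Entry × List Entry) × Entry => p.1.2) := snd.comp fst
  refine option_elim (list_head? (list_filter
    (f := fun S : List Entry × List Entry => S.1 ++ S.1.map EDP.flip)
    (g := fun S a => decide (EDP.deg S.2 a.2.1 + EDP.deg S.1 a.2.1 ≤
      EDP.mult S.1 a.2.1 a.2.2 + EDP.mult S.1 a.2.1 a.2.2)) ?_ ?_)) reduceDelete
    (h := fun S a => (EDP.contract a.2.1 a.2.2 S.1, EDP.contract a.2.1 a.2.2 S.2))
    ((contract h1 h2 h3).pair (contract h1 h2 h4))
  · exact list_append fst (list_map (g := fun _ e => EDP.flip e) fst (flip.comp snd))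
  · exact nat_le (nat_add (deg h4 h1) (deg h3 h1)) (nat_add (mult h3 h1 h2) (mult h3 h1 h2))

lemma reducePair :
    PT (fun p : (List Entry × List Entry) × Entry => reducePair p.1 p.2) := by
  refine option_elim (list_head? (list_filter
    (f := fun p : (List Entry × List Entry) × Entry => p.1.2)
    (g := fun p d => EDP.joins d.2.1 d.2.2 p.2) (snd.comp fst)
    (joins (fst.comp (snd.comp snd)) (snd.comp (snd.comp snd)) (snd.comp fst)))) fst
    (h := fun p d => (EDP.drop p.2.1 p.1.1, EDP.drop d.1 p.1.2)) ?_
  exact (drop (fst.comp (snd.comp fst)) (fst.comp (fst.comp fst))).pair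
    (drop (fst.comp snd) (snd.comp (fst.comp fst)))

lemma reduce : PT reduce := by
  refine option_elim (list_head? (list_filter (f := fun S : List Entry × List Entry => S.1)
    (g := fun S e => S.2.any fun d => EDP.joins d.2.1 d.2.2 e) fst ?_)) reduceContract reducePair
  exact list_any (f := fun p : (List Entry × List Entry) × Entry => p.1.2)
    (g := fun p d => EDP.joins d.2.1 d.2.2 p.2) (snd.comp fst)
    (joins (fst.comp (snd.comp snd)) (snd.comp (snd.comp snd)) (snd.comp fst))

/-- Labels and endpoints are encoded in unary. -/
lemma within_esize {E : List Entry} {N : ℕ} (h : esize E ≤ N) : Within N E := by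
  intro a ha
  have h1 := esize_le_of_mem ha
  obtain ⟨⟨i, j⟩, x, y⟩ := a
  simp only [esize_pair, esize_nat] at h1
  refine ⟨?_, ?_, ?_, ?_⟩ <;> simp only <;> omega

lemma esize_le_of_within {E : List Entry} {N : ℕ} (h : Within N E) :
    esize E ≤ E.length * (8 * N + 8) + 1 := by
  refine esize_le_of_forall E (8 * N + 7) fun a ha => ?_
  have h1 := h a ha
  obtain ⟨⟨i, j⟩, x, y⟩ := a
  simp only [esize_pair, esize_nat] at h1 ⊢
  omega

lemma reduceAll : PT reduceAll := by
  refine list_foldl (f := fun S : List Entry × List Entry => S.1) (g := fun S => S)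
    (h := fun _ T _ => EDP.reduce T) fst PT.id (reduce.comp (fst.comp snd))
    (2 * (Polynomial.X * (8 * Polynomial.X + 8) + 1) + 1) fun S l _ => ?_
  -- reductions introduce no new labels and endpoints and never lengthen the lists, which bounds the
  -- size of every intermediate result
  rw [foldl_reduce]
  have h0 : esize S = esize S.1 + esize S.2 + 1 := rfl
  obtain ⟨h1, h2⟩ := iterate_reduce_within (N := esize S) (S := S)
    ⟨within_esize (by omega), within_esize (by omega)⟩ l.length
  obtain ⟨h3, h4⟩ := iterate_reduce_length S l.length
  have h5 := length_lt_esize S.1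
  have h6 := length_lt_esize S.2
  generalize EDP.reduce^[l.length] S = T at *
  have h7 : T.1.length * (8 * esize S + 8) ≤ esize S * (8 * esize S + 8) :=
    Nat.mul_le_mul_right _ (by omega)
  have h8 : T.2.length * (8 * esize S + 8) ≤ esize S * (8 * esize S + 8) :=
    Nat.mul_le_mul_right _ (by omega)
  have h9 := esize_le_of_within h1
  have h10 := esize_le_of_within h2
  have h11 : esize T = esize T.1 + esize T.2 + 1 := rfl
  simp only [Polynomial.eval_add, Polynomial.eval_mul, Polynomial.eval_X, Polynomial.eval_ofNat,
    Polynomial.eval_one]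
  omega

lemma get {f : α → List (List Bool)} {g h : α → ℕ} (hf : PT f) (hg : PT g) (hh : PT h) :
    PT (fun a => get (f a) (g a) (h a)) :=
  list_headD false (list_drop hh (list_headD [] (list_drop hg hf)))

lemma entries {f : α → List (List Bool)} (hf : PT f) : PT (fun a => entries (f a)) :=
  list_map (g := fun _ (p : ℕ × ℕ) => (p, p))
    (list_filter (g := fun a (p : ℕ × ℕ) => decide (p.1 < p.2) && EDP.get (f a) p.1 p.2)
      (list_product (list_range (list_length hf)) (list_range (list_length hf)))
      ((nat_lt (fst.comp snd) (snd.comp snd)).and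
        (get (hf.comp fst) (fst.comp snd) (snd.comp snd))))
    (snd.pair snd)

lemma light {f : α → List Entry} {g : α → Entry} (hf : PT f) (hg : PT g) :
    PT (fun a => light (f a) (g a)) :=
  (nat_le (deg hf (fst.comp (snd.comp hg))) (const 2)).or
    (nat_le (deg hf (snd.comp (snd.comp hg))) (const 2))

lemma support {f : α → ℕ} {g : α → List Entry} (hf : PT f) (hg : PT g) :
    PT (fun a => support (f a) (g a)) :=
  list_filter (g := fun a v => decide (0 < EDP.deg (g a) v)) (list_range hf)
    (nat_lt (const 0) (deg (hg.comp fst) snd))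

lemma names {f : α → ℕ} {g h : α → List Entry} (hf : PT f) (hg : PT g) (hh : PT h) :
    PT (fun a => names (f a) (g a) (h a)) :=
  list_append
    (list_map (g := fun _ v => vertexName v) (support hf hg)
      ((const 0).pair ((snd.pair snd).pair (snd.pair snd))))
    (list_append
      (list_map (g := fun _ e => ((1, e) : Name))
        (list_filter (g := fun a e => !EDP.light (g a) e) hg (light (hg.comp fst) snd).not)
        ((const 1).pair snd))
      (list_map (g := fun _ e => ((2, e) : Name)) hh ((const 2).pair snd)))

lemma nameAdj {f : α → List Entry} {g h : α → Name} (hf : PT f) (hg : PT g) (hh : PT h) :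
    PT (fun a => nameAdj (f a) (g a) (h a)) := by
  have h1 : PT (fun a => (g a).2.2.1) := fst.comp (snd.comp (snd.comp hg))
  have h2 : PT (fun a => (h a).2.2.1) := fst.comp (snd.comp (snd.comp hh))
  exact (nat_beq (fst.comp hg) (const 0)).and
    (((nat_beq (fst.comp hh) (const 0)).and ((nat_beq h1 h2).not.and
      (list_any (g := fun a e => EDP.light (f a) e && EDP.joins (g a).2.2.1 (h a).2.2.1 e) hf
        ((light (hf.comp fst) snd).and (joins (h1.comp fst) (h2.comp fst) snd))))).or
    (((nat_beq (fst.comp hh) (const 1)).and (touches h1 (snd.comp hh))).or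
      ((nat_beq (fst.comp hh) (const 2)).and (nat_beq h1 h2))))

lemma namePair {g h : α → Name} (hg : PT g) (hh : PT h) :
    PT (fun a => namePair (g a) (h a)) :=
  (nat_beq (fst.comp hg) (const 2)).and ((nat_beq (fst.comp hh) (const 0)).and
    (nat_beq (snd.comp (snd.comp (snd.comp hg))) (fst.comp (snd.comp (snd.comp hh)))))

lemma matrix {f : α → List β} {A : α → β → β → Bool} (hf : PT f)
    (hA : PT (fun p : α × β × β => A p.1 p.2.1 p.2.2)) : PT (fun a => matrix (f a) (A a)) := by
  refine list_map (g := fun a b => (f a).map fun b' => A a b b' || A a b' b) hf ?_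
  refine list_map (f := fun p : α × β => f p.1) (g := fun p b' => A p.1 p.2 b' || A p.1 b' p.2)
    (hf.comp fst) ?_
  exact (hA.comp ((fst.comp fst).pair ((snd.comp fst).pair snd))).or
    (hA.comp ((fst.comp fst).pair (snd.pair (snd.comp fst))))

end PT

/-! ### The kernel -/

/-- No vertex is an endpoint of more demands than edges. -/
def feasible (S : List Entry × List Entry) : Bool :=
  S.2.all fun d => decide (deg S.2 d.2.1 ≤ deg S.1 d.2.1) && decide (deg S.2 d.2.2 ≤ deg S.1 d.2.2)

/-- The result of the kernelization in terms of matrices: a multigraph is read off, reduced, and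
written as a simple graph, unless it is infeasible, in which case the result consists of two
isolated vertices that form a terminal pair. -/
def kernelMatrix (M : List (List Bool) × List (List Bool)) :
    List (List Bool) × List (List Bool) :=
  if feasible (reduceAll (entries M.1, entries M.2)) = true then
    (matrix (names M.1.length (reduceAll (entries M.1, entries M.2)).1
        (reduceAll (entries M.1, entries M.2)).2)
      (nameAdj (reduceAll (entries M.1, entries M.2)).1),
     matrix (names M.1.length (reduceAll (entries M.1, entries M.2)).1
        (reduceAll (entries M.1, entries M.2)).2) namePair)
  else (matrix [false, true] fun _ _ => false, matrix [false, true] fun a b => a && !b)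

lemma pt_kernelMatrix : PT kernelMatrix := by
  have hS : PT (fun M : List (List Bool) × List (List Bool) =>
      reduceAll (entries M.1, entries M.2)) :=
    PT.reduceAll.comp ((PT.entries PT.fst).pair (PT.entries PT.snd))
  have hE := PT.fst.comp hS
  have hD := PT.snd.comp hS
  have hN := PT.names (PT.list_length (PT.fst (α := List (List Bool)) (β := List (List Bool))))
    hE hD
  refine PT.cond ?_ ((PT.matrix hN ?_).pair (PT.matrix (A := fun _ => namePair) hN ?_)) (PT.const _)
  · refine PT.comp (f := feasible) ?_ hS
    refine PT.list_all (f := fun S : List Entry × List Entry => S.2) (g := fun S d =>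
      decide (deg S.2 d.2.1 ≤ deg S.1 d.2.1) && decide (deg S.2 d.2.2 ≤ deg S.1 d.2.2)) PT.snd ?_
    have h1 : PT (fun p : (List Entry × List Entry) × Entry => p.2.2.1) :=
      PT.fst.comp (PT.snd.comp PT.snd)
    have h2 : PT (fun p : (List Entry × List Entry) × Entry => p.2.2.2) :=
      PT.snd.comp (PT.snd.comp PT.snd)
    exact (PT.nat_le (PT.deg (PT.snd.comp PT.fst) h1) (PT.deg (PT.fst.comp PT.fst) h1)).and
      (PT.nat_le (PT.deg (PT.snd.comp PT.fst) h2) (PT.deg (PT.fst.comp PT.fst) h2))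
  · exact PT.nameAdj (hE.comp PT.fst) (PT.fst.comp PT.snd) (PT.snd.comp PT.snd)
  · exact PT.namePair (PT.fst.comp PT.snd) (PT.snd.comp PT.snd)

/-- The multigraph with demands to which an instance is reduced. -/
noncomputable def Instance.reduced (I : Instance) : List Entry × List Entry :=
  reduceAll (entries (relMatrix I.G.Adj), entries (relMatrix fun i j => s(i, j) ∈ I.P))

/-- The kernelization. -/
noncomputable def kernel (I : Instance) : Instance :=
  if feasible I.reduced = true then
    ofNames (names I.n I.reduced.1 I.reduced.2) (nameAdj I.reduced.1) namePair
      (nameAdj_self _) namePair_self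
  else ofNames [false, true] (fun _ _ => false) (fun a b => a && !b) (fun _ => rfl)
    (fun a => by cases a <;> rfl)

lemma polyTimeComputable_kernel : PolyTimeComputable Instance.encode Instance.encode kernel := by
  obtain ⟨p, q, h⟩ := pt_kernelMatrix
  have henc : ∀ I : Instance, I.encode =
      Enc.enc (relMatrix I.G.Adj, relMatrix fun i j => s(i, j) ∈ I.P) := by
    intro I
    rw [Instance.encode, encodeRel_eq_relMatrix, encodeRel_eq_relMatrix]
    rfl
  refine ⟨p, q, fun I => ?_⟩
  obtain ⟨t, ht, hq⟩ := h (relMatrix I.G.Adj, relMatrix fun i j => s(i, j) ∈ I.P)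
  rw [← henc] at ht hq
  refine ⟨t, ?_, hq⟩
  have : (kernel I).encode =
      Enc.enc (kernelMatrix (relMatrix I.G.Adj, relMatrix fun i j => s(i, j) ∈ I.P)) := by
    rw [kernel, kernelMatrix]
    simp only [length_relMatrix]
    change (if feasible I.reduced = true then _ else _ : Instance).encode =
      Enc.enc (if feasible I.reduced = true then _ else _)
    split_ifs
    · exact encode_ofNames _ _ _ _ _
    · exact encode_ofNames _ _ _ _ _
  rwa [this]

lemma Instance.reduced_spec (I : Instance) :
    (Proper I.reduced.1 ∧ Proper I.reduced.2) ∧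
    (Within I.n I.reduced.1 ∧ Within I.n I.reduced.2) ∧
    (Solvable I.reduced.1 I.reduced.2 ↔ I.IsYes) ∧
    I.reduced.1.length ≤ rk I.reduced.1 + fes I.G ∧
    Stuck I.reduced.1 I.reduced.2 := by
  rw [reduced, reduceAll, foldl_reduce]
  set S : List Entry × List Entry :=
    (entries (relMatrix I.G.Adj), entries (relMatrix fun i j => s(i, j) ∈ I.P)) with hS
  have hE : Proper S.1 := entries_proper _
  have hD : Proper S.2 := entries_proper _
  obtain ⟨h1, h2, h3, h4⟩ := iterate_reduce_spec hE hD S.1.length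
  have hw : Within I.n S.1 ∧ Within I.n S.2 := by
    have h1 := entries_within (relMatrix I.G.Adj)
    have h2 := entries_within (relMatrix fun i j => s(i, j) ∈ I.P)
    rw [length_relMatrix] at h1 h2
    exact ⟨h1, h2⟩
  have h5 := length_le_rk_add_fes I.G hE (mem_entries _)
  exact ⟨h1, iterate_reduce_within hw _, h2.trans (solvable_entries_iff I.G I.P I.pairs),
    by omega, h4 le_rfl⟩

lemma deg_le_of_feasible {S : List Entry × List Entry} (h : feasible S = true) (v : ℕ) :
    deg S.2 v ≤ deg S.1 v := by
  rcases Nat.eq_zero_or_pos (deg S.2 v) with h0 | h0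
  · omega
  · obtain ⟨d, hd⟩ := List.exists_mem_of_length_pos h0
    rw [List.mem_filter, touches_iff] at hd
    have h1 := List.all_eq_true.1 h d hd.1
    rw [Bool.and_eq_true, decide_eq_true_eq, decide_eq_true_eq] at h1
    rcases hd.2 with rfl | rfl
    · exact h1.1
    · exact h1.2

theorem kernel_isYes_iff (I : Instance) : (kernel I).IsYes ↔ I.IsYes := by
  obtain ⟨⟨hE, hD⟩, ⟨hEN, hDN⟩, hyes, -, hS⟩ := I.reduced_spec
  rw [← hyes, kernel]
  split_ifs with h
  · exact solvable_iff_names hS (deg_le_of_feasible h) hE hD hEN hDN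
  · refine iff_of_false (fun hsol => ?_) fun hsol => h (List.all_eq_true.2 fun d _ => ?_)
    · obtain ⟨c, hc⟩ := (hasSolution_names_iff (N := [false, true]) (by simp)
        (fun _ _ => false) (fun a b => a && !b) fun _ => rfl).1 hsol
      have h1 := hc true (by simp) false (by simp) rfl
      have h2 := eqvGen_map (s := fun _ _ : Bool => False) id (fun x y h => by simp at h) h1
      generalize hx : id true = x at h2
      generalize hy : id false = y at h2
      have : x = y := by
        clear hx hy
        induction h2 with
        | rel _ _ h => exact h.elim
        | refl => rfl
        | symm _ _ _ ih => exact ih.symm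
        | trans _ _ _ _ _ ih ih' => exact ih.trans ih'
      rw [← hx, ← hy] at this
      exact absurd this (by simp)
    · rw [Bool.and_eq_true, decide_eq_true_eq, decide_eq_true_eq]
      exact ⟨hsol.deg_le hE hD _, hsol.deg_le hE hD _⟩

lemma fes_le_ncard {V : Type*} [Finite V] (G : SimpleGraph V) : fes G ≤ G.edgeSet.ncard := by
  refine Nat.sInf_le ⟨G.edgeSet, ⟨subset_rfl, ?_⟩, rfl⟩
  rw [SimpleGraph.deleteEdges_edgeSet, sdiff_self]
  exact SimpleGraph.isAcyclic_bot

lemma ncard_le_of_map_mem {α : Type} {N : List α} (hN : N.Nodup) (S : Set (Sym2 (Fin N.length)))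
    (L : List (Sym2 α)) (h : ∀ e ∈ S, Sym2.map N.get e ∈ L) : S.ncard ≤ L.length := by
  classical
  have hinj := Sym2.map.injective (List.nodup_iff_injective_get.1 hN)
  rw [← Set.ncard_image_of_injective S hinj]
  refine (Set.ncard_le_ncard (t := (L.toFinset : Set (Sym2 α))) ?_ (Finset.finite_toSet _)).trans ?_
  · rintro _ ⟨e, he, rfl⟩
    simpa using h e he
  · rw [Set.ncard_coe_finset]
    exact List.toFinset_card_le L

lemma ncard_edgeSet_names_le {N : ℕ} {E D : List Entry} (hE : Proper E) (hD : Proper D) :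
    (nameGraph (names N E D) (nameAdj E) (nameAdj_self E)).edgeSet.ncard ≤
      3 * E.length + D.length := by
  refine (ncard_le_of_map_mem (names_nodup hE hD) _ (E.map (fun e => s(vertexName e.2.1,
    vertexName e.2.2)) ++ (E.map (fun e => s(vertexName e.2.1, (1, e))) ++
      (E.map (fun e => s(vertexName e.2.2, (1, e))) ++
        D.map fun d => s(vertexName d.2.1, (2, d))))) ?_).trans ?_
  · have key : ∀ a ∈ names N E D, ∀ b ∈ names N E D, nameAdj E a b = true →
        s(a, b) ∈ (E.map (fun e => s(vertexName e.2.1,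
          vertexName e.2.2)) ++ (E.map (fun e => s(vertexName e.2.1, (1, e))) ++
          (E.map (fun e => s(vertexName e.2.2, (1, e))) ++
            D.map fun d => s(vertexName d.2.1, (2, d))))) := by
      intro a ha b hb hab
      simp only [List.mem_append, List.mem_map]
      rcases mem_names.1 ha with ⟨v, -, rfl⟩ | ⟨e, -, -, rfl⟩ | ⟨d', -, rfl⟩
      · rcases mem_names.1 hb with ⟨w, -, rfl⟩ | ⟨e, he, hl, rfl⟩ | ⟨d, hd, rfl⟩
        · have h1 : v ≠ w ∧ ∃ e ∈ E, light E e = true ∧ joins v w e = true := by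
            simpa [nameAdj, vertexName] using hab
          obtain ⟨-, e, he, -, hj⟩ := h1
          rw [joins_iff] at hj
          rcases hj with ⟨rfl, rfl⟩ | ⟨rfl, rfl⟩
          · exact .inl ⟨e, he, rfl⟩
          · exact .inl ⟨e, he, Sym2.eq_swap⟩
        · have h1 : touches v e = true := by simpa [nameAdj, vertexName] using hab
          rw [touches_iff] at h1
          rcases h1 with rfl | rfl
          · exact .inr (.inl ⟨e, he, rfl⟩)
          · exact .inr (.inr (.inl ⟨e, he, rfl⟩))
        · have h1 : v = d.2.1 := by simpa [nameAdj, vertexName] using hab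
          rw [h1]
          exact .inr (.inr (.inr ⟨d, hd, rfl⟩))
      · simp [nameAdj] at hab
      · simp [nameAdj] at hab
    intro e he
    induction e with
    | h i j =>
      rcases Bool.or_eq_true_iff.1 he with h | h
      · exact key _ (List.get_mem _ _) _ (List.get_mem _ _) h
      · rw [Sym2.eq_swap]
        exact key _ (List.get_mem _ _) _ (List.get_mem _ _) h
  · simp only [List.length_append, List.length_map]
    omega

lemma ncard_namePairs_le {N : ℕ} {E D : List Entry} (hE : Proper E) (hD : Proper D) :
    (namePairs (names N E D) namePair).ncard ≤ D.length := by
  refine (ncard_le_of_map_mem (names_nodup hE hD) _ (D.map demandPair) ?_).trans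
    (List.length_map _).le
  rintro _ ⟨i, j, rfl, h⟩
  obtain ⟨d, hd, h1, h2⟩ := (namePair_iff (List.get_mem _ _) (List.get_mem _ _)).1 h
  rw [Sym2.map_mk, h1, h2]
  exact List.mem_map.2 ⟨d, hd, rfl⟩

/-- The size of the kernel. With `k` the feedback edge set number, the graph has at most
`3 * (6 * k) + 6 * k` edges, and this also bounds its own feedback edge set number. -/
theorem kernel_size (I : Instance) :
    ((kernel I).n ≤ 2 ∨ (kernel I).n + 11 ≤ 11 * fes I.G) ∧
    (kernel I).n + (kernel I).G.edgeSet.ncard + (kernel I).P.ncard + fes (kernel I).G ≤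
      65 * (fes I.G + 1) := by
  obtain ⟨⟨hE, hD⟩, ⟨hEN, hDN⟩, -, hk, hS⟩ := I.reduced_spec
  by_cases h : feasible I.reduced = true
  · have hdeg := deg_le_of_feasible h
    have h1 := ncard_edgeSet_names_le (N := I.n) hE hD
    have h2 := ncard_namePairs_le (N := I.n) hE hD
    have h3 := length_names I.n I.reduced.1 I.reduced.2
    have h4 := fes_le_ncard
      (nameGraph (names I.n I.reduced.1 I.reduced.2) (nameAdj I.reduced.1) (nameAdj_self _))
    have hker : kernel I = ofNames (names I.n I.reduced.1 I.reduced.2) (nameAdj I.reduced.1)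
      namePair (nameAdj_self _) namePair_self := if_pos h
    rw [hker]
    simp only [ofNames]
    by_cases hne : I.reduced.1 = []
    · have hD0 : I.reduced.2 = [] := by
        refine List.eq_nil_iff_forall_not_mem.2 fun d hd => ?_
        have h4 := deg_pos hd (touches_iff.2 (.inl rfl))
        have h5 := hdeg d.2.1
        rw [hne] at h5
        exact absurd (h4.trans_le h5) (by simp [deg])
      have h6 : (support I.n I.reduced.1).length = 0 := by
        rw [support, List.length_eq_zero_iff, List.filter_eq_nil_iff, hne]
        simp [deg]
      have h7 : I.reduced.1.length = 0 := List.length_eq_zero_iff.2 hne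
      have h8 : I.reduced.2.length = 0 := List.length_eq_zero_iff.2 hD0
      have h9 := List.length_filter_le (fun a => !light I.reduced.1 a) I.reduced.1
      omega
    · obtain ⟨h5, h6, h7⟩ := hS.size_le hdeg hE hD hEN hDN hk hne
      omega
  · have hker : kernel I = ofNames [false, true] (fun _ _ => false) (fun a b => a && !b)
      (fun _ => rfl) (fun a => by cases a <;> rfl) := if_neg h
    rw [hker]
    simp only [ofNames]
    have h1 : (nameGraph [false, true] (fun _ _ => false) fun _ => rfl).edgeSet.ncard ≤ 0 :=
      ncard_le_of_map_mem (N := [false, true]) (by simp) _ [] fun e he => by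
        induction e with
        | h i j => exact absurd he (by simp [nameGraph])
    have h2 : (namePairs [false, true] fun a b => a && !b).ncard ≤ 1 := by
      refine ncard_le_of_map_mem (N := [false, true]) (by simp) _ [s(true, false)] ?_
      rintro _ ⟨i, j, rfl, hij⟩
      rw [Bool.and_eq_true, Bool.not_eq_true'] at hij
      rw [Sym2.map_mk, hij.1, hij.2]
      exact List.mem_singleton.2 rfl
    have h4 := fes_le_ncard (nameGraph [false, true] (fun _ _ => false) fun _ => rfl)
    have h5 : [false, true].length = 2 := rfl
    omega

theorem exists_linear_kernel : ∃ K : Instance → Instance,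
    PolyTimeComputable Instance.encode Instance.encode K ∧
    (∀ I : Instance, (K I).IsYes ↔ I.IsYes) ∧
    (∀ I : Instance, 1 ≤ fes I.G → (K I).n + 2 ≤ 11 * fes I.G) ∧
    ∃ c : ℕ, ∀ I : Instance,
      (K I).n + (K I).G.edgeSet.ncard + (K I).P.ncard + fes (K I).G ≤ c * (fes I.G + 1) := by
  refine ⟨kernel, polyTimeComputable_kernel, kernel_isYes_iff, fun I hI => ?_, 65,
    fun I => (kernel_size I).2⟩
  have := (kernel_size I).1
  omega

/-! ### Invariants of the reduction rules -/

lemma restrict_adj {V : Type*} {G : SimpleGraph V} {A : Set V} {x y : V} :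
    (restrict G A).Adj x y ↔ x ∈ A ∧ y ∈ A ∧ G.Adj x y := by
  simp [restrict, SimpleGraph.map_adj]
  tauto

lemma reachable_map {V W : Type*} {G : SimpleGraph V} {H : SimpleGraph W} (f : V → W)
    (h : ∀ x y, G.Adj x y → H.Reachable (f x) (f y)) {x y : V} (hxy : G.Reachable x y) :
    H.Reachable (f x) (f y) := by
  obtain ⟨w⟩ := hxy
  induction w with
  | nil => exact .refl _
  | cons hadj _ ih => exact (h _ _ hadj).trans ih

namespace State

variable {V : Type*}

/-- The edges not in `X` form a spanning tree of the current graph, and `X` has `k` elements. -/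
structure Inv (S : State V) (k : ℕ) : Prop where
  adj_mem : ∀ x y, S.G.Adj x y → x ∈ S.verts
  subset : S.X ⊆ S.G.edgeSet
  acyclic : S.Q.IsAcyclic
  reachable : ∀ x ∈ S.verts, ∀ y ∈ S.verts, S.Q.Reachable x y
  card : S.X.ncard = k

lemma Q_adj {S : State V} {x y : V} : S.Q.Adj x y ↔ S.G.Adj x y ∧ s(x, y) ∉ S.X := by
  rw [Q, SimpleGraph.deleteEdges_adj]

lemma not_Q_adj_of_mem {S : State V} {x y : V} (h : s(x, y) ∈ S.X) : ¬ S.Q.Adj x y :=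
  fun h' => (Q_adj.1 h').2 h

/-- A graph in which `X` is not empty has at least two vertices, so no vertex is isolated in the
spanning tree. -/
lemma Inv.exists_adj {S : State V} {k : ℕ} (h : S.Inv k) (hk : 1 ≤ k) {v : V} (hv : v ∈ S.verts) :
    ∃ w, S.Q.Adj v w := by
  obtain ⟨e, he⟩ : S.X.Nonempty := Set.nonempty_of_ncard_ne_zero (by rw [h.card]; omega)
  obtain ⟨w, hw, hne⟩ : ∃ w ∈ S.verts, v ≠ w := by
    induction e with
    | h x y =>
      have hadj : S.G.Adj x y := h.subset he
      by_cases hvx : v = x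
      · exact ⟨y, h.adj_mem y x hadj.symm, fun h' => hadj.ne (hvx.symm.trans h')⟩
      · exact ⟨x, h.adj_mem x y hadj, hvx⟩
  obtain ⟨p⟩ := h.reachable v hv w hw
  cases p with
  | nil => exact absurd rfl hne
  | cons hadj _ => exact ⟨_, hadj⟩

/-- The only edge at a vertex of degree one is not in `X`. -/
lemma Inv.not_mem_of_unique {S : State V} {k : ℕ} (h : S.Inv k) (hk : 1 ≤ k) {v w : V}
    (hN : S.G.neighborSet v = {w}) : ∀ e ∈ S.X, v ∉ e := by
  intro e he hve
  obtain ⟨z, rfl⟩ := Sym2.mem_iff_exists.1 hve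
  have hz : S.G.Adj v z := h.subset he
  obtain ⟨z', hz'⟩ := h.exists_adj hk (h.adj_mem v z hz)
  have h1 : z ∈ S.G.neighborSet v := hz
  have h2 : z' ∈ S.G.neighborSet v := (Q_adj.1 hz').1
  rw [hN, Set.mem_singleton_iff] at h1 h2
  rw [h2, ← h1] at hz'
  exact not_Q_adj_of_mem he hz'

/-- Deleting a set of vertices that is attached to the rest of the graph at a single vertex and
not incident with `X` preserves the invariant. -/
lemma Inv.remove {S : State V} {k : ℕ} (h : S.Inv k) (R : Set V) (y : V)
    (hR : ∀ x ∈ R, ∀ z ∉ R, S.G.Adj x z → z = y) (hX : ∀ e ∈ S.X, ∀ v ∈ R, v ∉ e)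
    (P : Set (Sym2 V)) :
    Inv { verts := S.verts \ R, G := restrict S.G Rᶜ, P := P, X := S.X } k := by
  classical
  set T : State V := { verts := S.verts \ R, G := restrict S.G Rᶜ, P := P, X := S.X } with hT
  have hQ : ∀ a b, T.Q.Adj a b ↔ a ∉ R ∧ b ∉ R ∧ S.Q.Adj a b := by
    intro a b
    rw [Q_adj, Q_adj]
    change (restrict S.G Rᶜ).Adj a b ∧ s(a, b) ∉ S.X ↔ _
    rw [restrict_adj, Set.mem_compl_iff, Set.mem_compl_iff]
    tauto
  refine ⟨fun a b hab => ?_, fun e he => ?_, ?_, fun a ha b hb => ?_, h.card⟩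
  · have := restrict_adj.1 hab
    exact ⟨h.adj_mem a b this.2.2, this.1⟩
  · induction e with
    | h a b =>
      exact restrict_adj.2 ⟨fun ha => hX _ he a ha (Sym2.mem_mk_left a b),
        fun hb => hX _ he b hb (Sym2.mem_mk_right a b), h.subset he⟩
  · exact h.acyclic.anti fun a b hab => ((hQ a b).1 hab).2.2
  · -- the map that collapses `R` to `y` preserves connections
    have h1 := reachable_map (H := T.Q) (fun x => if x ∈ R then y else x) ?_
      (h.reachable a ha.1 b hb.1)
    · simpa only [if_neg ha.2, if_neg hb.2] using h1
    · intro x z hxz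
      by_cases hx : x ∈ R <;> by_cases hz : z ∈ R <;> simp only [hx, hz, if_true, if_false]
      · exact .refl _
      · rw [hR x hx z hz (Q_adj.1 hxz).1]
      · rw [hR z hz x hx (Q_adj.1 hxz).1.symm]
      · exact SimpleGraph.Adj.reachable ((hQ x z).2 ⟨hx, hz, hxz⟩)

/-- Attaching a new vertex to an old one preserves the invariant. -/
lemma Inv.attach {S : State V} {k : ℕ} (h : S.Inv k) {y s : V} (hy : y ∈ S.verts)
    (hs : s ∉ S.verts) :
    Inv { verts := insert s S.verts, G := S.G ⊔ SimpleGraph.edge y s, P := S.P, X := S.X } k := by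
  set T : State V :=
    { verts := insert s S.verts, G := S.G ⊔ SimpleGraph.edge y s, P := S.P, X := S.X } with hT
  have hne : y ≠ s := fun h' => hs (h' ▸ hy)
  have hiso : ∀ a, ¬ S.G.Adj s a := fun a ha => hs (h.adj_mem s a ha)
  have hsX : s(y, s) ∉ S.X := fun h' => hiso y (show S.G.Adj y s from h.subset h').symm
  have hQ : T.Q = S.Q ⊔ SimpleGraph.edge y s := by
    ext a b
    rw [Q_adj]
    change (S.G ⊔ SimpleGraph.edge y s).Adj a b ∧ s(a, b) ∉ S.X ↔ _
    rw [SimpleGraph.sup_adj, SimpleGraph.sup_adj, Q_adj, SimpleGraph.edge_adj]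
    constructor
    · tauto
    · rintro (h1 | h1)
      · tauto
      · refine ⟨.inr h1, ?_⟩
        rcases h1.1 with ⟨rfl, rfl⟩ | ⟨rfl, rfl⟩
        · exact hsX
        · rwa [Sym2.eq_swap]
  have hadj : T.Q.Adj y s := by
    rw [hQ, SimpleGraph.sup_adj, SimpleGraph.edge_adj]
    exact .inr ⟨.inl ⟨rfl, rfl⟩, hne⟩
  have hle : S.Q ≤ T.Q := by rw [hQ]; exact le_sup_left
  have hreach : ∀ a ∈ T.verts, T.Q.Reachable a y := by
    intro a ha
    rcases ha with rfl | ha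
    · exact hadj.symm.reachable
    · exact (h.reachable a ha y hy).mono hle
  refine ⟨fun a b hab => ?_, fun e he => ?_, ?_, fun a ha b hb =>
    (hreach a ha).trans (hreach b hb).symm, h.card⟩
  · rcases (SimpleGraph.sup_adj _ _ _ _).1 hab with h1 | h1
    · exact .inr (h.adj_mem a b h1)
    · rw [SimpleGraph.edge_adj] at h1
      rcases h1.1 with ⟨rfl, rfl⟩ | ⟨rfl, rfl⟩
      · exact .inr hy
      · exact .inl rfl
  · exact SimpleGraph.edgeSet_mono le_sup_left (h.subset he)
  · rw [hQ]
    refine SimpleGraph.IsAcyclic.sup_edge_of_not_reachable ?_ h.acyclic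
    rintro h1
    obtain ⟨p⟩ := h1.symm
    cases p with
    | nil => exact hne rfl
    | cons h2 _ => exact hiso _ (Q_adj.1 h2).1

lemma Inv.not_reachable_of_Q_adj {S : State V} {k : ℕ} (h : S.Inv k) {x y : V}
    (hxy : S.Q.Adj x y) : ¬ (S.Q.deleteEdges {s(x, y)}).Reachable x y :=
  SimpleGraph.isBridge_iff.1 (SimpleGraph.isAcyclic_iff_forall_adj_isBridge.1 h.acyclic hxy)

open Classical in
/-- Suppressing a vertex preserves the invariant. -/
lemma Inv.suppress [Finite V] {S : State V} {k : ℕ} (h : S.Inv k) (hk : 1 ≤ k) {v a b : V}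
    (hv : v ∈ S.verts) (hab : a ≠ b) (hN : S.G.neighborSet v = {a, b}) (hadj : ¬ S.G.Adj a b) :
    Inv { verts := S.verts \ {v}
          G := restrict S.G {v}ᶜ ⊔ SimpleGraph.edge a b
          P := S.P
          X := if s(a, v) ∈ S.X ∨ s(v, b) ∈ S.X then (S.X \ {e | v ∈ e}) ∪ {s(a, b)}
            else S.X } k := by
  have hva : S.G.Adj v a := by
    have : a ∈ S.G.neighborSet v := by rw [hN]; exact .inl rfl
    exact this
  have hvb : S.G.Adj v b := by
    have : b ∈ S.G.neighborSet v := by rw [hN]; exact .inr rfl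
    exact this
  have hnbr : ∀ z, S.G.Adj v z → z = a ∨ z = b := by
    intro z hz
    have : z ∈ S.G.neighborSet v := hz
    rwa [hN] at this
  have habX : s(a, b) ∉ S.X := fun h' => hadj (h.subset h')
  have hmem : ∀ x y, (restrict S.G {v}ᶜ ⊔ SimpleGraph.edge a b).Adj x y → x ∈ S.verts \ {v} := by
    intro x y hxy
    rcases (SimpleGraph.sup_adj _ _ _ _).1 hxy with h1 | h1
    · rw [restrict_adj] at h1
      exact ⟨h.adj_mem x y h1.2.2, h1.1⟩
    · rw [SimpleGraph.edge_adj] at h1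
      rcases h1.1 with ⟨rfl, rfl⟩ | ⟨rfl, rfl⟩
      · exact ⟨h.adj_mem _ v hva.symm, hva.ne'⟩
      · exact ⟨h.adj_mem _ v hvb.symm, hvb.ne'⟩
  have hedge : (SimpleGraph.edge a b).Adj a b := by
    rw [SimpleGraph.edge_adj]; exact ⟨.inl ⟨rfl, rfl⟩, hab⟩
  split_ifs with hX
  · -- one of the two edges at `v` is in `X`; `w` is the other end of the remaining one
    obtain ⟨u, w, huw, hu, hw⟩ : ∃ u w, s(u, w) = s(a, b) ∧ s(v, u) ∈ S.X ∧ S.Q.Adj v w := by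
      obtain ⟨z, hz⟩ := h.exists_adj hk hv
      rcases hX with hX | hX
      · refine ⟨a, b, rfl, by rwa [Sym2.eq_swap], ?_⟩
        rcases hnbr z (Q_adj.1 hz).1 with rfl | rfl
        · rw [Sym2.eq_swap] at hX; exact absurd hz (not_Q_adj_of_mem hX)
        · exact hz
      · refine ⟨b, a, Sym2.eq_swap, hX, ?_⟩
        rcases hnbr z (Q_adj.1 hz).1 with rfl | rfl
        · exact hz
        · exact absurd hz (not_Q_adj_of_mem hX)
    have hnbr' : ∀ z, S.Q.Adj v z → z = w := by
      intro z hz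
      have h1 := hnbr z (Q_adj.1 hz).1
      have h2 : z ≠ u := by rintro rfl; exact not_Q_adj_of_mem hu hz
      rw [Sym2.eq_iff] at huw
      rcases huw with ⟨rfl, rfl⟩ | ⟨rfl, rfl⟩ <;> tauto
    have hdiff : S.X \ {e | v ∈ e} = S.X \ {s(v, u)} := by
      ext e
      simp only [Set.mem_sdiff, Set.mem_ofPred_eq, Set.mem_singleton_iff]
      refine and_congr_right fun he => not_congr ⟨fun hve => ?_, fun h' => ?_⟩
      · obtain ⟨z, rfl⟩ := Sym2.mem_iff_exists.1 hve
        have h1 : z ≠ w := by rintro rfl; exact not_Q_adj_of_mem he hw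
        have h2 := hnbr z (h.subset he)
        rw [Sym2.eq_iff] at huw
        rcases huw with ⟨rfl, rfl⟩ | ⟨rfl, rfl⟩ <;> [skip; skip] <;>
        · rcases h2 with rfl | rfl <;> first | rfl | exact absurd rfl h1
      · rw [h']; exact Sym2.mem_mk_left _ _
    set T : State V := { verts := S.verts \ {v}, G := restrict S.G {v}ᶜ ⊔ SimpleGraph.edge a b,
                         P := S.P, X := (S.X \ {e | v ∈ e}) ∪ {s(a, b)} } with hT
    have hQ : ∀ x y, T.Q.Adj x y ↔ x ≠ v ∧ y ≠ v ∧ S.Q.Adj x y := by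
      intro x y
      rw [Q_adj, Q_adj]
      change (restrict S.G {v}ᶜ ⊔ SimpleGraph.edge a b).Adj x y ∧
        s(x, y) ∉ (S.X \ {e | v ∈ e}) ∪ {s(a, b)} ↔ _
      rw [SimpleGraph.sup_adj, restrict_adj, SimpleGraph.edge_adj, Set.mem_union,
        Set.mem_singleton_iff, Set.mem_sdiff, Set.mem_ofPred_eq, Set.mem_compl_singleton_iff,
        Set.mem_compl_singleton_iff, Sym2.mem_iff, Sym2.eq_iff]
      constructor
      · rintro ⟨h1 | h1, h2⟩
        · refine ⟨h1.1, h1.2.1, h1.2.2, fun h3 => h2 (.inl ⟨h3, ?_⟩)⟩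
          rintro (h4 | h4)
          · exact h1.1 h4.symm
          · exact h1.2.1 h4.symm
        · exact absurd (.inr h1.1) h2
      · rintro ⟨h1, h2, h3, h4⟩
        refine ⟨.inl ⟨h1, h2, h3⟩, ?_⟩
        rintro (h5 | h5)
        · exact h4 h5.1
        · rcases h5 with ⟨rfl, rfl⟩ | ⟨rfl, rfl⟩
          · exact hadj h3
          · exact hadj h3.symm
    refine ⟨hmem, fun e he => ?_, ?_, fun x hx y hy => ?_, ?_⟩
    · rcases he with he | rfl
      · induction e with
        | h x y =>
          have h2 := he.2
          rw [Set.mem_ofPred_eq, Sym2.mem_iff, not_or] at h2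
          exact SimpleGraph.edgeSet_mono le_sup_left (a := s(x, y)) (restrict_adj.2
            ⟨fun h' => h2.1 h'.symm, fun h' => h2.2 h'.symm, h.subset he.1⟩)
      · exact SimpleGraph.edgeSet_mono le_sup_right (a := s(a, b)) hedge
    · exact h.acyclic.anti fun x y hxy => ((hQ x y).1 hxy).2.2
    · have h1 := reachable_map (H := T.Q) (fun x => if x = v then w else x) ?_
        (h.reachable x hx.1 y hy.1)
      · simpa only [if_neg (show x ≠ v from hx.2), if_neg (show y ≠ v from hy.2)] using h1
      · intro p q hpq
        by_cases hp : p = v <;> by_cases hq : q = v <;> simp only [hp, hq, if_true, if_false]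
        · exact .refl _
        · rw [hnbr' q (hp ▸ hpq)]
        · rw [hnbr' p (hq ▸ hpq).symm]
        · exact SimpleGraph.Adj.reachable ((hQ p q).2 ⟨hp, hq, hpq⟩)
    · change ((S.X \ {e | v ∈ e}) ∪ {s(a, b)}).ncard = k
      rw [hdiff, Set.union_singleton, Set.ncard_insert_of_notMem (fun h' => habX h'.1),
        Set.ncard_sdiff_singleton_add_one hu, h.card]
  · rw [not_or] at hX
    set T : State V := { verts := S.verts \ {v}, G := restrict S.G {v}ᶜ ⊔ SimpleGraph.edge a b,
                         P := S.P, X := S.X } with hT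
    have hQva : S.Q.Adj v a := Q_adj.2 ⟨hva, by rw [Sym2.eq_swap]; exact hX.1⟩
    have hQvb : S.Q.Adj v b := Q_adj.2 ⟨hvb, hX.2⟩
    have hQ : T.Q = restrict S.Q {v}ᶜ ⊔ SimpleGraph.edge a b := by
      ext x y
      rw [Q_adj]
      change (restrict S.G {v}ᶜ ⊔ SimpleGraph.edge a b).Adj x y ∧ s(x, y) ∉ S.X ↔ _
      rw [SimpleGraph.sup_adj, SimpleGraph.sup_adj, restrict_adj, restrict_adj, Q_adj,
        SimpleGraph.edge_adj]
      constructor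
      · tauto
      · rintro (h1 | h1)
        · tauto
        · refine ⟨.inr h1, ?_⟩
          rcases h1.1 with ⟨rfl, rfl⟩ | ⟨rfl, rfl⟩
          · exact habX
          · rwa [Sym2.eq_swap]
    refine ⟨hmem, fun e he => ?_, ?_, fun x hx y hy => ?_, h.card⟩
    · induction e with
      | h x y =>
        have hxy : S.G.Adj x y := h.subset he
        refine SimpleGraph.edgeSet_mono le_sup_left (a := s(x, y)) (restrict_adj.2 ⟨?_, ?_, hxy⟩)
        · rintro rfl
          rcases hnbr y hxy with rfl | rfl
          · exact hX.1 (by rwa [Sym2.eq_swap])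
          · exact hX.2 he
        · rintro rfl
          rcases hnbr x hxy.symm with rfl | rfl
          · exact hX.1 he
          · exact hX.2 (by rwa [Sym2.eq_swap])
    · rw [hQ]
      refine SimpleGraph.IsAcyclic.sup_edge_of_not_reachable (fun h1 => ?_)
        (h.acyclic.anti fun x y hxy => (restrict_adj.1 hxy).2.2)
      -- otherwise the edge from `v` to `a` would not be a bridge of the forest
      refine h.not_reachable_of_Q_adj hQva ?_
      have h2 : restrict S.Q {v}ᶜ ≤ S.Q.deleteEdges {s(v, a)} := by
        intro x y hxy
        rw [restrict_adj] at hxy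
        rw [SimpleGraph.deleteEdges_adj]
        refine ⟨hxy.2.2, fun h' => ?_⟩
        rw [Set.mem_singleton_iff, Sym2.eq_iff] at h'
        rcases h' with h' | h'
        · exact hxy.1 h'.1
        · exact hxy.2.1 h'.2
      have h3 : (S.Q.deleteEdges {s(v, a)}).Adj v b := by
        rw [SimpleGraph.deleteEdges_adj]
        refine ⟨hQvb, fun h' => ?_⟩
        rw [Set.mem_singleton_iff, Sym2.eq_iff] at h'
        rcases h' with h' | h'
        · exact hab h'.2.symm
        · exact hva.ne h'.1
      exact h3.reachable.trans (h1.symm.mono h2)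
    · have h1 := reachable_map (H := T.Q) (fun x => if x = v then a else x) ?_
        (h.reachable x hx.1 y hy.1)
      · simpa only [if_neg (show x ≠ v from hx.2), if_neg (show y ≠ v from hy.2)] using h1
      · have hTab : T.Q.Reachable a b := by
          rw [hQ]
          exact SimpleGraph.Adj.reachable ((SimpleGraph.sup_adj _ _ _ _).2 (.inr hedge))
        have hv' : ∀ z, S.Q.Adj v z → T.Q.Reachable a z := by
          intro z hz
          rcases hnbr z (Q_adj.1 hz).1 with rfl | rfl
          · exact .refl _
          · exact hTab
        intro p q hpq
        by_cases hp : p = v <;> by_cases hq : q = v <;> simp only [hp, hq, if_true, if_false]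
        · exact .refl _
        · exact hv' q (hp ▸ hpq)
        · exact (hv' p (hq ▸ hpq).symm).symm
        · rw [hQ]
          exact SimpleGraph.Adj.reachable ((SimpleGraph.sup_adj _ _ _ _).2 (.inl (restrict_adj.2
            ⟨hp, hq, hpq⟩)))

/-- A pendant component is attached to the rest of the graph at a single vertex. -/
lemma IsPendant.attached {S : State V} {L : Set V} {l y : V} {k : ℕ} (h : S.Inv k)
    (hL : S.IsPendant L l y) :
    L ⊆ S.verts ∧ y ∉ L ∧ (∀ x ∈ L, ∀ z ∉ L, S.G.Adj x z → z = y) ∧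
      ∀ e ∈ S.X, ∀ v ∈ L, v ∉ e := by
  obtain ⟨⟨C, rfl⟩, -, hy, -, hu⟩ := hL
  have hsub : ∀ x ∈ Subtype.val '' C.supp, x ∈ S.verts \ S.Y := by
    rintro _ ⟨x, -, rfl⟩
    exact x.2
  refine ⟨fun x hx => (hsub x hx).1, fun h' => (hsub y h').2 hy, ?_,
    fun e he v hv hve => (hsub v hv).2 ⟨e, he, hve⟩⟩
  rintro x hx z hz hxz
  by_cases hzY : z ∈ S.Y
  · exact (hu x hx z hzY hxz).2
  · obtain ⟨x', hx', rfl⟩ := hx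
    refine absurd ⟨⟨z, h.adj_mem z _ hxz.symm, hzY⟩, ?_, rfl⟩ hz
    rw [SimpleGraph.ConnectedComponent.mem_supp_iff] at hx' ⊢
    rw [← hx', SimpleGraph.ConnectedComponent.eq]
    exact SimpleGraph.Adj.reachable (SimpleGraph.induce_adj.2 hxz.symm)

/-- All rules preserve the invariant. -/
theorem Step.inv [Finite V] {S T : State V} {k : ℕ} (hk : 1 ≤ k) (hS : S.Inv k) (hST : Step S T) :
    T.Inv k := by
  cases hST with
  | deleteLeaf v hv hdeg _ =>
    obtain ⟨w, hw⟩ := Set.ncard_eq_one.1 hdeg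
    have hX := hS.not_mem_of_unique hk hw
    have hdiff : S.X \ {e | v ∈ e} = S.X := by
      ext e
      exact ⟨fun h => h.1, fun h => ⟨h, hX e h⟩⟩
    have hadj : S.G.Adj v w := by
      have : w ∈ S.G.neighborSet v := by rw [hw]; rfl
      exact this
    rw [hdiff]
    refine hS.remove {v} w ?_ ?_ _
    · rintro x rfl z - hz
      have : z ∈ S.G.neighborSet x := hz
      rwa [hw] at this
    · rintro e he x rfl
      exact hX e he
  | suppress v a b hv hab hN hadj => exact hS.suppress hk hv hab hN hadj
  | pruneAll L l y hL _ =>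
    obtain ⟨-, -, h3, h4⟩ := hL.attached hS
    exact hS.remove L y h3 h4 _
  | pruneTo L l y s hL hs _ =>
    obtain ⟨h1, h2, h3, h4⟩ := hL.attached hS
    have hsL : s ∈ L := by
      have : s ∈ S.unmatched L := by rw [hs.1]; rfl
      exact this.1
    have hy : y ∈ S.verts := hS.adj_mem y l hL.2.2.2.1.symm
    have h5 := (hS.remove L y h3 h4 (S.P \ S.inner L)).attach (y := y) (s := s) ⟨hy, h2⟩
      (fun h => h.2 hsL)
    convert h5 using 2
    · ext x
      simp only [Set.mem_sdiff, Set.mem_singleton_iff, Set.mem_insert_iff]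
      by_cases hx : x = s
      · simp [hx, h1 hsL]
      · simp [hx]
    · ext a b
      simp only [SimpleGraph.sup_adj, restrict_adj, SimpleGraph.edge_adj, Set.mem_compl_iff,
        Set.mem_sdiff, Set.mem_singleton_iff]
      constructor
      · rintro (⟨ha, hb, hab⟩ | h)
        · by_cases haL : a ∈ L <;> by_cases hbL : b ∈ L
          · have ha' : a = s := by tauto
            have hb' : b = s := by tauto
            exact absurd (ha'.trans hb'.symm) hab.ne
          · have ha' : a = s := by tauto
            exact .inr ⟨.inr ⟨ha', h3 a haL b hbL hab⟩, hab.ne⟩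
          · have hb' : b = s := by tauto
            exact .inr ⟨.inl ⟨h3 b hbL a haL hab.symm, hb'⟩, hab.ne⟩
          · exact .inl ⟨haL, hbL, hab⟩
        · exact .inr h
      · rintro (⟨ha, hb, hab⟩ | h)
        · exact .inl ⟨fun h => ha h.1, fun h => hb h.1, hab⟩
        · exact .inr h
  | deletePair a b _ hab hdeg hN =>
    obtain ⟨w, hw⟩ := Set.ncard_eq_one.1 hdeg
    have hw' : S.G.neighborSet b = {w} := hN ▸ hw
    have haw : S.G.Adj a w := by
      have : w ∈ S.G.neighborSet a := by rw [hw]; rfl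
      exact this
    have hbw : S.G.Adj b w := by
      have : w ∈ S.G.neighborSet b := by rw [hw']; rfl
      exact this
    refine hS.remove {a, b} w ?_ ?_ _
    · rintro x (rfl | rfl) z - hz
      · have : z ∈ S.G.neighborSet x := hz
        rwa [hw] at this
      · have : z ∈ S.G.neighborSet x := hz
        rwa [hw'] at this
    · rintro e he x (rfl | rfl)
      · exact hS.not_mem_of_unique hk hw e he
      · exact hS.not_mem_of_unique hk hw' e he

/-- A minimum feedback edge set of a connected graph is the complement of a spanning tree. -/
lemma inv_of_minimum [Finite V] {G : SimpleGraph V} {P X : Set (Sym2 V)} (hG : G.Connected)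
    (hX : IsFeedbackEdgeSet G X) (hmin : X.ncard = fes G) :
    Inv { verts := Set.univ, G := G, P := P, X := X } X.ncard := by
  refine ⟨fun _ _ _ => Set.mem_univ _, hX.1, hX.2, fun x _ y _ => ?_, rfl⟩
  change (G.deleteEdges X).Reachable x y
  refine reachable_map id (fun u v huv => ?_) (hG.preconnected x y)
  by_contra hcon
  have huvX : s(u, v) ∈ X := by
    by_contra h
    exact hcon (SimpleGraph.Adj.reachable ((SimpleGraph.deleteEdges_adj).2 ⟨huv, h⟩))
  -- otherwise an edge of `X` that joins two components can be put back
  have hX' : IsFeedbackEdgeSet G (X \ {s(u, v)}) := by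
    refine ⟨fun e he => hX.1 he.1, ?_⟩
    have hle : G.deleteEdges (X \ {s(u, v)}) ≤ G.deleteEdges X ⊔ SimpleGraph.edge u v := by
      intro a b hab
      rw [SimpleGraph.deleteEdges_adj] at hab
      rw [SimpleGraph.sup_adj, SimpleGraph.deleteEdges_adj, SimpleGraph.edge_adj]
      by_cases h : s(a, b) ∈ X
      · right
        have h1 : s(a, b) = s(u, v) := by
          by_contra h'
          exact hab.2 ⟨h, h'⟩
        rw [Sym2.eq_iff] at h1
        refine ⟨?_, hab.1.ne⟩
        tauto
      · exact .inl ⟨hab.1, h⟩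
    exact (SimpleGraph.IsAcyclic.sup_edge_of_not_reachable hcon hX.2).anti hle
  have h1 : fes G ≤ (X \ {s(u, v)}).ncard := Nat.sInf_le ⟨_, hX', rfl⟩
  have h2 := Set.ncard_sdiff_singleton_lt_of_mem huvX
  omega

/-! ### The size of an exhausted instance -/

lemma ncard_Y_le [Finite V] (S : State V) : S.Y.ncard ≤ 2 * S.X.ncard := by
  classical
  have hfin : S.X.Finite := Set.toFinite _
  have hsub : S.Y ⊆ (hfin.toFinset.biUnion fun e => e.toFinset : Finset V) := by
    rintro v ⟨e, he, hve⟩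
    simp only [Finset.coe_biUnion, Set.mem_iUnion]
    exact ⟨e, by simpa using he, by simpa using hve⟩
  refine (Set.ncard_le_ncard hsub (Finset.finite_toSet _)).trans ?_
  rw [Set.ncard_coe_finset, Set.ncard_eq_toFinset_card _ hfin, Nat.mul_comm]
  refine Finset.card_biUnion_le_card_mul _ _ _ fun e _ => ?_
  rw [Sym2.card_toFinset]
  split_ifs <;> omega

/-- In an exhausted instance, the two edges at a vertex that has degree two in the forest and is
not an endpoint of an edge in `X` form a triangle with an edge in `X`. -/
lemma Inv.exists_edge {S : State V} {k : ℕ} (h : S.Inv k) (hex : ∀ T, ¬ Step S T) {v : V}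
    (hv : v ∈ S.verts) (hdeg : (S.Q.neighborSet v).ncard = 2) (hY : v ∉ S.Y) :
    ∃ a b, S.Q.Adj v a ∧ S.Q.Adj v b ∧ a ≠ b ∧ s(a, b) ∈ S.X := by
  obtain ⟨a, b, hab, hN⟩ := Set.ncard_eq_two.1 hdeg
  have hQG : S.G.neighborSet v = {a, b} := by
    rw [← hN]
    ext z
    exact ⟨fun hz => Q_adj.2 ⟨hz, fun h' => hY ⟨_, h', Sym2.mem_mk_left _ _⟩⟩,
      fun hz => (Q_adj.1 hz).1⟩
  have hva : S.Q.Adj v a := by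
    have : a ∈ S.Q.neighborSet v := by rw [hN]; exact .inl rfl
    exact this
  have hvb : S.Q.Adj v b := by
    have : b ∈ S.Q.neighborSet v := by rw [hN]; exact .inr rfl
    exact this
  refine ⟨a, b, hva, hvb, hab, ?_⟩
  by_contra hX
  by_cases hadj : S.G.Adj a b
  · refine h.not_reachable_of_Q_adj hva ?_
    have h1 : (S.Q.deleteEdges {s(v, a)}).Adj v b := by
      rw [SimpleGraph.deleteEdges_adj, Set.mem_singleton_iff, Sym2.eq_iff]
      exact ⟨hvb, by rintro (h' | h'); exacts [hab h'.2.symm, hva.ne h'.1]⟩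
    have h2 : (S.Q.deleteEdges {s(v, a)}).Adj a b := by
      rw [SimpleGraph.deleteEdges_adj, Set.mem_singleton_iff, Sym2.eq_iff]
      exact ⟨Q_adj.2 ⟨hadj, hX⟩, by rintro (h' | h'); exacts [hva.ne h'.1.symm, hvb.ne h'.2.symm]⟩
    exact h1.reachable.trans h2.symm.reachable
  · exact hex _ (.suppress S v a b hv hab hQG hadj)

/-- A forest contains no cycle of length four. -/
lemma Inv.eq_of_adj {S : State V} {k : ℕ} (h : S.Inv k) {v v' a b : V} (hab : a ≠ b)
    (h1 : S.Q.Adj v a) (h2 : S.Q.Adj v b) (h3 : S.Q.Adj v' a) (h4 : S.Q.Adj v' b) : v = v' := by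
  by_contra hne
  refine h.not_reachable_of_Q_adj h1 ?_
  have e1 : (S.Q.deleteEdges {s(v, a)}).Adj v b := by
    rw [SimpleGraph.deleteEdges_adj, Set.mem_singleton_iff, Sym2.eq_iff]
    exact ⟨h2, by rintro (h' | h'); exacts [hab h'.2.symm, h1.ne h'.1]⟩
  have e2 : (S.Q.deleteEdges {s(v, a)}).Adj v' b := by
    rw [SimpleGraph.deleteEdges_adj, Set.mem_singleton_iff, Sym2.eq_iff]
    exact ⟨h4, by rintro (h' | h'); exacts [hne h'.1.symm, h3.ne h'.1]⟩
  have e3 : (S.Q.deleteEdges {s(v, a)}).Adj v' a := by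
    rw [SimpleGraph.deleteEdges_adj, Set.mem_singleton_iff, Sym2.eq_iff]
    exact ⟨h3, by rintro (h' | h'); exacts [hne h'.1.symm, h3.ne h'.1]⟩
  exact (e1.reachable.trans e2.symm.reachable).trans e3.reachable

/-- The degree sum of a tree with `n` vertices is `2 * n - 2`; the subtraction is avoided. -/
lemma Inv.sum_degree [Finite V] {S : State V} {k : ℕ} (h : S.Inv k) (hk : 1 ≤ k)
    [Fintype S.verts] :
    ∑ v : S.verts, (S.Q.neighborSet v).ncard + 2 = 2 * Fintype.card S.verts := by
  classical
  set H := S.Q.induce S.verts with hH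
  have hmem : ∀ x y, S.Q.Adj x y → x ∈ S.verts := fun x y hxy => h.adj_mem x y (Q_adj.1 hxy).1
  have hne : Nonempty S.verts := by
    obtain ⟨e, he⟩ : S.X.Nonempty := Set.nonempty_of_ncard_ne_zero (by rw [h.card]; omega)
    induction e with
    | h x y => exact ⟨⟨x, h.adj_mem x y (h.subset he)⟩⟩
  have htree : H.IsTree := by
    refine ⟨⟨fun x y => ?_⟩, h.acyclic.induce _⟩
    have h1 := reachable_map (H := H)
      (fun z => if hz : z ∈ S.verts then (⟨z, hz⟩ : S.verts) else x) ?_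
      (h.reachable x x.2 y y.2)
    · simpa using h1
    · intro a b hab
      rw [dif_pos (hmem a b hab), dif_pos (hmem b a hab.symm)]
      exact SimpleGraph.Adj.reachable (SimpleGraph.induce_adj.2 hab)
  have h1 := htree.card_edgeFinset
  have h2 := H.sum_degrees_eq_twice_card_edges
  have h3 : ∀ v : S.verts, H.degree v = (S.Q.neighborSet v).ncard := by
    intro v
    rw [← SimpleGraph.card_neighborSet_eq_degree, ← Nat.card_eq_fintype_card,
      Nat.card_coe_set_eq, ← Set.ncard_image_of_injective _ Subtype.val_injective]
    congr 1
    ext z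
    simp only [Set.mem_image, SimpleGraph.mem_neighborSet]
    constructor
    · rintro ⟨w, hw, rfl⟩
      exact hw
    · exact fun hz => ⟨⟨z, hmem z v hz.symm⟩, hz, rfl⟩
  simp only [h3] at h2
  omega

/-- The number of vertices of an exhausted instance: a tree has fewer vertices of degree at
least three than leaves, and a vertex of degree two is an endpoint of an edge in `X` or the third
vertex of a triangle with an edge in `X`. -/
theorem Inv.ncard_verts_le [Finite V] {S : State V} {k : ℕ} (h : S.Inv k) (hk : 1 ≤ k)
    (hex : ∀ T, ¬ Step S T) : S.verts.ncard + 2 ≤ 2 * S.leaves.ncard + 3 * k := by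
  classical
  have : Fintype S.verts := Fintype.ofFinite _
  set d : S.verts → ℕ := fun v => (S.Q.neighborSet v).ncard with hd
  have hsum : ∑ v, d v + 2 = 2 * Fintype.card S.verts := h.sum_degree hk
  have hpos : ∀ v, 1 ≤ d v := by
    intro v
    obtain ⟨w, hw⟩ := h.exists_adj hk v.2
    exact Nat.one_le_iff_ne_zero.2 (Set.ncard_ne_zero_of_mem (a := w) hw)
  set A1 := Finset.univ.filter fun v => d v = 1 with hA1
  set A2 := Finset.univ.filter fun v => d v = 2 with hA2
  set A2Y := A2.filter fun v : S.verts => (v : V) ∈ S.Y with hA2Y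
  set A2N := A2.filter fun v : S.verts => ¬ (v : V) ∈ S.Y with hA2N
  have h1 : S.leaves.ncard = A1.card := by
    rw [← Set.ncard_coe_finset, ← Set.ncard_image_of_injective _ Subtype.val_injective]
    congr 1
    ext v
    simp only [leaves, hA1, hd, Set.mem_ofPred_eq, Set.mem_image, Finset.coe_filter,
      Finset.mem_univ, true_and, Subtype.exists, exists_and_left, exists_prop,
      exists_eq_right_right]
    tauto
  have h2 : A2.card = A2Y.card + A2N.card := by
    rw [hA2Y, hA2N, Finset.card_filter_add_card_filter_not]
  have h3 : A2Y.card ≤ 2 * k := by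
    rw [← h.card]
    refine le_trans ?_ S.ncard_Y_le
    rw [← Set.ncard_coe_finset, ← Set.ncard_image_of_injective _ Subtype.val_injective]
    refine Set.ncard_le_ncard ?_ (Set.toFinite _)
    rintro _ ⟨v, hv, rfl⟩
    exact (Finset.mem_filter.1 (Finset.mem_coe.1 hv)).2
  have h4 : A2N.card ≤ k := by
    rw [← h.card, ← Set.ncard_coe_finset]
    have key : ∀ v : S.verts, ∃ a b, v ∈ A2N →
        S.Q.Adj v a ∧ S.Q.Adj v b ∧ a ≠ b ∧ s(a, b) ∈ S.X := by
      intro v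
      by_cases hv : v ∉ A2N
      · exact ⟨v, v, fun h' => absurd h' hv⟩
      rw [not_not] at hv
      rw [hA2N, hA2, Finset.mem_filter, Finset.mem_filter] at hv
      obtain ⟨a, b, hab⟩ := h.exists_edge hex v.2 hv.1.2 hv.2
      exact ⟨a, b, fun _ => hab⟩
    choose a b hab using key
    refine Set.ncard_le_ncard_of_injOn (fun v => s(a v, b v)) (fun v hv => (hab v hv).2.2.2) ?_
      (Set.toFinite _)
    intro v hv v' hv' heq
    rw [Sym2.eq_iff] at heq
    refine Subtype.ext ?_
    obtain ⟨h1, h2, hne, -⟩ := hab v hv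
    obtain ⟨h1', h2', -, -⟩ := hab v' hv'
    rcases heq with ⟨e1, e2⟩ | ⟨e1, e2⟩
    · exact h.eq_of_adj hne h1 h2 (e1 ▸ h1') (e2 ▸ h2')
    · exact h.eq_of_adj hne h1 h2 (e1 ▸ h2') (e2 ▸ h1')
  have h5 : 3 * Fintype.card S.verts ≤ ∑ v, d v + 2 * A1.card + A2.card := by
    have e1 : A1.card = ∑ v, if d v = 1 then 1 else 0 := by rw [Finset.sum_boole]; rfl
    have e2 : A2.card = ∑ v, if d v = 2 then 1 else 0 := by rw [Finset.sum_boole]; rfl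
    rw [e1, e2, Finset.mul_sum, ← Finset.sum_add_distrib, ← Finset.sum_add_distrib,
      ← Finset.card_univ, Nat.mul_comm, ← smul_eq_mul, ← Finset.sum_const]
    refine Finset.sum_le_sum fun v _ => ?_
    have := hpos v
    split_ifs <;> omega
  have h6 : S.verts.ncard = Fintype.card S.verts := by
    rw [← Nat.card_coe_set_eq, Nat.card_eq_fintype_card]
  -- the degree sum is `2 * n - 2`, hence `n + 2 ≤ 2 * A1.card + A2.card`
  omega

end State

end EDP

theorem mainTheorem3 :
    -- the linear kernel
    (∃ K : EDP.Instance → EDP.Instance,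
      EDP.PolyTimeComputable EDP.Instance.encode EDP.Instance.encode K ∧
      (∀ I : EDP.Instance, (K I).IsYes ↔ I.IsYes) ∧
      (∀ I : EDP.Instance, 1 ≤ EDP.fes I.G → (K I).n + 2 ≤ 11 * EDP.fes I.G) ∧
      ∃ c : ℕ, ∀ I : EDP.Instance,
        (K I).n + (K I).G.edgeSet.ncard + (K I).P.ncard + EDP.fes (K I).G
          ≤ c * (EDP.fes I.G + 1)) ∧
    -- the size bound after exhaustive application of the reduction rules
    (∀ (V : Type*) [Finite V] (G : SimpleGraph V) (P X : Set (Sym2 V)),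
      G.Connected → EDP.IsNormalized G P →
      EDP.IsFeedbackEdgeSet G X → X.ncard = EDP.fes G → 1 ≤ X.ncard →
      ∀ S : EDP.State V,
        Relation.ReflTransGen EDP.State.Step
          { verts := Set.univ, G := G, P := P, X := X } S →
        S.Exhausted →
        S.X.ncard = X.ncard ∧
        (S.verts.ncard + 2 ≤ 11 * X.ncard ∨ 4 * X.ncard < S.leaves.ncard)) := by
  refine ⟨EDP.exists_linear_kernel, ?_⟩
  intro V _ G P X hG _ hX hmin hk S hS hex
  have hinv : S.Inv X.ncard := by
    clear hex
    induction hS with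
    | refl => exact EDP.State.inv_of_minimum hG hX hmin
    | tail _ hstep ih => exact hstep.inv hk ih
  refine ⟨hinv.card, ?_⟩
  have := hinv.ncard_verts_le hk hex.1
  omega
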